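/- **Conventions.** For $q\in\mathbb{C}$, $H_n(q)$ is the unital associative $\mathbb{C}$-algebra with generators $T_{s_1},\dots,T_{s_{n-1}}$ and relations $T_{s_i}^2=(q-1)T_{s_i}+q$, $T_{s_i}T_{s_j}=T_{s_j}T_{s_i}$ for $|i-j|\ge 2$, and $T_{s_i}T_{s_{i+1}}T_{s_i}=T_{s_{i+1}}T_{s_i}T_{s_{i+1}}$. For $k\le n$, $H_k(q)$ is mapped to $H_n(q)$ by $T_{s_i}\mapsto T_{s_i}$. For $q\neq 0$ and $1\le k\le n$ let $J_k(q)=\sum_{i=1}^{k-1}q^{i-k}T_{(i,k)}$, where $T_{(i,k)}=T_{s_i}\cdots T_{s_{k-2}}T_{s_{k-1}}T_{s_{k-2}}\cdots T_{s_i}$. Put $$\mathcal{B}_k(q)=\sum_{i=1}^{k}T_{s_{k-1}}T_{s_{k-2}}\cdots T_{s_i},\qquad \mathcal{C}_j^{(n)}=\mathcal{B}_{j+1}(q)\,\mathcal{B}_{j+2}(q)\cdots\mathcal{B}_n(q)\in H_n(q).$$ For a partition $\lambda\vdash n$, $W^\lambda$ is the $\mathbb{C}$-vector space with basis the words $\mathbf{w}=w_1\cdots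 w_n$ that contain the letter $r$ exactly $\lambda_r$ times for every $r$; it is a right $H_n(q)$-module by $\mathbf{w}\,T_{s_i}=q\mathbf{w}$ if $w_i=w_{i+1}$, $\mathbf{w}\,T_{s_i}=\mathbf{w}s_i$ if $w_i<w_{i+1}$, and $\mathbf{w}\,T_{s_i}=q\,\mathbf{w}s_i+(q-1)\mathbf{w}$ if $w_i>w_{i+1}$, where $\mathbf{w}s_i$ is $\mathbf{w}$ with the letters in positions $i,i+1$ exchanged. For partitions $\mu\subseteq\lambda$, $\mathsf{SYT}(\lambda\setminus\mu)$ is the set of bijective fillings of the skew diagram $\lambda\setminus\mu$ by $|\mu|+1,\dots,|\lambda|$ that increase along rows and down columns, and $\mathsf{SYT}(\lambda)=\mathsf{SYT}(\lambda\setminus\emptyset)$. For $\mathfrak{t}\in\mathsf{SYT}(\lambda)$, $\mathrm{word}(\mathfrak{t})\in W^\lambda$ is the word whose $i$-th letter is the row of $\mathfrak{t}$ containing $i$. With $[m]_q=1+q+\cdots+q^{m-1}$ for $m\ge 0$ and $[m]_q=-q^{-1}-\cdots-q^{m}$ for $m<0$, let $\mathfrak{c}_{\mathfrak{t},m}(q)=[y-x]_q$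 where $m$ lies in row $x$ and column $y$ of $\mathfrak{t}$, let $V_m=\{[d]_q:-m<d<m,\ d\ne 0\text{ if }m\in\{2,3\}\}$ (a set of complex numbers), and $$p_{\mathfrak{t}}=\prod_{m=1}^{n}\ \prod_{e\in V_m\setminus\{\mathfrak{c}_{\mathfrak{t},m}(q)\}}\frac{J_m(q)-e}{\mathfrak{c}_{\mathfrak{t},m}(q)-e}\in H_n(q).$$ The Specht module $S^\lambda\subseteq W^\lambda$ is the right $H_n(q)$-submodule generated by the seminormal units $w_{\mathfrak{t}}=\mathrm{word}(\mathfrak{t})\,p_{\mathfrak{t}}$, $\mathfrak{t}\in\mathsf{SYT}(\lambda)$. When $H_n(q)$ is semisimple, $p_\lambda\in H_n(q)$ denotes the canonical projector onto the $S^\lambda$-isotypic component, i.e. the central idempotent for which $\{x\in H_n(q):x\,p_\lambda=x\}$ is the sum of all right ideals of $H_n(q)$ isomorphic to $S^\lambda$. For $\mathfrak{t}\in\mathsf{SYT}(\lambda\setminus\mu)$ with $|\mu|=j$, $|\lambda|=n$, $\Phi_{\mathfrak{t}}:W^\mu\to W^\lambda$ is the linear map (written on the right) $w_1\cdots w_j\mapsto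 w_1\cdots w_jw_{j+1}\cdots w_n$, where, for $i>j$, $w_i$ is the row of $\mathfrak{t}$ containing $i$. A skew shape $\nu\setminus\mu$ (with $\mu\subseteq\nu$) is a horizontal strip if it has at most one box in each column. **Horizontal Strip Lemma.** Let $q\in\mathbb{C}$, $q\ne 0$, and assume that $H_n(q)$ is semisimple. Let $\lambda$ be a partition of $n$ and $\mu$ a partition of $j$, $0\le j\le n$, with $\mu\subseteq\lambda$. Then for every $\mathfrak{t}\in\mathsf{SYT}(\lambda\setminus\mu)$, the set $S^\mu\,\Phi_{\mathfrak{t}}\,\mathcal{C}_j^{(n)}$ is contained in an $H_n(q)$-submodule of $W^\lambda$ that is isomorphic to a quotient of $$\bigoplus_{\substack{\nu\vdash n\\ \nu\setminus\mu\text{ is a horizontal strip}}}S^\nu .$$ Moreover, if $\lambda\setminus\mu$ is not a horizontal strip, then $u\,\Phi_{\mathfrak{t}}\,\mathcal{C}_j^{(n)}\,p_\lambda=0$ for every $u\in S^\mu$. -/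

import Mathlib

noncomputable section

open scoped RightActions

namespace HeckeStrip

/-! ### The Hecke algebra -/

/-- Defining relations of the type `A` Iwahori-Hecke algebra. The index `i : Fin (n - 1)` stands
for the simple transposition exchanging the positions `i` and `i + 1` (counted from `0`). -/
inductive HeckeRel (n : ℕ) (q : ℂ) :
    FreeAlgebra ℂ (Fin (n - 1)) → FreeAlgebra ℂ (Fin (n - 1)) → Prop
  | quad (i : Fin (n - 1)) :
      HeckeRel n q (FreeAlgebra.ι ℂ i * FreeAlgebra.ι ℂ i)
        ((q - 1) • FreeAlgebra.ι ℂ i + q • 1)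
  | comm (i j : Fin (n - 1)) (h : i.val + 2 ≤ j.val) :
      HeckeRel n q (FreeAlgebra.ι ℂ i * FreeAlgebra.ι ℂ j)
        (FreeAlgebra.ι ℂ j * FreeAlgebra.ι ℂ i)
  | braid (i j : Fin (n - 1)) (h : i.val + 1 = j.val) :
      HeckeRel n q (FreeAlgebra.ι ℂ i * FreeAlgebra.ι ℂ j * FreeAlgebra.ι ℂ i)
        (FreeAlgebra.ι ℂ j * FreeAlgebra.ι ℂ i * FreeAlgebra.ι ℂ j)

/-- The Iwahori-Hecke algebra `H_n(q)` over `ℂ`. -/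
def Hecke (n : ℕ) (q : ℂ) : Type := RingQuot (HeckeRel n q)

instance (n : ℕ) (q : ℂ) : Ring (Hecke n q) := inferInstanceAs (Ring (RingQuot (HeckeRel n q)))

instance (n : ℕ) (q : ℂ) : Algebra ℂ (Hecke n q) :=
  inferInstanceAs (Algebra ℂ (RingQuot (HeckeRel n q)))

/-- The quotient map from the free algebra. -/
def Hecke.mk (n : ℕ) (q : ℂ) : FreeAlgebra ℂ (Fin (n - 1)) →ₐ[ℂ] Hecke n q :=
  RingQuot.mkAlgHom ℂ (HeckeRel n q)

/-- The generator `T_{s_k}` of `H_n(q)`, for `1 ≤ k ≤ n - 1`. (It is never used for other `k`.) -/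
def T (n : ℕ) (q : ℂ) (k : ℕ) : Hecke n q :=
  if h : 1 ≤ k ∧ k < n then Hecke.mk n q (FreeAlgebra.ι ℂ ⟨k - 1, by omega⟩) else 1

/-- The element `T_{(i,k)} = T_{s_i} ⋯ T_{s_{k-2}} T_{s_{k-1}} T_{s_{k-2}} ⋯ T_{s_i}`
of the transposition `(i,k)`, for `1 ≤ i < k ≤ n`. -/
def transpT (n : ℕ) (q : ℂ) (i k : ℕ) : Hecke n q :=
  ((List.Ico i (k - 1)).map (T n q)).prod * T n q (k - 1) *
    ((List.Ico i (k - 1)).reverse.map (T n q)).prod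

/-- The Jucys-Murphy element `J_k(q) = ∑_{i=1}^{k-1} q^{i-k} T_{(i,k)}` in `H_n(q)`. -/
def jucysMurphy (n : ℕ) (q : ℂ) (k : ℕ) : Hecke n q :=
  ∑ i ∈ Finset.Ico 1 k, q ^ ((i : ℤ) - (k : ℤ)) • transpT n q i k

/-- The element `B_k(q) = ∑_{i=1}^{k} T_{s_{k-1}} T_{s_{k-2}} ⋯ T_{s_i}`, of `H_k(q)`, viewed in
`H_n(q)`, for `k ≤ n`. -/
def bottomToRandom (n : ℕ) (q : ℂ) (k : ℕ) : Hecke n q :=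
  ∑ i ∈ Finset.Icc 1 k, ((List.Ico i k).reverse.map (T n q)).prod

/-- `C_j^{(n)} = B_{j+1}(q) B_{j+2}(q) ⋯ B_n(q)`. -/
def cElt (n : ℕ) (q : ℂ) (j : ℕ) : Hecke n q :=
  ((List.Ico (j + 1) (n + 1)).map (bottomToRandom n q)).prod

/-! ### Tableaux -/

/-- Standard tableaux of skew shape `lam ∖ mu`: the entries are the numbers
`|mu| + 1, …, |lam|`, each used once, increasing along rows and down columns.
Cells are pairs (row, column). -/
structure SkewSYT (mu lam : YoungDiagram) where
  /-- The entry of a cell. -/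
  entry : {c : ℕ × ℕ // c ∈ lam.cells \ mu.cells} ≃ {k : ℕ // mu.card < k ∧ k ≤ lam.card}
  row_lt : ∀ c d, c.1.1 = d.1.1 → c.1.2 < d.1.2 → (entry c).1 < (entry d).1
  col_lt : ∀ c d, c.1.2 = d.1.2 → c.1.1 < d.1.1 → (entry c).1 < (entry d).1

/-- Standard Young tableaux of shape `lam`. -/
abbrev SYT (lam : YoungDiagram) := SkewSYT ⊥ lam

/-- The cell of `t` that holds the entry `k` (with value `(0,0)` if there is none). -/
def SkewSYT.cell {mu lam : YoungDiagram} (t : SkewSYT mu lam) (k : ℕ) : ℕ × ℕ :=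
  if h : mu.card < k ∧ k ≤ lam.card then (t.entry.symm ⟨k, h⟩).1 else (0, 0)

/-- The content (column minus row) of the cell that holds `k`. -/
def SkewSYT.content {mu lam : YoungDiagram} (t : SkewSYT mu lam) (k : ℕ) : ℤ :=
  ((t.cell k).2 : ℤ) - ((t.cell k).1 : ℤ)

/-- `lam ∖ mu` is a skew shape with at most one cell in each column. -/
def IsHorizontalStrip (mu lam : YoungDiagram) : Prop :=
  mu ≤ lam ∧ ∀ c ∈ lam.cells \ mu.cells, ∀ d ∈ lam.cells \ mu.cells, c.2 = d.2 → c = d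

/-! ### Words -/

/-- The complex vector space with basis the words of length `n` in the alphabet `ℕ`. -/
def WordSpace (n : ℕ) : Type := (Fin n → ℕ) →₀ ℂ

instance (n : ℕ) : AddCommGroup (WordSpace n) := inferInstanceAs (AddCommGroup (_ →₀ ℂ))

instance (n : ℕ) : Module ℂ (WordSpace n) := inferInstanceAs (Module ℂ (_ →₀ ℂ))

/-- The word `w`, as a basis vector. -/
def WordSpace.of {n : ℕ} (w : Fin n → ℕ) : WordSpace n := Finsupp.single w 1

/-- The linear map with prescribed values on words. -/
def WordSpace.lift {n : ℕ} {M : Type*} [AddCommGroup M] [Module ℂ M] (f : (Fin n → ℕ) → M) :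
    WordSpace n →ₗ[ℂ] M := Finsupp.linearCombination ℂ f

theorem WordSpace.lift_of {n : ℕ} {M : Type*} [AddCommGroup M] [Module ℂ M]
    (f : (Fin n → ℕ) → M) (w : Fin n → ℕ) : WordSpace.lift f (WordSpace.of w) = f w :=
  (Finsupp.linearCombination_single ℂ 1 w).trans (one_smul ℂ (f w))

theorem WordSpace.hom_ext {n : ℕ} {M : Type*} [AddCommGroup M] [Module ℂ M]
    {f g : WordSpace n →ₗ[ℂ] M} (h : ∀ w, f (WordSpace.of w) = g (WordSpace.of w)) : f = g :=
  Finsupp.lhom_ext' fun w => LinearMap.ext_ring (h w)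

/-- The `q`-deformed exchange of the letters of a word at the positions `a` and `b`. -/
def exch (q : ℂ) {n : ℕ} (a b : Fin n) : WordSpace n →ₗ[ℂ] WordSpace n :=
  WordSpace.lift fun w =>
    if w a = w b then q • WordSpace.of w
    else if w a < w b then WordSpace.of (w ∘ Equiv.swap a b)
    else q • WordSpace.of (w ∘ Equiv.swap a b) + (q - 1) • WordSpace.of w

theorem exch_eq (q : ℂ) {n : ℕ} {a b : Fin n} {w : Fin n → ℕ} (h : w a = w b) :
    exch q a b (WordSpace.of w) = q • WordSpace.of w := by
  simp [exch, WordSpace.lift_of, h]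

theorem exch_lt (q : ℂ) {n : ℕ} {a b : Fin n} {w : Fin n → ℕ} (h : w a < w b) :
    exch q a b (WordSpace.of w) = WordSpace.of (w ∘ Equiv.swap a b) := by
  simp [exch, WordSpace.lift_of, h, h.ne]

theorem exch_gt (q : ℂ) {n : ℕ} {a b : Fin n} {w : Fin n → ℕ} (h : w b < w a) :
    exch q a b (WordSpace.of w) =
      q • WordSpace.of (w ∘ Equiv.swap a b) + (q - 1) • WordSpace.of w := by
  simp [exch, WordSpace.lift_of, h.ne', h.not_gt]

theorem exch_quad (q : ℂ) {n : ℕ} (a b : Fin n) (w : Fin n → ℕ) :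
    exch q a b (exch q a b (WordSpace.of w)) =
      (q - 1) • exch q a b (WordSpace.of w) + q • WordSpace.of w := by
  have hs : (w ∘ Equiv.swap a b) ∘ Equiv.swap a b = w := by ext x; simp
  rcases lt_trichotomy (w a) (w b) with h | h | h
  · rw [exch_lt q h, exch_gt q (by simpa using h), hs]; module
  · rw [exch_eq q h, map_smul, exch_eq q h]; module
  · rw [exch_gt q h, map_add, map_smul, map_smul, exch_lt q (by simpa using h), hs, exch_gt q h]
    module

theorem exch_comm (q : ℂ) {n : ℕ} (a b c d : Fin n) (hac : a ≠ c) (had : a ≠ d) (hbc : b ≠ c)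
    (hbd : b ≠ d) (w : Fin n → ℕ) :
    exch q a b (exch q c d (WordSpace.of w)) = exch q c d (exch q a b (WordSpace.of w)) := by
  have hs : (w ∘ Equiv.swap a b) ∘ Equiv.swap c d = (w ∘ Equiv.swap c d) ∘ Equiv.swap a b := by
    ext x
    simp only [Function.comp, Equiv.swap_apply_def]
    grind
  have e1 : (w ∘ Equiv.swap a b) c = w c := by
    simp [Equiv.swap_apply_of_ne_of_ne hac.symm hbc.symm]
  have e2 : (w ∘ Equiv.swap a b) d = w d := by
    simp [Equiv.swap_apply_of_ne_of_ne had.symm hbd.symm]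
  have e3 : (w ∘ Equiv.swap c d) a = w a := by
    simp [Equiv.swap_apply_of_ne_of_ne hac had]
  have e4 : (w ∘ Equiv.swap c d) b = w b := by
    simp [Equiv.swap_apply_of_ne_of_ne hbc hbd]
  simp only [exch, WordSpace.lift_of]
  split_ifs <;> simp only [map_smul, map_add, WordSpace.lift_of, *, if_true, if_false] <;> module

theorem exch_braid (q : ℂ) {n : ℕ} (a b c : Fin n) (hab : a ≠ b) (hac : a ≠ c) (hbc : b ≠ c)
    (w : Fin n → ℕ) :
    exch q a b (exch q b c (exch q a b (WordSpace.of w))) =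
      exch q b c (exch q a b (exch q b c (WordSpace.of w))) := by
  have hbr : ((w ∘ Equiv.swap a b) ∘ Equiv.swap b c) ∘ Equiv.swap a b =
      ((w ∘ Equiv.swap b c) ∘ Equiv.swap a b) ∘ Equiv.swap b c := by
    ext x
    simp only [Function.comp, Equiv.swap_apply_def]
    grind
  have hs1 : ∀ v : Fin n → ℕ, (v ∘ Equiv.swap a b) ∘ Equiv.swap a b = v := fun v => by
    ext x; simp
  have hs2 : ∀ v : Fin n → ℕ, (v ∘ Equiv.swap b c) ∘ Equiv.swap b c = v := fun v => by
    ext x; simp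
  have e1 : ∀ v : Fin n → ℕ, (v ∘ Equiv.swap a b) a = v b := fun v => by simp
  have e2 : ∀ v : Fin n → ℕ, (v ∘ Equiv.swap a b) b = v a := fun v => by simp
  have e3 : ∀ v : Fin n → ℕ, (v ∘ Equiv.swap a b) c = v c := fun v => by
    simp [Equiv.swap_apply_of_ne_of_ne hac.symm hbc.symm]
  have f1 : ∀ v : Fin n → ℕ, (v ∘ Equiv.swap b c) a = v a := fun v => by
    simp [Equiv.swap_apply_of_ne_of_ne hab hac]
  have f2 : ∀ v : Fin n → ℕ, (v ∘ Equiv.swap b c) b = v c := fun v => by simp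
  have f3 : ∀ v : Fin n → ℕ, (v ∘ Equiv.swap b c) c = v b := fun v => by simp
  rcases lt_trichotomy (w a) (w b) with h | h | h <;>
  rcases lt_trichotomy (w b) (w c) with k | k | k <;>
  rcases lt_trichotomy (w a) (w c) with l | l | l <;>
  first
  | omega
  | (simp (disch := ((try simp only [e1, e2, e3, f1, f2, f3]); omega)) only [exch_lt, exch_eq, exch_gt,
      map_smul, map_add, hs1, hs2, hbr]
     done)
  | (simp (disch := ((try simp only [e1, e2, e3, f1, f2, f3]); omega)) only [exch_lt, exch_eq, exch_gt,
      map_smul, map_add, hs1, hs2, hbr]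
     module)

/-- The right action of `H_n(q)` on words: the generator of index `i` acts by the `q`-deformed
exchange of the letters at the adjacent positions `i` and `i + 1`. -/
def wordRep (n : ℕ) (q : ℂ) : Hecke n q →ₐ[ℂ] (Module.End ℂ (WordSpace n))ᵐᵒᵖ :=
  RingQuot.liftAlgHom ℂ (s := HeckeRel n q)
    ⟨FreeAlgebra.lift ℂ fun i : Fin (n - 1) =>
        MulOpposite.op (exch q (⟨i.val, by omega⟩ : Fin n) ⟨i.val + 1, by omega⟩), by
      intro x y h
      induction h with
      | quad i =>
        simp only [map_mul, map_add, map_smul, map_one, FreeAlgebra.lift_ι_apply]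
        apply MulOpposite.unop_injective
        refine WordSpace.hom_ext fun w => ?_
        exact exch_quad q _ _ w
      | comm i j h =>
        simp only [map_mul, FreeAlgebra.lift_ι_apply]
        apply MulOpposite.unop_injective
        refine WordSpace.hom_ext fun w => ?_
        refine exch_comm q _ _ _ _ ?_ ?_ ?_ ?_ w <;> simp only [ne_eq, Fin.mk.injEq] <;> omega
      | braid i j h =>
        obtain ⟨j, hj⟩ := j
        obtain rfl : i.val + 1 = j := h
        simp only [map_mul, FreeAlgebra.lift_ι_apply]
        apply MulOpposite.unop_injective
        refine WordSpace.hom_ext fun w => ?_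
        refine exch_braid q _ _ _ ?_ ?_ ?_ w <;> simp only [ne_eq, Fin.mk.injEq] <;> omega⟩

/-- `WordSpace n` as a right module over `H_n(q)`; `v <• x` is the right action. -/
instance (n : ℕ) (q : ℂ) : Module (Hecke n q)ᵐᵒᵖ (WordSpace n) where
  smul x v := (wordRep n q x.unop).unop v
  one_smul v := by
    change (wordRep n q (1 : Hecke n q)).unop v = v
    rw [map_one]; rfl
  mul_smul x y v := by
    change (wordRep n q (y.unop * x.unop)).unop v = _
    rw [map_mul]; rfl
  smul_zero x := map_zero (wordRep n q x.unop).unop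
  smul_add x := map_add (wordRep n q x.unop).unop
  add_smul x y v := by
    change (wordRep n q (x.unop + y.unop)).unop v = _
    rw [map_add]; rfl
  zero_smul v := by
    change (wordRep n q (0 : Hecke n q)).unop v = 0
    rw [map_zero]; rfl

theorem word_smul_def {n : ℕ} {q : ℂ} (v : WordSpace n) (x : Hecke n q) :
    v <• x = (wordRep n q x).unop v := rfl

theorem wordRep_gen (n : ℕ) (q : ℂ) (i : Fin (n - 1)) :
    (wordRep n q (Hecke.mk n q (FreeAlgebra.ι ℂ i))).unop =
      exch q (⟨i.val, by omega⟩ : Fin n) ⟨i.val + 1, by omega⟩ :=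
  congrArg MulOpposite.unop
    ((RingQuot.liftAlgHom_mkAlgHom_apply ℂ _ _ _).trans (FreeAlgebra.lift_ι_apply _ _))

/-- The word `w` has content `lam`: the letter `r` occurs `lam_r` times (rows, and so letters,
are counted from `0`). -/
def HasContent {n : ℕ} (lam : YoungDiagram) (w : Fin n → ℕ) : Prop :=
  ∀ r, (Finset.univ.filter fun i => w i = r).card = lam.rowLen r

theorem HasContent.comp {n : ℕ} {lam : YoungDiagram} {w : Fin n → ℕ} (h : HasContent lam w)
    (σ : Equiv.Perm (Fin n)) : HasContent lam (w ∘ σ) := by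
  intro r
  rw [← h r]
  exact Finset.card_equiv σ (by simp)

theorem exch_mem {n : ℕ} (q : ℂ) (a b : Fin n) (lam : YoungDiagram) {v : WordSpace n}
    (hv : v ∈ Submodule.span ℂ (WordSpace.of '' {w : Fin n → ℕ | HasContent lam w})) :
    exch q a b v ∈ Submodule.span ℂ (WordSpace.of '' {w : Fin n → ℕ | HasContent lam w}) := by
  have key : ∀ w : Fin n → ℕ, HasContent lam w → WordSpace.of w ∈
      Submodule.span ℂ (WordSpace.of '' {w : Fin n → ℕ | HasContent lam w}) :=
    fun w hw => Submodule.subset_span ⟨w, hw, rfl⟩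
  induction hv using Submodule.span_induction with
  | mem x hx =>
    obtain ⟨w, hw, rfl⟩ := hx
    rcases lt_trichotomy (w a) (w b) with h | h | h
    · rw [exch_lt q h]; exact key _ (hw.comp _)
    · rw [exch_eq q h]; exact Submodule.smul_mem _ _ (key _ hw)
    · rw [exch_gt q h]
      exact Submodule.add_mem _ (Submodule.smul_mem _ _ (key _ (hw.comp _)))
        (Submodule.smul_mem _ _ (key _ hw))
  | zero => simp
  | add x y _ _ hx hy => rw [map_add]; exact Submodule.add_mem _ hx hy
  | smul c x _ hx => rw [map_smul]; exact Submodule.smul_mem _ _ hx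

/-- The right `H_n(q)`-module `W^lam` spanned over `ℂ` by the words of content `lam`
(for `lam` a partition of `n`). -/
def wordModule (n : ℕ) (q : ℂ) (lam : YoungDiagram) : Submodule (Hecke n q)ᵐᵒᵖ (WordSpace n) where
  carrier := Submodule.span ℂ (WordSpace.of '' {w : Fin n → ℕ | HasContent lam w})
  zero_mem' := Submodule.zero_mem _
  add_mem' := Submodule.add_mem _
  smul_mem' x v hv := by
    obtain ⟨x, rfl⟩ := MulOpposite.op_surjective x
    obtain ⟨f, rfl⟩ := RingQuot.mkAlgHom_surjective ℂ (HeckeRel n q) x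
    change (wordRep n q (Hecke.mk n q f)).unop v ∈ Submodule.span ℂ _
    induction f using FreeAlgebra.induction generalizing v with
    | grade0 r =>
      rw [AlgHom.commutes, AlgHom.commutes]
      exact Submodule.smul_mem _ r hv
    | grade1 i => rw [wordRep_gen]; exact exch_mem q _ _ lam hv
    | mul f g hf hg =>
      rw [map_mul, map_mul]
      exact hg _ (hf _ hv)
    | add f g hf hg =>
      rw [map_add, map_add]
      exact Submodule.add_mem _ (hf _ hv) (hg _ hv)

/-- The word of `t`: its `i`-th letter is the row of `t` that holds the entry `i`. -/
def wordOf (n : ℕ) {lam : YoungDiagram} (t : SYT lam) : Fin n → ℕ :=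
  fun i => (t.cell (i.val + 1)).1

/-- The concatenation operator `Φ_t` from words of length `j = |mu|` to words of length
`n = |lam|`: it extends a word by the letters whose `i`-th one, for `j < i ≤ n`, is the row of `t`
that holds the entry `i`. -/
def phi (j n : ℕ) {mu lam : YoungDiagram} (t : SkewSYT mu lam) : WordSpace j →ₗ[ℂ] WordSpace n :=
  WordSpace.lift fun w => WordSpace.of fun i : Fin n =>
    if h : i.val < j then w ⟨i.val, h⟩ else (t.cell (i.val + 1)).1

/-! ### Young idempotents, Specht modules, isotypic projectors -/

/-- The `q`-integer `[m]_q`, `m ∈ ℤ`: it is `1 + q + ⋯ + q^{m-1}` for `m ≥ 0` and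
`-q^{-1} - q^{-2} - ⋯ - q^{m}` for `m < 0`. -/
def qInt (q : ℂ) (m : ℤ) : ℂ :=
  ∑ i ∈ Finset.range m.toNat, q ^ i - ∑ i ∈ Finset.range (-m).toNat, q⁻¹ ^ (i + 1)

/-- The set of the possible contents of the entry `m` in standard Young tableaux. -/
def contents (m : ℕ) : Finset ℤ :=
  (Finset.Ioo (-(m : ℤ)) m).filter fun k => ¬ (k = 0 ∧ (m = 2 ∨ m = 3))

open Classical in
/-- The Young idempotent `p_t = ∏_m ∏_e (J_m(q) - e) / (c_{t,m}(q) - e)` in `H_n(q)`, for `t` of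
size `n`. For each `m = 1, …, n` the inner product (Lagrange interpolation, evaluated at `J_m(q)`)
is over the distinct values `e = [d]_q`, `d ∈ contents m`, other than the `q`-content
`c_{t,m}(q)` of `m` in `t`, so that no denominator vanishes. -/
def youngIdempotent (n : ℕ) (q : ℂ) {lam : YoungDiagram} (t : SYT lam) : Hecke n q :=
  ((List.Ico 1 (n + 1)).map fun m =>
    Polynomial.aeval (jucysMurphy n q m)
      (Lagrange.basis ((contents m).image (qInt q)) id (qInt q (t.content m)))).prod

/-- The Young seminormal unit `w_t = word(t) p_t`. -/
def seminormalUnit (n : ℕ) (q : ℂ) {lam : YoungDiagram} (t : SYT lam) : WordSpace n :=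
  WordSpace.of (wordOf n t) <• youngIdempotent n q t

/-- The Specht module `S^lam` (for `lam` a partition of `n`): the right `H_n(q)`-module generated
by the seminormal units `w_t`, `t` a standard Young tableau of shape `lam`. -/
def specht (n : ℕ) (q : ℂ) (lam : YoungDiagram) : Submodule (Hecke n q)ᵐᵒᵖ (WordSpace n) :=
  Submodule.span _ (Set.range fun t : SYT lam => seminormalUnit n q t)

/-- `p` is the canonical projector of the algebra `A` onto its `S`-isotypic component, for a simple
right module `S`: the central idempotent of `A` whose fixed elements, under right multiplication,
form the sum of all right ideals isomorphic to `S`. -/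
structure IsIsotypicProjector (A : Type*) [Ring A] (S : Type*) [AddCommGroup S] [Module Aᵐᵒᵖ S]
    (p : A) : Prop where
  idem : p * p = p
  central : ∀ x, x * p = p * x
  range : ∀ x : A, x * p = x ↔ x ∈ isotypicComponent Aᵐᵒᵖ A S

/-- The canonical projector `p_lam` of `H_n(q)` onto the isotypic component of `S^lam`. -/
def isotypicProjector (n : ℕ) (q : ℂ) (lam : YoungDiagram) : Hecke n q :=
  Classical.epsilon (IsIsotypicProjector (Hecke n q) (specht n q lam))

end HeckeStrip
end

/-! The method is that of Okounkov and Vershik. Semisimplicity enters only through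
`qGood_of_isSemisimpleRing`: the q-integers [1], …, [n] are nonzero, for otherwise the full
symmetrizer would be a nonzero element of square zero spanning a left ideal without a complement.
Hence contents that differ by at most n have distinct q-contents.

A standard tableau is encoded by its lattice word r, where r k is the row of the entry k + 1
(positions and rows are counted from 0). Every module is a sum of simultaneous eigenvectors of the
Jucys-Murphy elements, and the eigenvalue sequences that occur are the q-content sequences of
standard tableaux (`HeckeFam.branches`). Intertwiners pass invertibly between tableaux that differ
by an admissible exchange of neighbouring entries, so a weight vector can be carried to every
tableau of its shape (`HeckeFam.transport`). With multiplicity one (`HeckeFam.multiplicity_one`),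
the module generated by a nonzero weight vector depends only on the shape. To identify it with the
Specht module defined by words one must know that the row reading word has a nonzero component of
its own weight (`spechtVector_ne_zero`). This is a dominance argument: components of the row reading
word are built from horizontal strips, some component of the column reading word is built from
vertical strips, and together these force the shape.

For the lemma itself, T_i C_j = q C_j for the generators of the last n - j positions. So, up to the
nonzero scalar [n - j]!, C_j may be preceded by the symmetrizer of these positions, and the set in
question lies in the module generated by one vector Y (`stripVector`). On the first j positions Y
has the weight of the row reading tableau of mu; on the others it is q-invariant. Invariance makes
an intertwiner send the component P_r Y to a nonzero multiple of the component for the exchanged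
word, and makes P_r Y vanish if r has vertical neighbours in the tail. Consequently the shapes nu of
nonzero components make nu ∖ mu a horizontal strip, and all components of one shape lie in the
module generated by any nonzero one of them, a copy of S^nu. As Y is the sum of its components, its
module is a quotient of the stated direct sum. If lam ∖ mu is not a horizontal strip, this module
has no component of shape lam, and the isotypic projector kills it. -/

noncomputable section
namespace HeckeStrip

/-! ### Lattice words -/

/-- The number of the letters `a` among the first `k` letters of `r`. -/
def cnt (r : ℕ → ℕ) (k a : ℕ) : ℕ := ((Finset.range k).filter fun i => r i = a).card

@[simp] theorem cnt_zero (r : ℕ → ℕ) (a : ℕ) : cnt r 0 a = 0 := by simp [cnt]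

theorem cnt_succ (r : ℕ → ℕ) (k a : ℕ) :
    cnt r (k + 1) a = cnt r k a + if r k = a then 1 else 0 := by
  unfold cnt
  rw [Finset.range_add_one, Finset.filter_insert]
  split_ifs with h
  · rw [Finset.card_insert_of_notMem (by simp)]
  · rfl

theorem cnt_mono (r : ℕ → ℕ) (a : ℕ) : Monotone fun k => cnt r k a :=
  monotone_nat_of_le_succ fun k => by simp only [cnt_succ]; omega

theorem cnt_congr {r r' : ℕ → ℕ} {k : ℕ} (h : ∀ i < k, r i = r' i) : cnt r k = cnt r' k := by
  funext a
  unfold cnt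
  congr 1
  exact Finset.filter_congr fun i hi => by rw [h i (Finset.mem_range.1 hi)]

theorem sum_cnt_range (r : ℕ → ℕ) (k b : ℕ) :
    ∑ a ∈ Finset.range b, cnt r k a = ((Finset.range k).filter fun i => r i < b).card := by
  unfold cnt
  rw [← Finset.card_biUnion]
  · congr 1
    ext i
    simp only [Finset.mem_biUnion, Finset.mem_filter, Finset.mem_range]
    constructor
    · rintro ⟨a, h1, h2, h3⟩; exact ⟨h2, h3 ▸ h1⟩
    · rintro ⟨h1, h2⟩; exact ⟨_, h2, h1, rfl⟩
  · intro x _ y _ hxy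
    rw [Function.onFun, Finset.disjoint_left]
    intro i h1 h2
    exact hxy ((Finset.mem_filter.1 h1).2.symm.trans (Finset.mem_filter.1 h2).2)

theorem sum_cnt_le (r : ℕ → ℕ) (k b : ℕ) : ∑ a ∈ Finset.range b, cnt r k a ≤ k := by
  rw [sum_cnt_range]
  exact (Finset.card_filter_le _ _).trans (by simp)

/-- All prefixes of length at most `m` of the word `r` have a partition as content. -/
def Lattice (m : ℕ) (r : ℕ → ℕ) : Prop := ∀ k ≤ m, Antitone (cnt r k)

/-- A box can be added to the row `b` of the partition `p`. -/
def Addable (p : ℕ → ℕ) (b : ℕ) : Prop := ∀ a < b, p b < p a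

/-- The content of the box that corresponds to the position `k` of the word `r`. -/
def ct (r : ℕ → ℕ) (k : ℕ) : ℤ := (cnt r k (r k) : ℤ) - (r k : ℤ)

theorem ct_congr {r r' : ℕ → ℕ} {k : ℕ} (h : ∀ i < k + 1, r i = r' i) : ct r k = ct r' k := by
  unfold ct
  rw [cnt_congr (fun i hi => h i (by omega)), h k (by omega)]

theorem Lattice.mono {m m' : ℕ} {r : ℕ → ℕ} (h : Lattice m r) (hm : m' ≤ m) : Lattice m' r :=
  fun k hk => h k (hk.trans hm)

theorem Lattice.congr {m : ℕ} {r r' : ℕ → ℕ} (h : Lattice m r) (e : ∀ i < m, r i = r' i) :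
    Lattice m r' := fun k hk => by
  rw [← cnt_congr fun i hi => e i (by omega)]; exact h k hk

theorem lattice_zero (r : ℕ → ℕ) : Lattice 0 r := fun k hk => by
  obtain rfl : k = 0 := by omega
  intro a b _; simp

theorem Lattice.addable {m k : ℕ} {r : ℕ → ℕ} (h : Lattice m r) (hk : k < m) :
    Addable (cnt r k) (r k) := fun a ha => by
  have := h (k + 1) hk ha.le
  simp only [cnt_succ, if_true] at this
  rw [if_neg ha.ne'] at this
  omega

theorem lattice_succ {m : ℕ} {r : ℕ → ℕ} (h : Lattice m r) (ha : Addable (cnt r m) (r m)) :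
    Lattice (m + 1) r := fun k hk => by
  rcases Nat.lt_or_ge k (m + 1) with hk' | hk'
  · exact h k (by omega)
  · obtain rfl : k = m + 1 := by omega
    intro a b hab
    simp only [cnt_succ]
    have h1 := h m le_rfl hab
    split_ifs with h2 h3 h3 <;> try omega
    have := ha a (by omega)
    rw [h2] at this
    omega

theorem cnt_eq_zero_of_lattice {m k a : ℕ} {r : ℕ → ℕ} (h : Lattice m r) (hk : k ≤ m)
    (ha : k ≤ a) : cnt r k a = 0 := by
  by_contra h0
  have h1 : ∑ b ∈ Finset.range (a + 1), 1 ≤ ∑ b ∈ Finset.range (a + 1), cnt r k b :=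
    Finset.sum_le_sum fun b hb => by
      have := h k hk (show b ≤ a by simp at hb; omega)
      omega
  have h2 := sum_cnt_le r k (a + 1)
  simp at h1
  omega

/-- A hook bound: all rows above an addable row are nonempty, so the β - 1 of them other than α use
at least β - 1 of the k boxes. -/
theorem addable_le {p : ℕ → ℕ} {r : ℕ → ℕ} {k α β : ℕ} (hp : p = cnt r k) (hβ : Addable p β)
    (hαβ : α < β) : p α + β ≤ k + 1 := by
  subst hp
  have h2 := sum_cnt_le r k β
  rw [← Finset.add_sum_erase _ _ (Finset.mem_range.2 hαβ)] at h2
  have h1 : ∑ b ∈ (Finset.range β).erase α, 1 ≤ ∑ b ∈ (Finset.range β).erase α, cnt r k b :=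
    Finset.sum_le_sum fun b hb => by
      have := hβ b (by simp at hb; omega)
      omega
  rw [Finset.sum_const, Finset.card_erase_of_mem (Finset.mem_range.2 hαβ)] at h1
  simp at h1
  omega

theorem addable_le_self {r : ℕ → ℕ} {k β : ℕ} (hβ : Addable (cnt r k) β) : β ≤ k := by
  rcases Nat.eq_zero_or_pos β with h | h
  · omega
  · have := addable_le rfl hβ h
    have := hβ 0 h
    omega

/-- Two corners of one shape never lie on equal or adjacent diagonals. The upper bound is what lets
`QGood n q` separate their q-contents when k < n. -/
theorem addable_content_diff {r : ℕ → ℕ} {k α β : ℕ}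
    (hα : Addable (cnt r k) α) (hβ : Addable (cnt r k) β) (h : α ≠ β) :
    2 ≤ |((cnt r k α : ℤ) - α) - ((cnt r k β : ℤ) - β)| ∧
      |((cnt r k α : ℤ) - α) - ((cnt r k β : ℤ) - β)| ≤ k + 1 := by
  rcases lt_or_gt_of_ne h with h | h
  · have h1 := addable_le rfl hβ h
    have h2 := hβ α h
    rw [abs_of_nonneg (by omega)]; omega
  · have h1 := addable_le rfl hα h
    have h2 := hα β h
    rw [abs_of_nonpos (by omega)]; omega

/-! ### Admissible exchanges of neighbours -/

/-- The word with the letters at the positions `k` and `k + 1` exchanged. -/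
def swapAt (r : ℕ → ℕ) (k : ℕ) : ℕ → ℕ := r ∘ Equiv.swap k (k + 1)

theorem swapAt_left (r : ℕ → ℕ) (k : ℕ) : swapAt r k k = r (k + 1) := by simp [swapAt]

theorem swapAt_right (r : ℕ → ℕ) (k : ℕ) : swapAt r k (k + 1) = r k := by simp [swapAt]

theorem swapAt_of_ne (r : ℕ → ℕ) {k i : ℕ} (h1 : i ≠ k) (h2 : i ≠ k + 1) :
    swapAt r k i = r i := by simp [swapAt, Equiv.swap_apply_of_ne_of_ne h1 h2]

theorem swapAt_swapAt (r : ℕ → ℕ) (k : ℕ) : swapAt (swapAt r k) k = r := by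
  ext i; simp [swapAt]

theorem cnt_swapAt_le (r : ℕ → ℕ) {k m : ℕ} (h : m ≤ k) : cnt (swapAt r k) m = cnt r m :=
  cnt_congr fun i hi => swapAt_of_ne r (by omega) (by omega)

theorem cnt_swapAt_ge (r : ℕ → ℕ) {k m : ℕ} (h : k + 2 ≤ m) : cnt (swapAt r k) m = cnt r m := by
  induction m, h using Nat.le_induction with
  | base =>
    funext a
    simp only [cnt_succ, cnt_swapAt_le r le_rfl, swapAt_left, swapAt_right]
    omega
  | succ m hm ih =>
    funext a
    rw [cnt_succ, cnt_succ, ih, swapAt_of_ne r (by omega) (by omega)]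

/-- The boxes at the positions `k` and `k + 1` are neighbours in a column. -/
def Vertical (r : ℕ → ℕ) (k : ℕ) : Prop :=
  r (k + 1) = r k + 1 ∧ cnt r k (r k) = cnt r k (r (k + 1))

/-- The boxes at the positions `k` and `k + 1` are not neighbours. -/
def Swappable (r : ℕ → ℕ) (k : ℕ) : Prop := r k ≠ r (k + 1) ∧ ¬ Vertical r k

/-- Only the box at k can obstruct adding the box at k + 1 first. It does so only from the row
directly above and with equal row lengths, which is the vertical case. -/
theorem Swappable.addable {m k : ℕ} {r : ℕ → ℕ} (hr : Lattice m r) (hk : k + 1 < m)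
    (h : Swappable r k) : Addable (cnt r k) (r (k + 1)) := fun a ha => by
  have h1 := hr.addable hk a ha
  simp only [cnt_succ, if_neg h.1] at h1
  by_contra hc
  have hra : r k = a := by
    by_contra hne
    rw [if_neg hne] at h1
    omega
  subst hra
  have h2 := hr k (by omega) ha.le
  rcases Nat.lt_or_ge (r k + 1) (r (k + 1)) with h3 | h3
  · have h4 := hr.addable hk (r k + 1) h3
    have h5 := hr k (by omega) (show r k ≤ r k + 1 by omega)
    simp only [cnt_succ, if_neg h.1] at h4
    rw [if_neg (show ¬ r k = r k + 1 by omega)] at h4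
    omega
  · exact h.2 ⟨by omega, by omega⟩

theorem Lattice.swapAt {m k : ℕ} {r : ℕ → ℕ} (hr : Lattice m r) (hk : k + 1 < m)
    (h : Swappable r k) : Lattice m (swapAt r k) := fun l hl => by
  rcases Nat.lt_or_ge k l with h1 | h1
  · rcases Nat.lt_or_ge (k + 1) l with h2 | h2
    · rw [cnt_swapAt_ge r (by omega)]; exact hr l hl
    · obtain rfl : l = k + 1 := by omega
      have h3 : Lattice k (HeckeStrip.swapAt r k) :=
        (hr.mono (by omega)).congr fun i hi => (swapAt_of_ne r (by omega) (by omega)).symm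
      refine lattice_succ h3 ?_ _ le_rfl
      rw [cnt_swapAt_le r le_rfl, swapAt_left]
      exact h.addable hr hk
  · rw [cnt_swapAt_le r h1]; exact hr l hl

theorem Swappable.swapAt {m k : ℕ} {r : ℕ → ℕ} (hr : Lattice m r) (hk : k + 1 < m)
    (h : Swappable r k) : Swappable (swapAt r k) k := by
  refine ⟨by rw [swapAt_left, swapAt_right]; exact h.1.symm, ?_⟩
  rintro ⟨h1, h2⟩
  rw [swapAt_left, swapAt_right, cnt_swapAt_le r le_rfl] at *
  have := hr.addable (show k < m by omega) (r (k + 1)) (by omega)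
  omega

theorem ct_swapAt_left {r : ℕ → ℕ} {k : ℕ} (h : r k ≠ r (k + 1)) :
    ct (swapAt r k) k = ct r (k + 1) := by
  unfold ct
  rw [swapAt_left, cnt_swapAt_le r le_rfl, cnt_succ, if_neg h, add_zero]

theorem ct_swapAt_right {r : ℕ → ℕ} {k : ℕ} (h : r k ≠ r (k + 1)) :
    ct (swapAt r k) (k + 1) = ct r k := by
  have := ct_swapAt_left (r := swapAt r k) (k := k) (by rw [swapAt_left, swapAt_right]; exact h.symm)
  rw [swapAt_swapAt] at this
  exact this.symm

theorem ct_swapAt_of_ne {r : ℕ → ℕ} {k i : ℕ} (h1 : i ≠ k) (h2 : i ≠ k + 1) :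
    ct (swapAt r k) i = ct r i := by
  unfold ct
  rw [swapAt_of_ne r h1 h2]
  rcases Nat.lt_or_ge i k with h | h
  · rw [cnt_swapAt_le r h.le]
  · rw [cnt_swapAt_ge r (by omega)]

theorem Swappable.content_diff {m k : ℕ} {r : ℕ → ℕ} (hr : Lattice m r) (hk : k + 1 < m)
    (h : Swappable r k) : 2 ≤ |ct r k - ct r (k + 1)| ∧ |ct r k - ct r (k + 1)| ≤ k + 1 := by
  rw [← ct_swapAt_left h.1]
  unfold ct
  rw [swapAt_left, cnt_swapAt_le r le_rfl]
  exact addable_content_diff (hr.addable (by omega)) (h.addable hr hk) h.1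

/-- The predicate `P` on lattice words of length `N` is stable under the admissible exchanges of
neighbours at positions in `[j, m)`. -/
def SwapClosed (N j m : ℕ) (P : (ℕ → ℕ) → Prop) : Prop :=
  ∀ r k, Lattice N r → j ≤ k → k + 1 < m → Swappable r k → P r → P (swapAt r k)

theorem SwapClosed.mono {N j m m' : ℕ} {P : (ℕ → ℕ) → Prop} (h : SwapClosed N j m P)
    (hm : m' ≤ m) : SwapClosed N j m' P :=
  fun r k hr hj hk => h r k hr hj (by omega)

theorem exists_last_letter {r : ℕ → ℕ} {j m γ : ℕ} (h : cnt r j γ < cnt r m γ) :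
    ∃ i, j ≤ i ∧ i < m ∧ r i = γ ∧ cnt r m γ = cnt r i γ + 1 := by
  induction m with
  | zero => simp at h
  | succ m ih =>
    rcases Nat.lt_or_ge m j with hm | hm
    · have := cnt_mono r γ (show m + 1 ≤ j by omega)
      simp only at this
      omega
    by_cases hγ : r m = γ
    · exact ⟨m, hm, by omega, hγ, by rw [cnt_succ, if_pos hγ]⟩
    · rw [cnt_succ, if_neg hγ, add_zero] at h
      obtain ⟨i, h1, h2, h3, h4⟩ := ih h
      exact ⟨i, h1, by omega, h3, by rw [cnt_succ, if_neg hγ, add_zero]; exact h4⟩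

theorem exists_letter_with_count {r : ℕ → ℕ} {j m x c : ℕ} (h1 : cnt r j x ≤ c)
    (h2 : c < cnt r m x) : ∃ i, j ≤ i ∧ i < m ∧ r i = x ∧ cnt r i x = c := by
  induction m with
  | zero => simp at h2
  | succ m ih =>
    rcases Nat.lt_or_ge m j with hm | hm
    · have := cnt_mono r x (show m + 1 ≤ j by omega)
      simp only at this
      omega
    rcases Nat.lt_or_ge c (cnt r m x) with hc | hc
    · obtain ⟨i, h1, h2, h3⟩ := ih hc
      exact ⟨i, h1, by omega, h3⟩
    · rw [cnt_succ] at h2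
      split_ifs at h2 with hx
      · exact ⟨m, hm, by omega, hx, by omega⟩
      · omega

/-- A letter of a removable row can be moved to the end. -/
theorem SwapClosed.move {N j m : ℕ} {P : (ℕ → ℕ) → Prop} (hP : SwapClosed N j m P) (hm : m ≤ N)
    {γ : ℕ} {r : ℕ → ℕ} (hr : Lattice N r) (hPr : P r) (hγ : cnt r m (γ + 1) < cnt r m γ)
    (hl : cnt r j γ < cnt r m γ) :
    ∃ r', Lattice N r' ∧ P r' ∧ j < m ∧ r' (m - 1) = γ ∧ (∀ i, i < j ∨ m ≤ i → r' i = r i) ∧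
      cnt r' m = cnt r m := by
  obtain ⟨i, hji, him, hi, hc⟩ := exists_last_letter hl
  clear hl
  obtain ⟨d, hd⟩ : ∃ d, i + d + 1 = m := ⟨m - 1 - i, by omega⟩
  induction d generalizing r i with
  | zero => exact ⟨r, hr, hPr, by omega, by rw [← hi]; congr 1; omega, fun _ _ => rfl, rfl⟩
  | succ d ih =>
    have h1 : cnt r (i + 2) γ ≤ cnt r m γ := cnt_mono r γ (show i + 2 ≤ m by omega)
    have h2 : cnt r (i + 2) (γ + 1) ≤ cnt r m (γ + 1) := cnt_mono r _ (show i + 2 ≤ m by omega)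
    have hne : r (i + 1) ≠ γ := fun he => by
      rw [cnt_succ, cnt_succ, if_pos hi, if_pos he] at h1
      omega
    have hs : Swappable r i := by
      refine ⟨by rw [hi]; exact hne.symm, ?_⟩
      rintro ⟨h3, h4⟩
      rw [h3, hi] at h4
      rw [hi] at h3
      rw [cnt_succ, cnt_succ, if_pos h3, hi] at h2
      omega
    obtain ⟨r', h3, h4, h5, h6, h7, h8⟩ := ih (hr.swapAt (by omega) hs)
      (hP r i hr hji (by omega) hs hPr)
      (by rw [cnt_swapAt_ge r (by omega)]; exact hγ) (i + 1) (by omega) (by omega)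
      (by rw [swapAt_right, hi])
      (by rw [cnt_swapAt_ge r (by omega), cnt_succ, cnt_swapAt_le r le_rfl, swapAt_left,
            if_neg hne, hc]) (by omega)
    refine ⟨r', h3, h4, h5, h6, fun l hl => ?_, by rw [h8, cnt_swapAt_ge r (by omega)]⟩
    rw [h7 l hl, swapAt_of_ne r (by omega) (by omega)]

/-- Lattice words with the same content are connected by admissible exchanges. -/
theorem SwapClosed.connected {N j m : ℕ} {P : (ℕ → ℕ) → Prop} (hP : SwapClosed N j m P)
    (hm : m ≤ N) {r r' : ℕ → ℕ} (hr : Lattice N r) (hr' : Lattice N r')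
    (he : ∀ i, i < j ∨ m ≤ i → r i = r' i) (hc : cnt r m = cnt r' m) (hPr : P r) : P r' := by
  induction m generalizing r with
  | zero =>
    obtain rfl : r = r' := funext fun i => he i (by omega)
    exact hPr
  | succ m ih =>
    rcases Nat.lt_or_ge m j with hj | hj
    · obtain rfl : r = r' := funext fun i => he i (by omega)
      exact hPr
    have hr'm : ∀ a, cnt r' m a ≤ cnt r' (m + 1) a := fun a => cnt_mono r' a (Nat.le_succ m)
    obtain ⟨r1, h1, h2, -, h3, h4, h5⟩ := hP.move hm (γ := r' m) hr hPr
      (by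
        have := hr' m (by omega) (show r' m ≤ r' m + 1 by omega)
        rw [hc, cnt_succ, cnt_succ, if_pos rfl, if_neg (by omega)]
        omega)
      (by
        have : cnt r' j (r' m) ≤ cnt r' m (r' m) := cnt_mono r' _ hj
        rw [hc, cnt_succ, if_pos rfl, cnt_congr fun i hi => he i (Or.inl hi)]
        omega)
    rw [Nat.add_sub_cancel] at h3
    refine ih (hP.mono (Nat.le_succ m)) (by omega) h1 ?_ ?_ h2
    · intro i hi
      rcases eq_or_ne i m with rfl | hne
      · exact h3
      · rw [h4 i (by omega), he i (by omega)]
    · funext a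
      have := congrFun (h5.trans hc) a
      rw [cnt_succ, cnt_succ, h3] at this
      omega

/-- If the bound fails, the box in row a + 1 and column `cnt r j a` was added after position j,
below another such box. Just before it is added, row a is removable, so the last box of row a can be
moved to the position right before it. The two are then vertical neighbours, which is excluded, or
they can be exchanged, and the lower box occurs one position earlier. -/
theorem SwapClosed.horizontal {N j m : ℕ} {P : (ℕ → ℕ) → Prop} (hP : SwapClosed N j m P)
    (hm : m ≤ N)
    (hV : ∀ r k, Lattice N r → j ≤ k → k + 1 < m → Vertical r k → ¬ P r)
    {r : ℕ → ℕ} (hr : Lattice N r) (hPr : P r) (hjN : j ≤ N) (a : ℕ) :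
    cnt r m (a + 1) ≤ cnt r j a := by
  by_contra! hlt
  obtain ⟨i, hji, him, hi, hc⟩ :=
    exists_letter_with_count (hr j hjN (show a ≤ a + 1 by omega)) hlt
  generalize hμ : cnt r j a = μ at hc
  clear hlt
  induction i using Nat.strong_induction_on generalizing r with
  | _ i ih =>
    have h1 : cnt r (i + 1) (a + 1) ≤ cnt r (i + 1) a := hr _ (by omega) (by omega)
    rw [cnt_succ, cnt_succ, if_pos hi, if_neg (by omega)] at h1
    obtain ⟨r1, g1, g2, g3, g4, g5, g6⟩ := (hP.mono him.le).move (by omega) (γ := a) hr hPr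
      (by omega) (by omega)
    obtain ⟨k, rfl⟩ : ∃ k, i = k + 1 := ⟨i - 1, by omega⟩
    rw [Nat.add_sub_cancel] at g4
    have e1 : r1 (k + 1) = a + 1 := by rw [g5 _ (by omega), hi]
    have e2 : cnt r1 k (a + 1) = μ := by
      have := congrFun g6 (a + 1)
      rw [cnt_succ, if_neg (by omega)] at this
      omega
    by_cases hv : Vertical r1 k
    · exact hV r1 k g1 (by omega) (by omega) hv g2
    · have hs : Swappable r1 k := ⟨by omega, hv⟩
      refine ih k (by omega) (g1.swapAt (by omega) hs)
        (hP r1 k g1 (by omega) (by omega) hs g2) (by omega) (by omega) ?_ ?_ ?_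
      · rw [swapAt_left, e1]
      · rw [cnt_swapAt_le r1 (by omega), cnt_congr fun i hi => g5 i (Or.inl hi), hμ]
      · rw [cnt_swapAt_le r1 le_rfl, e2]

/-- The transposed argument, for a second new box in row a. When it is added, take a row b ≥ a with
as many boxes as row a had before, followed by a shorter row. Its last box is removable, and new
because row b started no longer than row a. Moved next to the second box of row a, it is a row
neighbour if b = a, and can be exchanged otherwise. -/
theorem SwapClosed.vertical {N j m : ℕ} {P : (ℕ → ℕ) → Prop} (hP : SwapClosed N j m P)
    (hm : m ≤ N)
    (hV : ∀ r k, Lattice N r → j ≤ k → k + 1 < m → r k = r (k + 1) → ¬ P r)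
    {r : ℕ → ℕ} (hr : Lattice N r) (hPr : P r) (hjN : j ≤ N) (a : ℕ) :
    cnt r m a ≤ cnt r j a + 1 := by
  by_contra! hlt
  obtain ⟨i, hji, him, hi, hc⟩ := exists_letter_with_count (Nat.le_succ _) hlt
  have hμ : ∀ b, a ≤ b → cnt r j b ≤ cnt r j a := fun b hb => hr j hjN hb
  generalize cnt r j a = μ at hc hμ
  clear hlt
  induction i using Nat.strong_induction_on generalizing r with
  | _ i ih =>
    -- Without such a row, all rows from a on would have μ + 1 boxes, yet row a + i is empty after i
    -- letters.
    obtain ⟨b, hab, hb, hb'⟩ : ∃ b, a ≤ b ∧ cnt r i b = μ + 1 ∧ cnt r i (b + 1) < μ + 1 := by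
      by_contra! hno
      have : ∀ d, cnt r i (a + d) = μ + 1 := fun d => by
        induction d with
        | zero => exact hc
        | succ d ihd =>
          have := hno (a + d) (by omega) ihd
          have := hr i (by omega) (show a ≤ a + (d + 1) by omega)
          rw [show a + (d + 1) = a + d + 1 by ring] at *
          omega
      have h0 := this i
      rw [cnt_eq_zero_of_lattice hr (by omega) (by omega)] at h0
      omega
    obtain ⟨r1, g1, g2, g3, g4, g5, g6⟩ := (hP.mono him.le).move (by omega) (γ := b) hr hPr
      (by omega) (by have := hμ b hab; omega)
    obtain ⟨k, rfl⟩ : ∃ k, i = k + 1 := ⟨i - 1, by omega⟩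
    rw [Nat.add_sub_cancel] at g4
    have e1 : r1 (k + 1) = a := by rw [g5 _ (by omega), hi]
    by_cases hba : b = a
    · exact hV r1 k g1 (by omega) (by omega) (by omega) g2
    · have hs : Swappable r1 k := ⟨by omega, fun hv => by have := hv.1; omega⟩
      have e2 : cnt r1 k a = μ + 1 := by
        have := congrFun g6 a
        rw [cnt_succ, if_neg (by omega)] at this
        omega
      refine ih k (by omega) (g1.swapAt (by omega) hs)
        (hP r1 k g1 (by omega) (by omega) hs g2) (by omega) (by omega) ?_ ?_ ?_
      · rw [swapAt_left, e1]
      · rw [cnt_swapAt_le r1 le_rfl, e2]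
      · intro b hb
        rw [cnt_swapAt_le r1 (by omega), cnt_congr fun i hi => g5 i (Or.inl hi)]
        exact hμ b hb

end HeckeStrip
end

/-! ### Jucys-Murphy elements, weights and intertwiners -/

noncomputable section
open scoped RightActions
namespace HeckeStrip

/-! ### `q`-integers -/

theorem qInt_zero (q : ℂ) : qInt q 0 = 0 := by simp [qInt]

/-- Together with `qInt_zero`, this recursion is all that is used about the definition; it is
uniform in the sign of c. -/
theorem qInt_add_one {q : ℂ} (hq : q ≠ 0) (c : ℤ) : qInt q (c + 1) = q * qInt q c + 1 := by
  rcases le_or_gt 0 c with h | h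
  · lift c to ℕ using h
    have e1 : ((c : ℤ) + 1).toNat = c + 1 := by omega
    have e2 : (-((c : ℤ) + 1)).toNat = 0 := by omega
    have e3 : (-(c : ℤ)).toNat = 0 := by omega
    simp only [qInt, e1, e2, e3, Int.toNat_natCast, Finset.sum_range_zero, sub_zero]
    rw [Finset.sum_range_succ', Finset.mul_sum]
    simp [pow_succ']
  · obtain ⟨d, rfl⟩ : ∃ d : ℕ, c = -(d + 1 : ℕ) := ⟨(-c - 1).toNat, by omega⟩
    have e1 : (-((d + 1 : ℕ) : ℤ)).toNat = 0 := by omega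
    have e2 : (-((d + 1 : ℕ) : ℤ) + 1).toNat = 0 := by omega
    have e3 : (-(-((d + 1 : ℕ) : ℤ) + 1)).toNat = d := by omega
    simp only [qInt, e1, e2, e3, neg_neg, Int.toNat_natCast, Finset.sum_range_zero, zero_sub]
    rw [Finset.sum_range_succ', mul_neg, mul_add, Finset.mul_sum]
    have : ∀ i, q * q⁻¹ ^ (i + 1 + 1) = q⁻¹ ^ (i + 1) := fun i => by
      rw [pow_succ' _ (i + 1), ← mul_assoc, mul_inv_cancel₀ hq, one_mul]
    simp only [this]
    simp [hq]

theorem qInt_one {q : ℂ} (hq : q ≠ 0) : qInt q 1 = 1 := by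
  simpa [qInt_zero] using qInt_add_one hq 0

theorem qInt_add {q : ℂ} (hq : q ≠ 0) (b d : ℤ) :
    qInt q (b + d) = qInt q b + q ^ b * qInt q d := by
  induction b using Int.induction_on with
  | zero => simp [qInt_zero]
  | succ b ih =>
    rw [show (b : ℤ) + 1 + d = b + d + 1 by ring, qInt_add_one hq, qInt_add_one hq, ih,
      zpow_add_one₀ hq]
    ring
  | pred b ih =>
    have h1 := qInt_add_one hq (-(b : ℤ) - 1 + d)
    have h2 := qInt_add_one hq (-(b : ℤ) - 1)
    rw [show -(b : ℤ) - 1 + d + 1 = -b + d by ring, ih] at h1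
    rw [show -(b : ℤ) - 1 + 1 = -b by ring] at h2
    apply mul_left_cancel₀ hq
    rw [mul_add, ← mul_assoc, ← zpow_one_add₀ hq, show 1 + (-(b : ℤ) - 1) = -b by ring]
    linear_combination h2 - h1

/-- The `q`-integers `[1]_q, …, [n]_q` do not vanish. -/
def QGood (n : ℕ) (q : ℂ) : Prop := ∀ k : ℕ, 1 ≤ k → k ≤ n → qInt q k ≠ 0

/-- For b < a one has [a] - [b] = q^b [a - b]. -/
theorem QGood.ne {n : ℕ} {q : ℂ} (hg : QGood n q) (hq : q ≠ 0) {a b : ℤ} (hab : a ≠ b)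
    (hn : |a - b| ≤ n) : qInt q a ≠ qInt q b := by
  wlog h : b < a generalizing a b
  · exact (this hab.symm (by rwa [abs_sub_comm]) (by omega)).symm
  · have h1 := qInt_add hq b (a - b)
    rw [add_sub_cancel] at h1
    rw [abs_of_pos (by omega)] at hn
    have h2 := hg (a - b).toNat (by omega) (by omega)
    rw [show ((a - b).toNat : ℤ) = a - b by omega] at h2
    rw [h1]
    intro h3
    have : q ^ b * qInt q (a - b) = 0 := by linear_combination h3
    exact mul_ne_zero (zpow_ne_zero b hq) h2 this

theorem QGood.ne_neg_one {n : ℕ} {q : ℂ} (hg : QGood n q) (hq : q ≠ 0) (hn : 2 ≤ n) :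
    1 + q ≠ 0 := by
  have := hg 2 (by omega) hn
  rw [show ((2 : ℕ) : ℤ) = 1 + 1 by norm_num, qInt_add_one hq, qInt_one hq] at this
  rwa [mul_one, add_comm] at this

/-! ### Families of Hecke generators and their Jucys-Murphy elements -/

variable {A : Type*} [Ring A] [Algebra ℂ A]

/-- The elements `t 0, …, t (n - 2)` satisfy the relations of the Hecke algebra; `t i` belongs to
the exchange of the positions `i` and `i + 1`, counted from `0`. -/
structure HeckeFam (n : ℕ) (q : ℂ) (t : ℕ → A) : Prop where
  q_ne : q ≠ 0
  quad : ∀ i, i + 1 < n → t i * t i = (q - 1) • t i + q • (1 : A)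
  comm : ∀ i j, i + 2 ≤ j → j + 1 < n → t i * t j = t j * t i
  braid : ∀ i, i + 2 < n → t i * t (i + 1) * t i = t (i + 1) * t i * t (i + 1)

/-- The Jucys-Murphy element of the position `k`. -/
def jm (q : ℂ) (t : ℕ → A) : ℕ → A
  | 0 => 0
  | k + 1 => q⁻¹ • (t k * jm q t k * t k + t k)

namespace HeckeFam

variable {n : ℕ} {q : ℂ} {t : ℕ → A}

/-- The affine Hecke relation between a generator and two neighbouring Jucys-Murphy elements; it and
its mirror image `mul_jm_succ` are the source of the intertwiners. -/
theorem jm_succ_mul (h : HeckeFam n q t) {k : ℕ} (hk : k + 1 < n) :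
    jm q t (k + 1) * t k = t k * jm q t k + 1 + (q - 1) • jm q t (k + 1) := by
  have e : (t k * jm q t k * t k + t k) * t k =
      q • (t k * jm q t k + 1) + (q - 1) • (t k * jm q t k * t k + t k) := by
    rw [add_mul, mul_assoc (t k * jm q t k), h.quad k hk]
    simp only [mul_add, mul_smul_comm, mul_one]
    module
  rw [jm, smul_mul_assoc, e, smul_add, smul_smul, inv_mul_cancel₀ h.q_ne, one_smul,
    smul_comm q⁻¹]

theorem mul_jm_succ (h : HeckeFam n q t) {k : ℕ} (hk : k + 1 < n) :
    t k * jm q t (k + 1) = jm q t k * t k + 1 + (q - 1) • jm q t (k + 1) := by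
  have e : t k * (t k * jm q t k * t k + t k) =
      q • (jm q t k * t k + 1) + (q - 1) • (t k * jm q t k * t k + t k) := by
    rw [mul_add, ← mul_assoc, ← mul_assoc, h.quad k hk]
    simp only [add_mul, smul_mul_assoc, one_mul]
    module
  rw [jm, mul_smul_comm, e, smul_add, smul_smul, inv_mul_cancel₀ h.q_ne, one_smul,
    smul_comm q⁻¹]

theorem commute_far (h : HeckeFam n q t) {i j : ℕ} (hi : i + 1 < n) (hj : j + 1 < n)
    (hij : i + 2 ≤ j ∨ j + 2 ≤ i) : Commute (t i) (t j) := by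
  rcases hij with hij | hij
  · exact h.comm i j hij hj
  · exact (h.comm j i hij hi).symm

theorem commute_jm_of_lt (h : HeckeFam n q t) {i k : ℕ} (hi : i + 1 < n) (hk : k < i) :
    Commute (t i) (jm q t k) := by
  induction k with
  | zero => exact Commute.zero_right _
  | succ k ih =>
    have h1 : Commute (t i) (t k) := h.commute_far hi (by omega) (by omega)
    exact (((h1.mul_right (ih (by omega))).mul_right h1).add_right h1).smul_right _

theorem commute_jm_of_gt (h : HeckeFam n q t) {i k : ℕ} (hk : k < n) (hi : i + 1 < k) :
    Commute (t i) (jm q t k) := by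
  induction k with
  | zero => omega
  | succ k ih =>
    rcases Nat.lt_or_ge (i + 1) k with hik | hik
    · have h1 : Commute (t i) (t k) := h.commute_far (by omega) (by omega) (by omega)
      exact (((h1.mul_right (ih (by omega) hik)).mul_right h1).add_right h1).smul_right _
    -- The one case that needs the braid relation. Expanding the recursion twice leaves b a x a b,
    -- which commutes with a by braiding, and a b a / q + b, which does so by the quadratic
    -- relation.
    · obtain rfl : k = i + 1 := by omega
      set x := jm q t i
      set a := t i
      set b := t (i + 1)
      have hbx : b * x = x * b := h.commute_jm_of_lt hk (Nat.lt_succ_self i)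
      have hbr : a * b * a = b * a * b := h.braid i (by omega)
      have haa : a * a = (q - 1) • a + q • (1 : A) := h.quad i (by omega)
      have e : jm q t (i + 1 + 1) = q⁻¹ • (q⁻¹ • (b * a * x * a * b + a * b * a) + b) := by
        simp only [jm, mul_smul_comm, smul_mul_assoc, mul_add, add_mul, hbr, mul_assoc]
        rfl
      have e1 : Commute a (b * a * x * a * b) := by
        change a * (b * a * x * a * b) = b * a * x * a * b * a
        calc a * (b * a * x * a * b) = (a * b * a) * x * a * b := by noncomm_ring
          _ = b * a * (b * x) * a * b := by rw [hbr]; noncomm_ring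
          _ = b * a * x * (b * a * b) := by rw [hbx]; noncomm_ring
          _ = _ := by rw [← hbr]; noncomm_ring
      have e2 : Commute a (q⁻¹ • (a * b * a) + b) := by
        change a * (q⁻¹ • (a * b * a) + b) = (q⁻¹ • (a * b * a) + b) * a
        have l1 : a * (a * b * a) = (q - 1) • (a * b * a) + q • (b * a) := by
          rw [← mul_assoc, ← mul_assoc, haa]
          simp only [add_mul, smul_mul_assoc, one_mul]
        have l2 : a * b * a * a = (q - 1) • (a * b * a) + q • (a * b) := by
          rw [mul_assoc, haa]
          simp only [mul_add, mul_smul_comm, mul_one]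
        rw [mul_add, add_mul, mul_smul_comm, smul_mul_assoc, l1, l2]
        simp only [smul_add, smul_smul, inv_mul_cancel₀ h.q_ne, one_smul]
        abel
      rw [e, smul_add q⁻¹ (b * a * x * a * b), add_assoc]
      exact ((e1.smul_right _).add_right e2).smul_right _

theorem commute_jm (h : HeckeFam n q t) {i k : ℕ} (hi : i + 1 < n) (hk : k < n) (h1 : k ≠ i)
    (h2 : k ≠ i + 1) : Commute (t i) (jm q t k) := by
  rcases Nat.lt_or_ge k i with h3 | h3
  · exact h.commute_jm_of_lt hi h3
  · exact h.commute_jm_of_gt hk (by omega)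

theorem jm_commute_jm (h : HeckeFam n q t) {k l : ℕ} (hl : l < n) (hk : k < n) :
    Commute (jm q t k) (jm q t l) := by
  wlog hkl : k < l generalizing k l
  · rcases eq_or_ne k l with rfl | hne
    · exact Commute.refl _
    · exact (this hk hl (by omega)).symm
  · induction k with
    | zero => exact Commute.zero_left _
    | succ k ih =>
      have h1 : Commute (t k) (jm q t l) := h.commute_jm_of_gt hl hkl
      exact (((h1.mul_left (ih (by omega) (by omega))).mul_left h1).add_left h1).smul_left _

end HeckeFam

/-! ### Weight vectors -/

set_option linter.unusedSectionVars false

variable {M : Type*} [AddCommGroup M] [Module ℂ M] [Module A M] [IsScalarTower ℂ A M]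

theorem smul_smul_comm' (c : ℂ) (a : A) (v : M) : a • c • v = c • a • v := smul_comm a c v

/-- `v` is a simultaneous eigenvector of the first `m` Jucys-Murphy elements, for the contents of
the word `r`. -/
def Wt (q : ℂ) (t : ℕ → A) (m : ℕ) (r : ℕ → ℕ) (v : M) : Prop :=
  ∀ k < m, jm q t k • v = qInt q (ct r k) • v

namespace HeckeFam

variable {n : ℕ} {q : ℂ} {t : ℕ → A}

/-- The intertwining element of the positions `k` and `k + 1`. -/
def tau (q : ℂ) (t : ℕ → A) (k : ℕ) (a b : ℂ) : A :=
  (b - a) • t k - (1 + (q - 1) * b) • (1 : A)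

theorem tau_smul (k : ℕ) (a b : ℂ) (v : M) :
    tau q t k a b • v = (b - a) • t k • v - (1 + (q - 1) * b) • v := by
  simp [tau, sub_smul]

theorem jm_smul_t_smul (h : HeckeFam n q t) {k : ℕ} (hk : k + 1 < n) {b : ℂ} {v : M}
    (hv : jm q t (k + 1) • v = b • v) :
    jm q t k • t k • v = b • t k • v - (1 + (q - 1) * b) • v := by
  have h1 := congrArg (fun x : A => x • v) (h.mul_jm_succ hk)
  simp only [mul_smul, add_smul, smul_assoc, one_smul, hv] at h1
  rw [smul_smul_comm'] at h1
  generalize t k • v = w at *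
  have h2 : jm q t k • w = b • w - v - (q - 1) • b • v := by rw [h1]; abel
  rw [h2]
  module

theorem jm_succ_smul_t_smul (h : HeckeFam n q t) {k : ℕ} (hk : k + 1 < n) {a b : ℂ} {v : M}
    (hv : jm q t k • v = a • v) (hv' : jm q t (k + 1) • v = b • v) :
    jm q t (k + 1) • t k • v = a • t k • v + (1 + (q - 1) * b) • v := by
  have h1 := congrArg (fun x : A => x • v) (h.jm_succ_mul hk)
  simp only [mul_smul, add_smul, smul_assoc, one_smul, hv, hv'] at h1
  rw [smul_smul_comm'] at h1
  generalize t k • v = w at *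
  rw [h1]
  module

theorem jm_tau (h : HeckeFam n q t) {k : ℕ} (hk : k + 1 < n) {a b : ℂ} {v : M}
    (hv : jm q t k • v = a • v) (hv' : jm q t (k + 1) • v = b • v) :
    jm q t k • tau q t k a b • v = b • tau q t k a b • v := by
  rw [tau_smul, smul_sub, smul_smul_comm', smul_smul_comm', h.jm_smul_t_smul hk hv', hv]
  generalize t k • v = w
  module

theorem jm_succ_tau (h : HeckeFam n q t) {k : ℕ} (hk : k + 1 < n) {a b : ℂ} {v : M}
    (hv : jm q t k • v = a • v) (hv' : jm q t (k + 1) • v = b • v) :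
    jm q t (k + 1) • tau q t k a b • v = a • tau q t k a b • v := by
  rw [tau_smul, smul_sub, smul_smul_comm', smul_smul_comm', h.jm_succ_smul_t_smul hk hv hv', hv']
  generalize t k • v = w
  module

theorem t_t_smul (h : HeckeFam n q t) {k : ℕ} (hk : k + 1 < n) (v : M) :
    t k • t k • v = (q - 1) • t k • v + q • v := by
  rw [smul_smul, h.quad k hk, add_smul, smul_assoc, smul_assoc, one_smul]

theorem tau_tau (h : HeckeFam n q t) {k : ℕ} (hk : k + 1 < n) (a b : ℂ) (v : M) :
    tau q t k b a • tau q t k a b • v = ((1 + q * a - b) * (1 + q * b - a)) • v := by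
  rw [tau_smul, tau_smul, smul_sub, smul_smul_comm', smul_smul_comm', h.t_t_smul hk]
  generalize t k • v = w
  module

theorem Wt_mono {m m' : ℕ} {r : ℕ → ℕ} {v : M} (hv : Wt q t m r v) (hm : m' ≤ m) :
    Wt q t m' r v := fun k hk => hv k (by omega)

theorem Wt_congr {m : ℕ} {r r' : ℕ → ℕ} {v : M} (hv : Wt q t m r v) (hr : ∀ i < m, r i = r' i) :
    Wt q t m r' v := fun k hk => by
  rw [hv k hk, ct_congr fun i hi => hr i (by omega)]

theorem Wt_zero (m : ℕ) (r : ℕ → ℕ) : Wt q t m r (0 : M) := fun k _ => by simp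

theorem Wt_smul {m : ℕ} {r : ℕ → ℕ} {v : M} (hv : Wt q t m r v) (c : ℂ) :
    Wt q t m r (c • v) := fun k hk => by rw [smul_smul_comm', hv k hk, smul_comm]

theorem Wt_of_commute {m : ℕ} {r : ℕ → ℕ} {v : M} (hv : Wt q t m r v) {a : A}
    (ha : ∀ k < m, Commute a (jm q t k)) : Wt q t m r (a • v) := fun k hk => by
  rw [smul_smul, ← (ha k hk).eq, mul_smul, hv k hk, smul_smul_comm']

theorem Wt_succ {m : ℕ} {r : ℕ → ℕ} {v : M} (hv : Wt q t m r v)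
    (h : jm q t m • v = qInt q (ct r m) • v) : Wt q t (m + 1) r v := fun k hk => by
  rcases Nat.lt_or_ge k m with h1 | h1
  · exact hv k h1
  · obtain rfl : k = m := by omega
    exact h

/-- The intertwining element for the positions `k` and `k + 1` on vectors of weight `r`. -/
def tauOf (q : ℂ) (t : ℕ → A) (r : ℕ → ℕ) (k : ℕ) : A :=
  tau q t k (qInt q (ct r k)) (qInt q (ct r (k + 1)))

theorem Wt_tauOf (h : HeckeFam n q t) {m : ℕ} (hm : m ≤ n) {r : ℕ → ℕ} {v : M}
    (hv : Wt q t m r v) {k : ℕ} (hk : k + 1 < m) (hr : r k ≠ r (k + 1)) :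
    Wt q t m (swapAt r k) (tauOf q t r k • v) := fun l hl => by
  have h1 := hv k (by omega)
  have h2 := hv (k + 1) hk
  by_cases hlk : l = k
  · subst hlk
    rw [ct_swapAt_left hr]
    exact h.jm_tau (by omega) h1 h2
  · by_cases hlk' : l = k + 1
    · subst hlk'
      rw [ct_swapAt_right hr]
      exact h.jm_succ_tau (by omega) h1 h2
    · rw [ct_swapAt_of_ne hlk hlk', tauOf, tau_smul, smul_sub, smul_smul_comm', smul_smul_comm',
        smul_smul, ← (h.commute_jm (by omega) (by omega) hlk hlk').eq, mul_smul, hv l hl,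
        smul_smul_comm']
      generalize t k • v = w
      module

/-- For contents c, d the factors are [c + 1] - [d] and [d + 1] - [c]. Since 2 ≤ |c - d| ≤ k + 1,
the shifted differences are nonzero and at most k + 2 ≤ n. This is the invertibility of the
intertwiners. -/
theorem tauOf_tauOf_ne (hq : q ≠ 0) (hg : QGood n q) {m : ℕ} (hm : m ≤ n) {r : ℕ → ℕ} {k : ℕ}
    (hr : Lattice m r) (hk : k + 1 < m) (hs : Swappable r k) :
    (1 + q * qInt q (ct r k) - qInt q (ct r (k + 1))) *
      (1 + q * qInt q (ct r (k + 1)) - qInt q (ct r k)) ≠ 0 := by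
  obtain ⟨h1, h2⟩ := hs.content_diff hr hk
  have e : ∀ c, 1 + q * qInt q c = qInt q (c + 1) := fun c => by rw [qInt_add_one hq]; ring
  rw [e, e]
  rcases abs_cases (ct r k - ct r (k + 1)) with h3 | h3 <;>
  refine mul_ne_zero (sub_ne_zero.2 (hg.ne hq ?_ ?_)) (sub_ne_zero.2 (hg.ne hq ?_ ?_)) <;>
  first
  | omega
  | rw [abs_le]; omega

theorem tauOf_swap_tauOf (h : HeckeFam n q t) {r : ℕ → ℕ} {k : ℕ} (hk : k + 1 < n)
    (hr : r k ≠ r (k + 1)) (v : M) :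
    tauOf q t (swapAt r k) k • tauOf q t r k • v =
      ((1 + q * qInt q (ct r k) - qInt q (ct r (k + 1))) *
      (1 + q * qInt q (ct r (k + 1)) - qInt q (ct r k))) • v := by
  rw [tauOf, tauOf, ct_swapAt_left hr, ct_swapAt_right hr, h.tau_tau hk]

theorem content_ne (hq : q ≠ 0) (hg : QGood n q) {m : ℕ} (hm : m ≤ n) {r : ℕ → ℕ} {k : ℕ}
    (hr : Lattice m r) (hk : k + 1 < m) (hs : Swappable r k) :
    qInt q (ct r (k + 1)) ≠ qInt q (ct r k) := by
  obtain ⟨h1, h2⟩ := hs.content_diff hr hk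
  refine (hg.ne hq ?_ (by omega)).symm
  rintro h3
  rw [h3, sub_self, abs_zero] at h1
  omega

end HeckeFam
end HeckeStrip
end

/-! ### Polynomials in one operator, on eigenvectors -/

noncomputable section
open scoped RightActions
namespace HeckeStrip

open Polynomial

variable {A : Type*} [Ring A] [Algebra ℂ A]
variable {M : Type*} [AddCommGroup M] [Module ℂ M] [Module A M] [IsScalarTower ℂ A M]

set_option linter.unusedSectionVars false

/-! ### Eigenvectors -/

/-- Eigenspaces for distinct eigenvalues are independent. -/
theorem eigenvalue_of_mem_span {C : ℂ → Prop} {x : A} {v : M} {b : ℂ}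
    (hv : v ∈ Submodule.span ℂ {u : M | ∃ c, C c ∧ x • u = c • u}) (hb : x • v = b • v)
    (h0 : v ≠ 0) : C b := by
  by_contra hC
  have hind := Module.End.eigenspaces_iSupIndep (Algebra.lsmul ℂ ℂ M x) b
  rw [Submodule.disjoint_def] at hind
  refine h0 (hind v (Module.End.mem_eigenspace_iff.2 hb) ?_)
  refine Submodule.span_le.2 ?_ hv
  rintro u ⟨c, hc, hu⟩
  refine Submodule.mem_iSup_of_mem c (Submodule.mem_iSup_of_mem ?_
    (Module.End.mem_eigenspace_iff.2 hu))
  rintro rfl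
  exact hC hc

theorem aeval_smul_of_eigen {x : A} {u : M} {c : ℂ} (hu : x • u = c • u) (Q : ℂ[X]) :
    aeval x Q • u = eval c Q • u := by
  induction Q using Polynomial.induction_on with
  | C a => simp
  | add p q hp hq => simp only [map_add, add_smul, eval_add, hp, hq]
  | monomial k a ih =>
    rw [pow_succ, ← mul_assoc, map_mul, mul_smul, aeval_X, hu, smul_smul_comm', ih, smul_smul]
    simp only [eval_mul, eval_X, mul_comm c]

theorem aeval_prod_smul_eq_zero {x : A} {v : M} {E : Finset ℂ}
    (hv : v ∈ Submodule.span ℂ {u : M | ∃ c, c ∈ E ∧ x • u = c • u}) :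
    aeval x (∏ e ∈ E, (X - C e)) • v = 0 := by
  induction hv using Submodule.span_induction with
  | mem u hu =>
    obtain ⟨c, hc, hu⟩ := hu
    rw [aeval_smul_of_eigen hu, eval_prod, Finset.prod_eq_zero hc (by simp), zero_smul]
  | zero => simp
  | add u w _ _ hu hw => rw [smul_add, hu, hw, add_zero]
  | smul c u _ hu => rw [smul_smul_comm', hu, smul_zero]

/-- Lagrange interpolation at simple roots splits v into eigenvectors. Recording that they are
polynomials in x applied to v lets them inherit the eigenvalues of v for operators commuting with x.
-/
theorem mem_span_eigen {x : A} {v : M} {E : Finset ℂ}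
    (hv : aeval x (∏ e ∈ E, (X - C e)) • v = 0) :
    v ∈ Submodule.span ℂ {u : M | ∃ e ∈ E, (∃ g : ℂ[X], u = aeval x g • v) ∧ x • u = e • u} := by
  rcases E.eq_empty_or_nonempty with rfl | hE
  · simp at hv
    simp [hv]
  · have h1 := congrArg (fun g : ℂ[X] => aeval x g • v)
      (Lagrange.sum_basis (s := E) (v := id) (Function.injective_id.injOn) hE)
    simp only [map_sum, map_one, one_smul, Finset.sum_smul] at h1
    rw [← h1]
    refine Submodule.sum_mem _ fun e he => Submodule.subset_span ⟨e, he, ?_, ?_⟩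
    · rw [h1]; exact ⟨_, rfl⟩
    · have h2 : (X - C e) * Lagrange.basis E id e =
          C (∏ j ∈ E.erase e, (e - j)⁻¹) * ∏ j ∈ E, (X - C j) := by
        simp only [Lagrange.basis, Lagrange.basisDivisor, id, Finset.prod_mul_distrib, map_prod]
        rw [← Finset.mul_prod_erase E (fun j => X - C j) he]
        ring
      have h3 := congrArg (fun g : ℂ[X] => aeval x g • v) h2
      simp only [map_mul, mul_smul, hv, smul_zero, map_sub, aeval_X, sub_smul, aeval_C] at h3
      rw [algebraMap_smul] at h3
      exact sub_eq_zero.1 h3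

theorem commute_aeval {x y : A} (h : Commute x y) (Q : ℂ[X]) : Commute x (aeval y Q) := by
  induction Q using Polynomial.induction_on with
  | C a => rw [aeval_C]; exact Algebra.commute_algebraMap_right _ _
  | add p q hp hq => rw [map_add]; exact hp.add_right hq
  | monomial k a ih =>
    rw [pow_succ, ← mul_assoc, map_mul, aeval_X]
    exact ih.mul_right h

namespace HeckeFam

variable {n : ℕ} {q : ℂ} {t : ℕ → A}

/-- Commutation of polynomials in Jucys-Murphy elements with a generator, on eigenvectors. -/
theorem aeval_jm_t_smul (h : HeckeFam n q t) {k : ℕ} (hk : k + 1 < n) (z : ℂ) (Q : ℂ[X]) :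
    ∃ G : ℂ[X], (X - C z) * G = Q - C (eval z Q) ∧ ∀ v : M, jm q t k • v = z • v →
      aeval (jm q t k) Q • t k • v = t k • aeval (jm q t (k + 1)) Q • v -
        (1 + (q - 1) • jm q t (k + 1)) • aeval (jm q t (k + 1)) G • v := by
  induction Q using Polynomial.induction_on' with
  | add P Q hP hQ =>
    obtain ⟨G, h1, h2⟩ := hP
    obtain ⟨G', h3, h4⟩ := hQ
    refine ⟨G + G', by rw [mul_add, h1, h3, eval_add, C_add]; ring, fun v hv => ?_⟩
    simp only [map_add, add_smul _ _ (t k • v), h2 v hv, h4 v hv, add_smul _ _ v, smul_add]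
    abel
  | monomial m a =>
    induction m with
    | zero => exact ⟨0, by simp, fun v hv => by
        simp only [monomial_zero_left, aeval_C, algebraMap_smul, smul_smul_comm']; simp⟩
    | succ m ih =>
      obtain ⟨G, h1, h2⟩ := ih
      -- The divided difference of X Q at z: from (X - z) G = Q - Q(z) follows (X - z)(Q + z G) = X
      -- Q - z Q(z).
      refine ⟨monomial m a + C z * G, ?_, fun v hv => ?_⟩
      · rw [mul_add, ← mul_assoc, mul_comm _ (C z), mul_assoc, h1, ← monomial_mul_X, eval_mul,
          eval_X, C_mul]
        ring
      · have e : ∀ x : A, aeval x (monomial (m + 1) a : ℂ[X]) = x * aeval x (monomial m a : ℂ[X]) :=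
          fun x => by rw [← monomial_mul_X, mul_comm, map_mul, aeval_X]
        have e1 : jm q t k * t k = t k * jm q t (k + 1) - (1 + (q - 1) • jm q t (k + 1)) := by
          rw [h.mul_jm_succ hk]; abel
        have hc := h.jm_commute_jm (show k + 1 < n by omega) (show k < n by omega)
        have e4 := commute_aeval hc G
        have e5 : Commute (jm q t k) (1 + (q - 1) • jm q t (k + 1)) :=
          (Commute.one_right _).add_right (hc.smul_right _)
        have e6 : ∀ w : M, jm q t k • (1 + (q - 1) • jm q t (k + 1)) • w =
            (1 + (q - 1) • jm q t (k + 1)) • jm q t k • w := fun w => by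
          rw [smul_smul, e5.eq, mul_smul]
        have e7 : ∀ w : M, jm q t k • aeval (jm q t (k + 1)) G • w =
            aeval (jm q t (k + 1)) G • jm q t k • w := fun w => by
          rw [smul_smul, e4.eq, mul_smul]
        have e8 : ∀ w : M, jm q t k • t k • w =
            t k • jm q t (k + 1) • w - (1 + (q - 1) • jm q t (k + 1)) • w := fun w => by
          rw [smul_smul, e1, sub_smul, mul_smul]
        rw [e, e, mul_smul, h2 v hv, smul_sub, e8, e6, e7, hv, map_add, map_mul, aeval_C,
          add_smul _ _ v, mul_smul, mul_smul, algebraMap_smul, smul_add]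
        simp only [smul_smul_comm' z]
        abel

end HeckeFam
end HeckeStrip
end

noncomputable section
open scoped RightActions
namespace HeckeStrip

open Polynomial

variable {A : Type*} [Ring A] [Algebra ℂ A]
variable {M : Type*} [AddCommGroup M] [Module ℂ M] [Module A M] [IsScalarTower ℂ A M]

set_option linter.unusedSectionVars false

namespace HeckeFam

variable {n : ℕ} {q : ℂ} {t : ℕ → A}

/-! ### The weights are the contents of standard tableaux -/

/-- Vectors of the weight `r` are sums of vectors of weights that extend `r` by an addable box. -/
def Branches (q : ℂ) (t : ℕ → A) (M : Type*) [AddCommGroup M] [Module ℂ M] [Module A M]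
    (k : ℕ) : Prop :=
  ∀ r, Lattice k r → ∀ v : M, Wt q t k r v → v ∈ Submodule.span ℂ {u : M |
    ∃ r', (∀ i < k, r' i = r i) ∧ Lattice (k + 1) r' ∧ Wt q t (k + 1) r' u}

/-- The eigenvalue of the box at the end of row `β`. -/
def rowValue (q : ℂ) (p : ℕ → ℕ) (β : ℕ) : ℂ := qInt q ((p β : ℤ) - β)

theorem ct_eq {r r' : ℕ → ℕ} {k : ℕ} (h : ∀ i < k, r' i = r i) :
    qInt q (ct r' k) = rowValue q (cnt r k) (r' k) := by
  rw [ct, cnt_congr h, rowValue]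

theorem Branches.mem_span {k : ℕ} (hB : Branches q t M k) {r : ℕ → ℕ} (hr : Lattice k r) {v : M}
    (hv : Wt q t k r v) : v ∈ Submodule.span ℂ {u : M | ∃ c,
      (∃ β, Addable (cnt r k) β ∧ c = rowValue q (cnt r k) β) ∧ jm q t k • u = c • u} := by
  refine Submodule.span_mono ?_ (hB r hr v hv)
  rintro u ⟨r', h1, h2, h3⟩
  refine ⟨_, ⟨r' k, ?_, rfl⟩, ?_⟩
  · rw [← cnt_congr h1]; exact h2.addable (Nat.lt_succ_self k)
  · rw [h3 k (Nat.lt_succ_self k), ct_eq h1]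

theorem Branches.eigenvalue {k : ℕ} (hB : Branches q t M k) {r : ℕ → ℕ} (hr : Lattice k r) {v : M}
    (hv : Wt q t k r v) {b : ℂ} (hb : jm q t k • v = b • v) (h0 : v ≠ 0) :
    ∃ β, Addable (cnt r k) β ∧ b = rowValue q (cnt r k) β :=
  eigenvalue_of_mem_span (C := fun c => ∃ β, Addable (cnt r k) β ∧ c = rowValue q (cnt r k) β)
    (hB.mem_span hr hv) hb h0

/-- The two diagonals adjacent to an addable box contain no addable box of the same shape. -/
theorem rowValue_ne (hq : q ≠ 0) (hg : QGood n q) {k : ℕ} (hk : k + 1 < n) {r : ℕ → ℕ}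
    {α β : ℕ} (hα : Addable (cnt r k) α) (hβ : Addable (cnt r k) β) {d : ℤ} (hd : |d| = 1) :
    qInt q ((cnt r k α : ℤ) - α + d) ≠ rowValue q (cnt r k) β := by
  have hd' : d = 1 ∨ d = -1 := (abs_eq (by norm_num)).1 hd
  by_cases hab : α = β
  · subst hab
    refine hg.ne hq (by omega) ?_
    rw [add_sub_cancel_left, hd]; omega
  · obtain ⟨h1, h2⟩ := addable_content_diff hα hβ hab
    rcases abs_cases (((cnt r k α : ℤ) - α) - ((cnt r k β : ℤ) - β)) with h3 | h3 <;>
    refine hg.ne hq (by omega) ?_ <;> rw [abs_le] <;> omega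

theorem Wt_t_smul (h : HeckeFam n q t) {k : ℕ} (hk : k + 1 < n) {r : ℕ → ℕ} {v : M}
    (hv : Wt q t k r v) : Wt q t k r (t k • v) :=
  Wt_of_commute hv fun _ hl => h.commute_jm_of_lt hk hl

theorem Wt_sub {m : ℕ} {r : ℕ → ℕ} {v w : M} (hv : Wt q t m r v) (hw : Wt q t m r w) :
    Wt q t m r (v - w) := fun k hk => by rw [smul_sub, hv k hk, hw k hk, smul_sub]

theorem Wt_add {m : ℕ} {r : ℕ → ℕ} {v w : M} (hv : Wt q t m r v) (hw : Wt q t m r w) :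
    Wt q t m r (v + w) := fun k hk => by rw [smul_add, hv k hk, hw k hk, smul_add]

/-- If t v - q v were nonzero, it would have weight r on the first k positions and, at position k,
the eigenvalue of the diagonal just right of an addable box. Branching allows only eigenvalues of
addable boxes there. The companion `t_smul_below` uses t v + v and the diagonal on the other side.
-/
theorem Branches.t_smul_right (h : HeckeFam n q t) (hg : QGood n q) {k : ℕ} (hk : k + 1 < n)
    (hB : Branches q t M k) {r : ℕ → ℕ} (hr : Lattice k r) {v : M} (hv : Wt q t k r v) {β : ℕ}
    (hβ : Addable (cnt r k) β) (h1 : jm q t k • v = rowValue q (cnt r k) β • v)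
    (h2 : jm q t (k + 1) • v = qInt q ((cnt r k β : ℤ) - β + 1) • v) : t k • v = q • v := by
  rw [← sub_eq_zero]
  by_contra h0
  have h3 : jm q t k • (t k • v - q • v) = qInt q ((cnt r k β : ℤ) - β + 1) • (t k • v - q • v) := by
    rw [smul_sub, smul_smul_comm', h.jm_smul_t_smul hk h2, h1, rowValue, qInt_add_one h.q_ne]
    generalize t k • v = w
    module
  obtain ⟨α, h4, h5⟩ := hB.eigenvalue hr (Wt_sub (h.Wt_t_smul hk hv) (Wt_smul hv q)) h3 h0
  exact rowValue_ne h.q_ne hg hk hβ h4 (by norm_num) h5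

theorem Branches.t_smul_below (h : HeckeFam n q t) (hg : QGood n q) {k : ℕ} (hk : k + 1 < n)
    (hB : Branches q t M k) {r : ℕ → ℕ} (hr : Lattice k r) {v : M} (hv : Wt q t k r v) {β : ℕ}
    (hβ : Addable (cnt r k) β) (h1 : jm q t k • v = rowValue q (cnt r k) β • v)
    (h2 : jm q t (k + 1) • v = qInt q ((cnt r k β : ℤ) - β + -1) • v) : t k • v = -v := by
  rw [eq_neg_iff_add_eq_zero]
  by_contra h0
  have h3 : jm q t k • (t k • v + v) = qInt q ((cnt r k β : ℤ) - β + -1) • (t k • v + v) := by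
    have e := qInt_add_one h.q_ne ((cnt r k β : ℤ) - β + -1)
    rw [show (cnt r k β : ℤ) - β + -1 + 1 = (cnt r k β : ℤ) - β by ring] at e
    rw [smul_add, h.jm_smul_t_smul hk h2, h1, rowValue, e]
    generalize t k • v = w
    module
  obtain ⟨α, h4, h5⟩ := hB.eigenvalue hr (Wt_add (h.Wt_t_smul hk hv) hv) h3 h0
  exact rowValue_ne h.q_ne hg hk hβ h4 (by norm_num) h5

/-- On v the braid relation reads a²b = ab². -/
theorem braid_smul (h : HeckeFam n q t) {k : ℕ} (hk : k + 2 < n) {v : M} {a b : ℂ}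
    (ha : t k • v = a • v) (hb : t (k + 1) • v = b • v) (hab : a * b * (a - b) ≠ 0) : v = 0 := by
  have h1 := congrArg (fun x : A => x • v) (h.braid k hk)
  have e : ∀ (i : ℕ) (c : ℂ) (w : M), t i • c • w = c • t i • w := fun i c w =>
    smul_smul_comm' c (t i) w
  simp only [mul_smul, ha, hb, e] at h1
  have h2 : (a * b * (a - b)) • v = 0 := by
    have := sub_eq_zero.2 h1
    rw [← this]; module
  exact (smul_eq_zero.1 h2).resolve_left hab

/-- The intertwiners involved only use generators that commute with the Jucys-Murphy element of
position k + 1, so they preserve its eigenvalue e; being invertible, they do not kill u. -/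
theorem swapClosed_exists (h : HeckeFam n q t) (hg : QGood n q) {k : ℕ} (hk : k + 1 < n) (e : ℂ) :
    SwapClosed (k + 1) 0 k fun r => ∃ u : M, u ≠ 0 ∧ Wt q t (k + 1) r u ∧
      jm q t (k + 1) • u = e • u := by
  rintro r l hr - hl hs ⟨u, h0, h1, h2⟩
  refine ⟨tauOf q t r l • u, fun h3 => ?_, h.Wt_tauOf (by omega) h1 (by omega) hs.1, ?_⟩
  · have h4 := h.tauOf_swap_tauOf (r := r) (show l + 1 < n by omega) hs.1 u
    rw [h3, smul_zero] at h4
    exact (smul_ne_zero (tauOf_tauOf_ne h.q_ne hg (by omega) hr (by omega) hs) h0) h4.symm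
  · rw [tauOf, tau_smul, smul_sub, smul_smul_comm', smul_smul_comm', smul_smul,
      ← (h.commute_jm (i := l) (k := k + 1) (by omega) hk (by omega) (by omega)).eq, mul_smul, h2,
      smul_smul_comm']
    generalize t l • u = w
    module

/-- The next box would stand right of the last box although the row above is too short. Then the box
above the last one ends its row and can be moved to the position just before. The result is an L:
the first two of three consecutive boxes are vertical neighbours (eigenvalue -1), the last two have
the eigenvalues of row neighbours (eigenvalue q), and the braid relation forbids this. -/
theorem not_right (h : HeckeFam n q t) (hg : QGood n q) {k : ℕ} (hk : k + 1 < n)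
    (hB : ∀ l ≤ k, Branches q t M l) {r : ℕ → ℕ} (hr : Lattice (k + 1) r) {u : M}
    (hu : Wt q t (k + 1) r u) (h2 : jm q t (k + 1) • u = qInt q (ct r k + 1) • u)
    (hna : ¬ Addable (cnt r (k + 1)) (r k)) : u = 0 := by
  by_contra h0
  have hra := hr.addable (Nat.lt_succ_self k)
  unfold Addable at hna
  push Not at hna
  obtain ⟨a, ha, hna⟩ := hna
  have hρ : 1 ≤ r k := by omega
  have h3 := hr k (by omega) (show a ≤ r k - 1 by omega)
  have h4 := hra (r k - 1) (by omega)
  rw [cnt_succ, cnt_succ, if_pos rfl, if_neg ha.ne'] at hna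
  obtain ⟨r1, g1, ⟨u1, f0, f1, f2⟩, g3, g4, g5, g6⟩ := (h.swapClosed_exists hg hk _).move
    (Nat.le_succ k) (γ := r k - 1) hr ⟨u, h0, hu, h2⟩
    (by rw [show r k - 1 + 1 = r k by omega]; exact h4) (by simp; omega)
  obtain ⟨l, rfl⟩ : ∃ l, k = l + 1 := ⟨k - 1, by omega⟩
  rw [Nat.add_sub_cancel] at g4
  have e1 : r1 (l + 1) = r (l + 1) := g5 _ (Or.inr le_rfl)
  have e2 : ct r1 (l + 1) = ct r (l + 1) := by rw [ct, ct, g6, e1]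
  have k1 := congrFun g6 (r (l + 1))
  have k2 := congrFun g6 (r (l + 1) - 1)
  rw [cnt_succ, if_neg (by omega)] at k1
  rw [cnt_succ, if_pos g4] at k2
  have e3 : ct r1 (l + 1) = ct r1 l + -1 := by
    rw [e2, ct, ct, g4]
    omega
  have h5 : t l • u1 = (-1 : ℂ) • u1 := by
    rw [neg_one_smul]
    refine Branches.t_smul_below h hg (by omega) (hB l (by omega)) (g1.mono (by omega))
      (Wt_mono f1 (by omega)) (g1.addable (show l < l + 1 + 1 by omega)) (f1 l (by omega)) ?_
    rw [f1 (l + 1) (by omega), e3, ct]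
  have h6 : t (l + 1) • u1 = q • u1 := by
    refine Branches.t_smul_right h hg hk (hB (l + 1) le_rfl) (g1.mono (by omega))
      (Wt_mono f1 (by omega)) (g1.addable (show l + 1 < l + 1 + 1 by omega))
      (f1 (l + 1) (by omega)) ?_
    rw [f2, ← e2, ct]
  refine f0 (h.braid_smul hk h5 h6 ?_)
  have := hg.ne_neg_one h.q_ne (by omega)
  rw [show -1 * q * (-1 - q) = q * (1 + q) by ring]
  exact mul_ne_zero h.q_ne this

/-- The transpose of `not_right`: the box to the left of the last one is movable to the position
before it, which gives eigenvalues q and -1 for two braiding generators. -/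
theorem not_below (h : HeckeFam n q t) (hg : QGood n q) {k : ℕ} (hk : k + 1 < n)
    (hB : ∀ l ≤ k, Branches q t M l) {r : ℕ → ℕ} (hr : Lattice (k + 1) r) {u : M}
    (hu : Wt q t (k + 1) r u) (h2 : jm q t (k + 1) • u = qInt q (ct r k + -1) • u)
    (hna : cnt r k (r k + 1) < cnt r k (r k)) : u = 0 := by
  by_contra h0
  have hra := hr.addable (Nat.lt_succ_self k)
  obtain ⟨r1, g1, ⟨u1, f0, f1, f2⟩, g3, g4, g5, g6⟩ := (h.swapClosed_exists hg hk _).move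
    (Nat.le_succ k) (γ := r k) hr ⟨u, h0, hu, h2⟩ hna (by simp; omega)
  obtain ⟨l, rfl⟩ : ∃ l, k = l + 1 := ⟨k - 1, by omega⟩
  rw [Nat.add_sub_cancel] at g4
  have e1 : r1 (l + 1) = r (l + 1) := g5 _ (Or.inr le_rfl)
  have e2 : ct r1 (l + 1) = ct r (l + 1) := by rw [ct, ct, g6, e1]
  have k1 := congrFun g6 (r (l + 1))
  rw [cnt_succ, if_pos g4] at k1
  have e3 : ct r1 (l + 1) = ct r1 l + 1 := by
    rw [e2, ct, ct, g4]
    omega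
  have h5 : t l • u1 = q • u1 := by
    refine Branches.t_smul_right h hg (by omega) (hB l (by omega)) (g1.mono (by omega))
      (Wt_mono f1 (by omega)) (g1.addable (show l < l + 1 + 1 by omega)) (f1 l (by omega)) ?_
    rw [f1 (l + 1) (by omega), e3, ct]
  have h6 : t (l + 1) • u1 = (-1 : ℂ) • u1 := by
    rw [neg_one_smul]
    refine Branches.t_smul_below h hg hk (hB (l + 1) le_rfl) (g1.mono (by omega))
      (Wt_mono f1 (by omega)) (g1.addable (show l + 1 < l + 1 + 1 by omega))
      (f1 (l + 1) (by omega)) ?_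
    rw [f2, ← e2, ct]
  refine f0 (h.braid_smul hk h5 h6 ?_)
  have := hg.ne_neg_one h.q_ne (by omega)
  rw [show q * -1 * (q - -1) = -(q * (1 + q)) by ring]
  exact neg_ne_zero.2 (mul_ne_zero h.q_ne this)

/-- If `v` has eigenvalue `z` for `J_k`, and the vectors of its `H_k`-weight have only the
eigenvalues `z` and the roots of `R`, then `v` is annihilated by an explicit polynomial in
`J_{k+1}`. -/
theorem aeval_jm_succ_eq_zero (h : HeckeFam n q t) {k : ℕ} (hk : k + 1 < n) {z : ℂ} {R : ℂ[X]}
    {r : ℕ → ℕ} {v : M} (hv : Wt q t k r v) (hz : jm q t k • v = z • v)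
    (hR : ∀ u : M, Wt q t k r u → aeval (jm q t k) ((X - C z) * R) • u = 0) :
    aeval (jm q t (k + 1)) (R * ((X - C (q * z + 1)) * (C q * X - C (z - 1)))) • v = 0 := by
  set y := jm q t (k + 1) with hy
  have hc : Commute y (jm q t k) := h.jm_commute_jm (by omega) hk
  have ev : ∀ f g : ℂ[X], aeval y f • aeval y g • v = aeval y (f * g) • v := fun f g => by
    rw [map_mul, mul_smul]
  have es : ∀ (c : ℂ) (g : ℂ[X]), c • aeval y g • v = aeval y (C c * g) • v := fun c g => by
    rw [map_mul, mul_smul, aeval_C, algebraMap_smul]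
  -- The vector t k • g(y) v still has weight r on the first k positions, so (X - z) R kills it at
  -- position k. Moving this polynomial past t k turns the vanishing into a relation in y.
  have key : ∀ g : ℂ[X], t k • aeval y ((X - C z) * (R * g)) • v =
      aeval y ((C 1 + C (q - 1) * X) * (R * g)) • v := fun g => by
    have hw : jm q t k • aeval y g • v = z • aeval y g • v := by
      rw [smul_smul, (commute_aeval hc.symm g).eq, mul_smul, hz, smul_smul_comm']
    have hw' : Wt q t k r (aeval y g • v) :=
      Wt_of_commute hv fun l hl => (commute_aeval (h.jm_commute_jm hk (by omega)) g).symm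
    obtain ⟨G, h1, h2⟩ := h.aeval_jm_t_smul (M := M) hk z ((X - C z) * R)
    have hG : G = R := by
      rw [eval_mul, eval_sub, eval_X, eval_C, sub_self, zero_mul, C_0, sub_zero] at h1
      exact mul_left_cancel₀ (X_sub_C_ne_zero z) h1
    have h3 := h2 _ hw
    rw [hR _ (h.Wt_t_smul hk hw'), hG, eq_comm, sub_eq_zero, ← hy, ev, ev, mul_assoc] at h3
    have e : aeval y (C 1 + C (q - 1) * X) = 1 + (q - 1) • y := by simp [Algebra.smul_def]
    rw [h3, ← e, ev]
  -- A second application of t k, with the quadratic relation, eliminates t k. The resulting factor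
  -- has the roots q z + 1 and (z - 1) / q, which are [c + 1] and [c - 1] when z = [c].
  have k4 := congrArg (fun w => t k • w) (key (X - C z))
  rw [h.t_t_smul hk, key, show (C 1 + C (q - 1) * X) * (R * (X - C z)) =
    (X - C z) * (R * (C 1 + C (q - 1) * X)) by ring, key] at k4
  have k5 := sub_eq_zero.2 k4
  rw [es, es, ← add_smul, ← map_add, ← sub_smul, ← map_sub] at k5
  rw [← k5]
  congr 2
  simp only [C_add, C_sub, C_mul, C_1]
  ring

/-- Induction on k. If the last box of r has content c, `aeval_jm_succ_eq_zero` leaves as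
eigenvalues of the next Jucys-Murphy element [c + 1], [c - 1] and the values of the other boxes
addable before. The latter boxes remain addable; [c + 1] and [c - 1] come from addable boxes or have
no eigenvectors, by `not_right` and `not_below`. -/
theorem branches (h : HeckeFam n q t) (hg : QGood n q) {k : ℕ} (hk : k < n) :
    Branches q t M k := by
  induction k using Nat.strong_induction_on with
  | _ k ih =>
  intro r hr v hv
  have hupd : ∀ β : ℕ, ∀ i < k, Function.update r k β i = r i := fun β i hi =>
    Function.update_of_ne (by omega) _ _
  have mem : ∀ (u : M) (β : ℕ), Addable (cnt r k) β → Wt q t k r u →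
      jm q t k • u = rowValue q (cnt r k) β • u → u ∈ Submodule.span ℂ {u : M |
        ∃ r', (∀ i < k, r' i = r i) ∧ Lattice (k + 1) r' ∧ Wt q t (k + 1) r' u} := by
    intro u β hβ hu he
    refine Submodule.subset_span ⟨Function.update r k β, hupd β, lattice_succ ?_ ?_, ?_⟩
    · exact hr.congr fun i hi => (hupd β i hi).symm
    · rwa [cnt_congr (hupd β), Function.update_self]
    · refine Wt_succ (Wt_congr hu fun i hi => (hupd β i hi).symm) ?_
      rw [ct_eq (hupd β), Function.update_self, he]
  rcases k with _ | k
  · refine mem v 0 (fun a ha => by omega) hv ?_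
    simp [jm, rowValue, qInt_zero]
  have hB : ∀ l ≤ k, Branches q t M l := fun l hl => ih l (by omega) (by omega)
  have hra : Addable (cnt r k) (r k) := hr.addable (Nat.lt_succ_self k)
  have hup : qInt q (ct r k + 1) = q * qInt q (ct r k) + 1 := qInt_add_one h.q_ne _
  have hdown : qInt q (ct r k) = q * qInt q (ct r k + -1) + 1 := by
    rw [← qInt_add_one h.q_ne, neg_add_cancel_right]
  have hpm : qInt q (ct r k + 1) ≠ qInt q (ct r k + -1) := by
    refine hg.ne h.q_ne (by omega) ?_
    rw [abs_le]; omega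
  classical
  -- The range loses no row, because an addable row of a shape with k boxes has index at most k.
  set S : Finset ℕ := (Finset.range (k + 1)).filter fun β => β ≠ r k ∧ Addable (cnt r k) β with hS
  set c := rowValue q (cnt r k) with hc
  have hinj : ∀ α, Addable (cnt r k) α → ∀ β, Addable (cnt r k) β → c α = c β → α = β := by
    intro α hα β hβ hαβ
    by_contra hne
    obtain ⟨h1, h2⟩ := addable_content_diff hα hβ hne
    refine hg.ne h.q_ne ?_ (by omega) hαβ
    intro h3
    rw [h3, sub_self, abs_zero] at h1
    omega
  have hz : jm q t k • v = qInt q (ct r k) • v := hv k (Nat.lt_succ_self k)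
  have h1 := h.aeval_jm_succ_eq_zero (z := qInt q (ct r k))
    (R := ∏ β ∈ S, (X - C (c β))) hk (Wt_mono hv (Nat.le_succ k)) hz (by
      intro u hu
      have e : (X - C (qInt q (ct r k))) * ∏ β ∈ S, (X - C (c β)) =
          ∏ e ∈ insert (qInt q (ct r k)) (S.image c), (X - C e) := by
        rw [Finset.prod_insert, Finset.prod_image]
        · intro α hα β hβ
          exact hinj α (Finset.mem_filter.1 hα).2.2 β (Finset.mem_filter.1 hβ).2.2
        · intro hm
          obtain ⟨β, hβ, he⟩ := Finset.mem_image.1 hm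
          exact (Finset.mem_filter.1 hβ).2.1 (hinj _ (Finset.mem_filter.1 hβ).2.2 _ hra he)
      rw [e]
      refine aeval_prod_smul_eq_zero (Submodule.span_mono ?_
        ((hB k le_rfl).mem_span (hr.mono (Nat.le_succ k)) hu))
      rintro w ⟨_, ⟨β, hβ, rfl⟩, hw⟩
      refine ⟨_, ?_, hw⟩
      by_cases hβr : β = r k
      · subst hβr; exact Finset.mem_insert_self _ _
      · refine Finset.mem_insert_of_mem (Finset.mem_image_of_mem c (Finset.mem_filter.2 ⟨?_, hβr, hβ⟩))
        exact Finset.mem_range.2 (Nat.lt_succ_of_le (addable_le_self hβ)))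
  set E : Finset ℂ := insert (qInt q (ct r k + 1)) (insert (qInt q (ct r k + -1)) (S.image c))
  have h2 : aeval (jm q t (k + 1)) (∏ e ∈ E, (X - C e)) • v = 0 := by
    have e : (∏ β ∈ S, (X - C (c β))) * ((X - C (q * qInt q (ct r k) + 1)) *
        (C q * X - C (qInt q (ct r k) - 1))) = C q * ∏ e ∈ E, (X - C e) := by
      rw [Finset.prod_insert, Finset.prod_insert, Finset.prod_image, ← hup, hdown,
        add_sub_cancel_right, C_mul]
      · ring
      · intro α hα β hβ
        exact hinj α (Finset.mem_filter.1 hα).2.2 β (Finset.mem_filter.1 hβ).2.2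
      · intro hm
        obtain ⟨β, hβ, he⟩ := Finset.mem_image.1 hm
        exact rowValue_ne h.q_ne hg hk hra (Finset.mem_filter.1 hβ).2.2 (d := -1) (by norm_num)
          he.symm
      · intro hm
        rcases Finset.mem_insert.1 hm with hm | hm
        · exact hpm hm
        obtain ⟨β, hβ, he⟩ := Finset.mem_image.1 hm
        exact rowValue_ne h.q_ne hg hk hra (Finset.mem_filter.1 hβ).2.2 (d := 1) (by norm_num)
          he.symm
    rw [e, map_mul, mul_smul, aeval_C, algebraMap_smul] at h1
    exact (smul_eq_zero.1 h1).resolve_left h.q_ne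
  refine Submodule.span_le.2 ?_ (mem_span_eigen h2)
  rintro u ⟨e, heE, ⟨g, rfl⟩, hu⟩
  rw [SetLike.mem_coe]
  set u := aeval (jm q t (k + 1)) g • v
  have hw : Wt q t (k + 1) r u := Wt_of_commute hv fun l hl =>
    (commute_aeval (h.jm_commute_jm hk (by omega)) g).symm
  have hrow : ∀ β, β ≠ r k → rowValue q (cnt r (k + 1)) β = rowValue q (cnt r k) β := fun β hβ => by
    rw [rowValue, rowValue, cnt_succ, if_neg hβ.symm, add_zero]
  have hrow' : rowValue q (cnt r (k + 1)) (r k) = qInt q (ct r k + 1) := by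
    rw [rowValue, cnt_succ, if_pos rfl, ct]
    congr 1
    push_cast
    ring
  rcases Finset.mem_insert.1 heE with rfl | heE
  · by_cases ha : Addable (cnt r (k + 1)) (r k)
    · exact mem u _ ha hw (by rw [hu, hrow'])
    · rw [h.not_right hg hk hB hr hw hu ha]
      exact Submodule.zero_mem _
  rcases Finset.mem_insert.1 heE with rfl | heE
  · rcases Nat.lt_or_ge (cnt r k (r k + 1)) (cnt r k (r k)) with ha | ha
    · rw [h.not_below hg hk hB hr hw hu ha]
      exact Submodule.zero_mem _
    · have ha' := hr k (by omega) (show r k ≤ r k + 1 by omega)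
      refine mem u (r k + 1) (fun a hlt => ?_) hw ?_
      · have := hra a
        rw [cnt_succ, cnt_succ, if_neg (by omega)]
        split_ifs with h3
        · subst h3; omega
        · have := this (by omega); omega
      · rw [hu, hrow _ (by omega), rowValue, ct]
        congr 2
        push_cast
        omega
  · obtain ⟨β, hβ, rfl⟩ := Finset.mem_image.1 heE
    obtain ⟨-, hβ, hβa⟩ := Finset.mem_filter.1 hβ
    refine mem u β (fun a ha => ?_) hw (by rw [hu, hrow β hβ])
    have := hβa a ha
    rw [cnt_succ, cnt_succ, if_neg (Ne.symm hβ)]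
    omega

end HeckeFam
end HeckeStrip
end

/-! ### Weight projectors, seminormal form and the subalgebras of initial positions -/

noncomputable section
open scoped RightActions
namespace HeckeStrip

open Polynomial

variable {A : Type*} [Ring A] [Algebra ℂ A]
variable {M : Type*} [AddCommGroup M] [Module ℂ M] [Module A M] [IsScalarTower ℂ A M]

set_option linter.unusedSectionVars false

/-- A diagonal box other than the corner needs at least three earlier boxes, so the entries 2 and 3
never have content 0. -/
theorem ct_mem_contents {m : ℕ} {r : ℕ → ℕ} (hr : Lattice (m + 1) r) :
    ct r m ∈ contents (m + 1) := by
  have ha := hr.addable (Nat.lt_succ_self m)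
  have h1 := addable_le_self ha
  have h2 : cnt r m (r m) ≤ m := (Finset.card_filter_le _ _).trans (by simp)
  refine Finset.mem_filter.2 ⟨Finset.mem_Ioo.2 ⟨?_, ?_⟩, ?_⟩
  · unfold ct; push_cast; omega
  · unfold ct; push_cast; omega
  · rintro ⟨h3, h4⟩
    have h5 : cnt r m (r m) = r m := by unfold ct at h3; omega
    rcases Nat.eq_zero_or_pos (r m) with h6 | h6
    · rw [h6] at h5
      have h7 := hr m (Nat.le_succ m) (Nat.zero_le (r 0))
      have h8 : cnt r 1 (r 0) ≤ cnt r m (r 0) := cnt_mono r (r 0) (show 1 ≤ m by omega)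
      rw [cnt_succ, if_pos rfl] at h8
      omega
    · have h7 := addable_le rfl ha h6
      have h8 := ha 0 h6
      have h9 : r m = 1 := by omega
      have h10 := sum_cnt_le r m 2
      rw [Finset.sum_range_succ, Finset.sum_range_one] at h10
      rw [h9] at h5 h8
      omega

/-- The lattice words of length `n`, extended by `0`. -/
def latticeWords (n : ℕ) : Set (ℕ → ℕ) := {r | Lattice n r ∧ ∀ i, n ≤ i → r i = 0}

theorem latticeWords_finite (n : ℕ) : (latticeWords n).Finite := by
  refine (Set.finite_range fun f : Fin n → Fin (n + 1) =>
    fun i : ℕ => if h : i < n then (f ⟨i, h⟩ : ℕ) else 0).subset ?_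
  rintro r ⟨h1, h2⟩
  refine ⟨fun i => ⟨r i, ?_⟩, funext fun i => ?_⟩
  · have := addable_le_self (h1.addable i.2)
    have := i.2
    omega
  · dsimp only
    split_ifs with h
    · rfl
    · exact (h2 i (by omega)).symm

theorem exists_latticeWord {n : ℕ} {r : ℕ → ℕ} (hr : Lattice n r) :
    ∃ r' ∈ latticeWords n, ∀ i < n, r i = r' i :=
  have h : ∀ i < n, r i = if i < n then r i else 0 := fun i hi => by rw [if_pos hi]
  ⟨fun i => if i < n then r i else 0,
    ⟨hr.congr h, fun i hi => if_neg (by omega)⟩, h⟩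

open Classical in
/-- The product of Lagrange interpolation polynomials in the Jucys-Murphy elements that projects
onto the vectors of weight `r`. -/
def wtProj (n : ℕ) (q : ℂ) (t : ℕ → A) (r : ℕ → ℕ) : A :=
  ((List.range n).map fun m => aeval (jm q t m)
    (Lagrange.basis ((contents (m + 1)).image (qInt q)) id (qInt q (ct r m)))).prod

theorem list_prod_smul {ι : Type*} (l : List ι) (f : ι → A) (g : ι → ℂ) (u : M)
    (h : ∀ i ∈ l, f i • u = g i • u) : (l.map f).prod • u = (l.map g).prod • u := by
  induction l with
  | nil => simp
  | cons i l ih =>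
    rw [List.map_cons, List.prod_cons, mul_smul, ih fun j hj => h j (List.mem_cons_of_mem _ hj),
      smul_smul_comm', h i List.mem_cons_self, smul_smul, List.map_cons, List.prod_cons, mul_comm]

namespace HeckeFam

variable {n : ℕ} {q : ℂ} {t : ℕ → A}

/-- With the next two lemmas, Young's seminormal form: a generator acts on a weight vector by q, by
-1, or through v and its image under the intertwiner. -/
theorem t_smul_row (h : HeckeFam n q t) (hg : QGood n q) {m k : ℕ} (hm : m ≤ n) (hk : k + 1 < m)
    {r : ℕ → ℕ} (hr : Lattice m r) {v : M} (hv : Wt q t m r v) (he : r k = r (k + 1)) :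
    t k • v = q • v := by
  refine Branches.t_smul_right h hg (by omega) (h.branches hg (by omega)) (hr.mono (by omega))
    (Wt_mono hv (by omega)) (hr.addable (by omega)) (hv k (by omega)) ?_
  rw [hv (k + 1) hk, ct, cnt_succ, ← he, if_pos rfl]
  congr 2
  push_cast
  ring

theorem t_smul_vertical (h : HeckeFam n q t) (hg : QGood n q) {m k : ℕ} (hm : m ≤ n)
    (hk : k + 1 < m) {r : ℕ → ℕ} (hr : Lattice m r) {v : M} (hv : Wt q t m r v)
    (he : Vertical r k) : t k • v = -v := by
  refine Branches.t_smul_below h hg (by omega) (h.branches hg (by omega)) (hr.mono (by omega))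
    (Wt_mono hv (by omega)) (hr.addable (by omega)) (hv k (by omega)) ?_
  rw [hv (k + 1) hk, ct, cnt_succ, if_neg (by have := he.1; omega), he.2, he.1]
  congr 2
  push_cast
  ring

theorem t_smul_swappable (hq : q ≠ 0) (hg : QGood n q) {m k : ℕ} (hm : m ≤ n)
    (hk : k + 1 < m) {r : ℕ → ℕ} (hr : Lattice m r) (v : M) (hs : Swappable r k) :
    t k • v = (qInt q (ct r (k + 1)) - qInt q (ct r k))⁻¹ •
      (tauOf q t r k • v + (1 + (q - 1) * qInt q (ct r (k + 1))) • v) := by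
  have := sub_ne_zero.2 (content_ne hq hg hm hr hk hs)
  rw [tauOf, tau_smul, sub_add_cancel, smul_smul, inv_mul_cancel₀ this, one_smul]

theorem mem_span_Wt (h : HeckeFam n q t) (hg : QGood n q) {m : ℕ} (hm : m ≤ n) (v : M) :
    v ∈ Submodule.span ℂ {u : M | ∃ r, Lattice m r ∧ Wt q t m r u} := by
  induction m with
  | zero => exact Submodule.subset_span ⟨fun _ => 0, lattice_zero _, fun k hk => by omega⟩
  | succ m ih =>
    refine Submodule.span_le.2 ?_ (ih (by omega))
    rintro u ⟨r, hr, hu⟩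
    refine Submodule.span_mono ?_ (h.branches hg (by omega) r hr u hu)
    rintro w ⟨r', -, h1, h2⟩
    exact ⟨r', h1, h2⟩

/-- At the first difference both letters are addable rows of one common shape, so their q-contents
differ. Hence a weight determines its tableau. -/
theorem exists_ct_ne (hq : q ≠ 0) (hg : QGood n q) {m : ℕ} (hm : m ≤ n) {r r' : ℕ → ℕ}
    (hr : Lattice m r) (hr' : Lattice m r') (hne : ∃ i < m, r i ≠ r' i) :
    ∃ i < m, qInt q (ct r i) ≠ qInt q (ct r' i) := by
  classical
  have h1 := Nat.find_spec hne
  have h2 : ∀ i < Nat.find hne, r i = r' i := fun i hi => by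
    have := Nat.find_min hne hi
    by_contra h3
    exact this ⟨by omega, h3⟩
  generalize Nat.find hne = k at h1 h2
  refine ⟨k, h1.1, ?_⟩
  have h3 := hr'.addable h1.1
  rw [← cnt_congr h2] at h3
  obtain ⟨h4, h5⟩ := addable_content_diff (hr.addable h1.1) h3 h1.2
  rw [ct, ct, ← cnt_congr h2]
  refine hg.ne hq ?_ (by omega)
  intro h6
  rw [h6, sub_self, abs_zero] at h4
  omega

theorem Wt_eq_zero (hq : q ≠ 0) (hg : QGood n q) {m : ℕ} (hm : m ≤ n) {r r' : ℕ → ℕ}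
    (hr : Lattice m r) (hr' : Lattice m r') (hne : ∃ i < m, r i ≠ r' i) {u : M}
    (hu : Wt q t m r u) (hu' : Wt q t m r' u) : u = 0 := by
  obtain ⟨i, hi, h1⟩ := exists_ct_ne hq hg hm hr hr' hne
  have h2 := (hu i hi).symm.trans (hu' i hi)
  rw [← sub_eq_zero, ← sub_smul] at h2
  exact (smul_eq_zero.1 h2).resolve_left (sub_ne_zero.2 h1)

/-- Each Lagrange factor acts on a weight vector by a scalar: 1 at its own content, 0 at every other
possible one. -/
theorem wtProj_smul (r r' : ℕ → ℕ) {u : M} (hu : Wt q t n r' u) :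
    ∃ c : ℂ, wtProj n q t r • u = c • u ∧
      (Lattice n r → (∀ i < n, r i = r' i) → c = 1) ∧
      (Lattice n r' → (∃ i < n, qInt q (ct r i) ≠ qInt q (ct r' i)) → c = 0) := by
  classical
  refine ⟨_, list_prod_smul _ _ (fun m => eval (qInt q (ct r' m))
    (Lagrange.basis ((contents (m + 1)).image (qInt q)) id (qInt q (ct r m)))) _
    fun m hm => ?_, ?_, ?_⟩
  · convert aeval_smul_of_eigen (hu m (List.mem_range.1 hm)) _
  · intro hr he
    refine List.prod_eq_one fun x hx => ?_
    obtain ⟨m, hm, rfl⟩ := List.mem_map.1 hx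
    rw [List.mem_range] at hm
    rw [← ct_congr fun i hi => he i (by omega)]
    exact Lagrange.eval_basis_self (v := id) Function.injective_id.injOn
      (Finset.mem_image_of_mem _ (ct_mem_contents (hr.mono hm)))
  · rintro hr' ⟨m, hm, hne⟩
    refine List.prod_eq_zero (List.mem_map.2 ⟨m, List.mem_range.2 hm, ?_⟩)
    exact Lagrange.eval_basis_of_ne (v := id) hne
      (Finset.mem_image_of_mem _ (ct_mem_contents (hr'.mono hm)))

theorem wtProj_smul_self {r r' : ℕ → ℕ} (hr : Lattice n r) {u : M} (hu : Wt q t n r' u)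
    (he : ∀ i < n, r i = r' i) : wtProj n q t r • u = u := by
  obtain ⟨c, h1, h2, -⟩ := wtProj_smul r r' hu
  rw [h1, h2 hr he, one_smul]

theorem wtProj_smul_of_ne (hq : q ≠ 0) (hg : QGood n q) {r r' : ℕ → ℕ} (hr : Lattice n r)
    (hr' : Lattice n r') {u : M} (hu : Wt q t n r' u) (hne : ∃ i < n, r i ≠ r' i) :
    wtProj n q t r • u = 0 := by
  obtain ⟨c, h1, -, h2⟩ := wtProj_smul r r' hu
  rw [h1, h2 hr' (exists_ct_ne hq hg le_rfl hr hr' hne), zero_smul]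

theorem Wt_wtProj (h : HeckeFam n q t) (hg : QGood n q) {r : ℕ → ℕ} (hr : Lattice n r) (x : M) :
    Wt q t n r (wtProj n q t r • x) := by
  have hx := h.mem_span_Wt hg le_rfl x
  induction hx using Submodule.span_induction with
  | mem u hu =>
    obtain ⟨r', hr', hu⟩ := hu
    by_cases he : ∀ i < n, r i = r' i
    · rw [wtProj_smul_self hr hu he]; exact Wt_congr hu fun i hi => (he i hi).symm
    · push Not at he
      rw [wtProj_smul_of_ne h.q_ne hg hr hr' hu he]
      exact Wt_zero _ _
  | zero => rw [smul_zero]; exact Wt_zero _ _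
  | add u w _ _ hu hw => rw [smul_add]; exact Wt_add hu hw
  | smul c u _ hu => rw [smul_smul_comm']; exact Wt_smul hu c

theorem sum_wtProj_smul (h : HeckeFam n q t) (hg : QGood n q) (x : M) :
    ∑ r ∈ (latticeWords_finite n).toFinset, wtProj n q t r • x = x := by
  have hx := h.mem_span_Wt hg le_rfl x
  induction hx using Submodule.span_induction with
  | mem u hu =>
    obtain ⟨r', hr', hu⟩ := hu
    obtain ⟨s, hs, he⟩ := exists_latticeWord hr'
    rw [Finset.sum_eq_single s]
    · exact wtProj_smul_self hs.1 hu fun i hi => (he i hi).symm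
    · intro r hr hne
      rw [Set.Finite.mem_toFinset] at hr
      refine wtProj_smul_of_ne h.q_ne hg hr.1 hr' hu ?_
      by_contra! hc
      refine hne (funext fun i => ?_)
      rcases Nat.lt_or_ge i n with hi | hi
      · rw [hc i hi, he i hi]
      · rw [hr.2 i hi, hs.2 i hi]
    · intro hn
      exact absurd ((latticeWords_finite n).mem_toFinset.2 hs) hn
  | zero => simp
  | add u w _ _ hu hw => simp only [smul_add, Finset.sum_add_distrib, hu, hw]
  | smul c u _ hu => simp only [smul_smul_comm' c, ← Finset.smul_sum, hu]

theorem exists_wtProj_ne_zero (h : HeckeFam n q t) (hg : QGood n q) {x : M} (hx : x ≠ 0) :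
    ∃ r ∈ latticeWords n, wtProj n q t r • x ≠ 0 := by
  by_contra! hc
  refine hx ?_
  rw [← h.sum_wtProj_smul hg x]
  exact Finset.sum_eq_zero fun r hr => hc r ((latticeWords_finite n).mem_toFinset.1 hr)

/-! ### Vectors of a given shape -/

/-- The span of the vectors in `K` of weights that are tableaux of shape `p`. -/
def shapeSpan (q : ℂ) (t : ℕ → A) (K : Submodule ℂ M) (m : ℕ) (p : ℕ → ℕ) : Submodule ℂ M :=
  Submodule.span ℂ {y | y ∈ K ∧ ∃ r, Lattice m r ∧ cnt r m = p ∧ Wt q t m r y}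

theorem tauOf_smul_mem {K : Submodule ℂ M} {k : ℕ} (hK : ∀ y ∈ K, t k • y ∈ K) (r : ℕ → ℕ) {y : M}
    (hy : y ∈ K) : tauOf q t r k • y ∈ K := by
  rw [tauOf, tau_smul]
  exact K.sub_mem (K.smul_mem _ (hK y hy)) (K.smul_mem _ hy)

/-- Exchanges do not change the shape. The subspace K is carried along so that it can later be taken
to be an orbit. -/
theorem t_smul_mem_shapeSpan (h : HeckeFam n q t) (hg : QGood n q) {m k : ℕ} (hm : m ≤ n)
    (hk : k + 1 < m) {K : Submodule ℂ M} (hK : ∀ y ∈ K, t k • y ∈ K) {p : ℕ → ℕ} {x : M}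
    (hx : x ∈ shapeSpan q t K m p) : t k • x ∈ shapeSpan q t K m p := by
  unfold shapeSpan at hx
  induction hx using Submodule.span_induction with
  | mem y hy =>
    have hy' : y ∈ shapeSpan q t K m p := Submodule.subset_span hy
    obtain ⟨hyK, r, hr, hp, hy⟩ := hy
    by_cases h1 : r k = r (k + 1)
    · rw [h.t_smul_row hg hm hk hr hy h1]; exact Submodule.smul_mem _ _ hy'
    by_cases h2 : Vertical r k
    · rw [h.t_smul_vertical hg hm hk hr hy h2]; exact Submodule.neg_mem _ hy'
    have hs : Swappable r k := ⟨h1, h2⟩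
    rw [t_smul_swappable h.q_ne hg hm hk hr y hs]
    refine Submodule.smul_mem _ _ (Submodule.add_mem _ (Submodule.subset_span ⟨?_, ?_⟩)
      (Submodule.smul_mem _ _ hy'))
    · exact tauOf_smul_mem hK r hyK
    · exact ⟨_, hr.swapAt hk hs, by rw [cnt_swapAt_ge r (by omega), hp],
        h.Wt_tauOf hm hy hk h1⟩
  | zero => rw [smul_zero]; exact Submodule.zero_mem _
  | add u w _ _ hu hw => rw [smul_add]; exact Submodule.add_mem _ hu hw
  | smul c u _ hu => rw [smul_smul_comm']; exact Submodule.smul_mem _ _ hu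

/-- The subalgebra of the first `m` positions. -/
def subAlg (t : ℕ → A) (m : ℕ) : Subalgebra ℂ A := Algebra.adjoin ℂ {x | ∃ i, i + 1 < m ∧ x = t i}

theorem t_mem_subAlg {m i : ℕ} (hi : i + 1 < m) : t i ∈ subAlg t m :=
  Algebra.subset_adjoin ⟨i, hi, rfl⟩

theorem subAlg_mono {m m' : ℕ} (h : m ≤ m') : subAlg t m ≤ subAlg t m' :=
  Algebra.adjoin_mono fun _ ⟨i, hi, e⟩ => ⟨i, by omega, e⟩

theorem commute_subAlg {m : ℕ} {x : A} (hx : ∀ i, i + 1 < m → Commute (t i) x) {a : A}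
    (ha : a ∈ subAlg t m) : Commute a x := by
  induction ha using Algebra.adjoin_induction with
  | mem y hy => obtain ⟨i, hi, rfl⟩ := hy; exact hx i hi
  | algebraMap c => exact Algebra.commute_algebraMap_left c x
  | add y z _ _ hy hz => exact hy.add_left hz
  | mul y z _ _ hy hz => exact hy.mul_left hz

theorem smul_mem_of_subAlg {m : ℕ} {K : Submodule ℂ M}
    (hK : ∀ k, k + 1 < m → ∀ y ∈ K, t k • y ∈ K) {a : A} (ha : a ∈ subAlg t m) {x : M}
    (hx : x ∈ K) : a • x ∈ K := by
  induction ha using Algebra.adjoin_induction generalizing x with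
  | mem y hy => obtain ⟨i, hi, rfl⟩ := hy; exact hK i hi x hx
  | algebraMap c => rw [algebraMap_smul]; exact K.smul_mem c hx
  | add y z _ _ hy hz => rw [add_smul]; exact K.add_mem (hy hx) (hz hx)
  | mul y z _ _ hy hz => rw [mul_smul]; exact hy (hz hx)

theorem smul_mem_shapeSpan (h : HeckeFam n q t) (hg : QGood n q) {m : ℕ} (hm : m ≤ n)
    {K : Submodule ℂ M} (hK : ∀ k, k + 1 < m → ∀ y ∈ K, t k • y ∈ K) {p : ℕ → ℕ} {a : A}
    (ha : a ∈ subAlg t m) {x : M} (hx : x ∈ shapeSpan q t K m p) :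
    a • x ∈ shapeSpan q t K m p :=
  smul_mem_of_subAlg (fun k hk _ hy => h.t_smul_mem_shapeSpan hg hm hk (hK k hk) hy) ha hx

/-- The orbit of `v` under the subalgebra of the first `m` positions. -/
def orbit (t : ℕ → A) (m : ℕ) (v : M) : Submodule ℂ M :=
  (Subalgebra.toSubmodule (subAlg t m)).map (LinearMap.toSpanSingleton A M v |>.restrictScalars ℂ)

theorem mem_orbit {m : ℕ} {v x : M} : x ∈ orbit t m v ↔ ∃ a ∈ subAlg t m, a • v = x := by
  simp [orbit]

theorem smul_mem_orbit {m : ℕ} {v x : M} {a : A} (ha : a ∈ subAlg t m) (hx : x ∈ orbit t m v) :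
    a • x ∈ orbit t m v := by
  obtain ⟨b, hb, rfl⟩ := mem_orbit.1 hx
  exact mem_orbit.2 ⟨a * b, mul_mem ha hb, mul_smul _ _ _⟩

theorem self_mem_orbit (m : ℕ) (v : M) : v ∈ orbit t m v :=
  mem_orbit.2 ⟨1, one_mem _, one_smul _ _⟩

theorem smul_mem_shapeSpan_orbit (h : HeckeFam n q t) (hg : QGood n q) {m : ℕ} (hm : m ≤ n)
    {r : ℕ → ℕ} (hr : Lattice m r) {v : M} (hv : Wt q t m r v) {a : A} (ha : a ∈ subAlg t m) :
    a • v ∈ shapeSpan q t (orbit t m v) m (cnt r m) :=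
  h.smul_mem_shapeSpan hg hm (fun _ hk _ hy => smul_mem_orbit (t_mem_subAlg hk) hy) ha
    (Submodule.subset_span ⟨self_mem_orbit m v, r, hr, rfl, hv⟩)

/-! ### Multiplicity one -/

/-- The subalgebra of `m + 2` positions is generated by the one of `m + 1` positions, as a
bimodule, by `1` and `t m`. -/
theorem subAlg_succ (h : HeckeFam n q t) {m : ℕ} (hm : m + 2 ≤ n) {a : A}
    (ha : a ∈ subAlg t (m + 2)) :
    a ∈ Submodule.span ℂ {x : A | x ∈ subAlg t (m + 1) ∨
      ∃ b ∈ subAlg t (m + 1), ∃ b' ∈ subAlg t (m + 1), x = b * t m * b'} := by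
  induction m generalizing a with
  | zero =>
    set D := Submodule.span ℂ {x : A | x ∈ subAlg t (0 + 1) ∨
      ∃ b ∈ subAlg t (0 + 1), ∃ b' ∈ subAlg t (0 + 1), x = b * t 0 * b'} with hD
    have hc : ∀ b ∈ subAlg t (0 + 1), Commute b (t 0) := fun b hb =>
      commute_subAlg (fun i hi => by omega) hb
    -- Stability of D under left multiplication is proved on generators; applied to 1 ∈ D it gives
    -- the claim.
    suffices ∀ x ∈ D, a * x ∈ D by
      simpa using this 1 (Submodule.subset_span (Or.inl (one_mem _)))
    induction ha using Algebra.adjoin_induction with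
    | mem y hy =>
      obtain ⟨i, hi, rfl⟩ := hy
      obtain rfl : i = 0 := by omega
      intro x hx
      induction hx using Submodule.span_induction with
      | mem x hx =>
        rcases hx with hx | ⟨b, hb, b', hb', rfl⟩
        · exact Submodule.subset_span (Or.inr ⟨1, one_mem _, x, hx, by rw [one_mul]⟩)
        · rw [(hc b hb).eq, mul_assoc, ← mul_assoc, h.quad 0 (by omega), add_mul, smul_mul_assoc,
            smul_mul_assoc, one_mul]
          refine Submodule.add_mem _ (Submodule.smul_mem _ _ (Submodule.subset_span (Or.inr ?_)))
            (Submodule.smul_mem _ _ (Submodule.subset_span (Or.inl (mul_mem hb hb'))))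
          exact ⟨1, one_mem _, b * b', mul_mem hb hb', by rw [one_mul]⟩
      | zero => simp
      | add x y _ _ hx hy => rw [mul_add]; exact Submodule.add_mem _ hx hy
      | smul c x _ hx => rw [mul_smul_comm]; exact Submodule.smul_mem _ _ hx
    | algebraMap c =>
      intro x hx
      rw [← Algebra.smul_def]; exact Submodule.smul_mem _ _ hx
    | add y z _ _ hy hz => intro x hx; rw [add_mul]; exact Submodule.add_mem _ (hy x hx) (hz x hx)
    | mul y z _ _ hy hz => intro x hx; rw [mul_assoc]; exact hy _ (hz x hx)
  | succ m ih =>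
    set D := Submodule.span ℂ {x : A | x ∈ subAlg t (m + 1 + 1) ∨
      ∃ b ∈ subAlg t (m + 1 + 1), ∃ b' ∈ subAlg t (m + 1 + 1), x = b * t (m + 1) * b'} with hD
    have hle : subAlg t (m + 1) ≤ subAlg t (m + 1 + 1) := subAlg_mono (Nat.le_succ _)
    have htm : t m ∈ subAlg t (m + 1 + 1) := t_mem_subAlg (Nat.lt_succ_self _)
    have hc : ∀ b ∈ subAlg t (m + 1), b * t (m + 1) = t (m + 1) * b := fun b hb =>
      commute_subAlg (fun i hi => h.commute_far (by omega) (by omega) (by omega)) hb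
    have hleft : ∀ b ∈ subAlg t (m + 1 + 1), ∀ x ∈ D, b * x ∈ D := by
      intro b hb x hx
      induction hx using Submodule.span_induction with
      | mem x hx =>
        rcases hx with hx | ⟨c, hc, c', hc', rfl⟩
        · exact Submodule.subset_span (Or.inl (mul_mem hb hx))
        · exact Submodule.subset_span (Or.inr ⟨b * c, mul_mem hb hc, c', hc', by noncomm_ring⟩)
      | zero => simp
      | add x y _ _ hx hy => rw [mul_add]; exact Submodule.add_mem _ hx hy
      | smul c x _ hx => rw [mul_smul_comm]; exact Submodule.smul_mem _ _ hx
    have hright : ∀ b ∈ subAlg t (m + 1 + 1), ∀ x ∈ D, x * b ∈ D := by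
      intro b hb x hx
      induction hx using Submodule.span_induction with
      | mem x hx =>
        rcases hx with hx | ⟨c, hc, c', hc', rfl⟩
        · exact Submodule.subset_span (Or.inl (mul_mem hx hb))
        · exact Submodule.subset_span (Or.inr ⟨c, hc, c' * b, mul_mem hc' hb, by noncomm_ring⟩)
      | zero => simp
      | add x y _ _ hx hy => rw [add_mul]; exact Submodule.add_mem _ hx hy
      | smul c x _ hx => rw [smul_mul_assoc]; exact Submodule.smul_mem _ _ hx
    have ht : t (m + 1) ∈ D := Submodule.subset_span
      (Or.inr ⟨1, one_mem _, 1, one_mem _, by rw [one_mul, mul_one]⟩)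
    have htt : t (m + 1) * t (m + 1) ∈ D := by
      rw [h.quad (m + 1) (by omega)]
      exact Submodule.add_mem _ (Submodule.smul_mem _ _ ht)
        (Submodule.smul_mem _ _ (Submodule.subset_span (Or.inl (one_mem _))))
    -- These are the only products not obviously in D. Decompose b by induction: its terms either
    -- commute with t (m + 1), leaving a square, or are c * t m * c' with c and c' commuting with
    -- it, leaving a braid.
    have hmid : ∀ b ∈ subAlg t (m + 1 + 1), t (m + 1) * b * t (m + 1) ∈ D := by
      intro b hb
      have hb' := ih (by omega) hb
      clear hb
      induction hb' using Submodule.span_induction with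
      | mem x hx =>
        rcases hx with hx | ⟨c, hcm, c', hcm', rfl⟩
        · rw [mul_assoc, hc x hx, ← mul_assoc]
          exact hright x (hle hx) _ htt
        · have e : t (m + 1) * (c * t m * c') * t (m + 1) =
              c * (t m * t (m + 1) * t m) * c' := by
            rw [h.braid m (by omega)]
            calc t (m + 1) * (c * t m * c') * t (m + 1)
                = t (m + 1) * c * t m * (c' * t (m + 1)) := by noncomm_ring
              _ = c * t (m + 1) * t m * (t (m + 1) * c') := by rw [hc c' hcm', ← hc c hcm]
              _ = _ := by noncomm_ring
          rw [e]
          refine hright _ (hle hcm') _ (hleft _ (hle hcm) _ (Submodule.subset_span (Or.inr ?_)))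
          exact ⟨t m, htm, t m, htm, rfl⟩
      | zero => simp
      | add x y _ _ hx hy => rw [mul_add, add_mul]; exact Submodule.add_mem _ hx hy
      | smul c x _ hx => rw [mul_smul_comm, smul_mul_assoc]; exact Submodule.smul_mem _ _ hx
    suffices ∀ x ∈ D, a * x ∈ D by
      simpa using this 1 (Submodule.subset_span (Or.inl (one_mem _)))
    induction ha using Algebra.adjoin_induction with
    | mem y hy =>
      obtain ⟨i, hi, rfl⟩ := hy
      rcases Nat.lt_or_ge i (m + 1) with hi' | hi'
      · exact hleft _ (t_mem_subAlg (by omega))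
      obtain rfl : i = m + 1 := by omega
      intro x hx
      induction hx using Submodule.span_induction with
      | mem x hx =>
        rcases hx with hx | ⟨b, hb, b', hb', rfl⟩
        · exact hright x hx _ ht
        · rw [← mul_assoc, ← mul_assoc]
          exact hright b' hb' _ (hmid b hb)
      | zero => simp
      | add x y _ _ hx hy => rw [mul_add]; exact Submodule.add_mem _ hx hy
      | smul c x _ hx => rw [mul_smul_comm]; exact Submodule.smul_mem _ _ hx
    | algebraMap c =>
      intro x hx
      rw [← Algebra.smul_def]; exact Submodule.smul_mem _ _ hx
    | add y z _ _ hy hz => intro x hx; rw [add_mul]; exact Submodule.add_mem _ (hy x hx) (hz x hx)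
    | mul y z _ _ hy hz => intro x hx; rw [mul_assoc]; exact hy _ (hz x hx)

end HeckeFam
end HeckeStrip
end

/-! ### Multiplicity one, transport between tableaux, components of invariant vectors -/

noncomputable section
open scoped RightActions
namespace HeckeStrip

variable {A : Type*} [Ring A] [Algebra ℂ A]
variable {M : Type*} [AddCommGroup M] [Module ℂ M] [Module A M] [IsScalarTower ℂ A M]

set_option linter.unusedSectionVars false

theorem latticeWords_swapAt {n k : ℕ} {r : ℕ → ℕ} (hr : r ∈ latticeWords n) (hk : k + 1 < n)
    (hs : Swappable r k) : swapAt r k ∈ latticeWords n :=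
  ⟨hr.1.swapAt hk hs, fun i hi => by rw [swapAt_of_ne r (by omega) (by omega), hr.2 i hi]⟩

theorem exists_ne_of_latticeWords {n : ℕ} {r r' : ℕ → ℕ} (hr : r ∈ latticeWords n)
    (hr' : r' ∈ latticeWords n) (hne : r ≠ r') : ∃ i < n, r i ≠ r' i := by
  by_contra! hc
  refine hne (funext fun i => ?_)
  rcases Nat.lt_or_ge i n with hi | hi
  · exact hc i hi
  · rw [hr.2 i hi, hr'.2 i hi]

namespace HeckeFam

variable {n : ℕ} {q : ℂ} {t : ℕ → A}

theorem subAlg_of_le_one {m : ℕ} (hm : m ≤ 1) {a : A} (ha : a ∈ subAlg t m) :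
    ∃ c : ℂ, a = algebraMap ℂ A c := by
  induction ha using Algebra.adjoin_induction with
  | mem y hy => obtain ⟨i, hi, -⟩ := hy; omega
  | algebraMap c => exact ⟨c, rfl⟩
  | add y z _ _ hy hz =>
    obtain ⟨c, rfl⟩ := hy
    obtain ⟨d, rfl⟩ := hz
    exact ⟨c + d, (map_add _ _ _).symm⟩
  | mul y z _ _ hy hz =>
    obtain ⟨c, rfl⟩ := hy
    obtain ⟨d, rfl⟩ := hz
    exact ⟨c * d, (map_mul _ _ _).symm⟩

theorem jm_smul_orbit (h : HeckeFam n q t) {m : ℕ} (hm : m < n) {v : M} {c : ℂ}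
    (hv : jm q t m • v = c • v) {y : M} (hy : y ∈ orbit t m v) : jm q t m • y = c • y := by
  obtain ⟨a, ha, rfl⟩ := mem_orbit.1 hy
  have hc : Commute a (jm q t m) :=
    commute_subAlg (fun i hi => h.commute_jm (by omega) hm (by omega) (by omega)) ha
  rw [smul_smul, ← hc.eq, mul_smul, hv, smul_smul_comm']

/-- Weight spaces of the module generated by a weight vector are one-dimensional. -/
theorem multiplicity_one (h : HeckeFam n q t) (hg : QGood n q) {m : ℕ} (hm : m ≤ n) {r : ℕ → ℕ}
    (hr : Lattice m r) {v : M} (hv : Wt q t m r v) {a : A} (ha : a ∈ subAlg t m)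
    (hav : Wt q t m r (a • v)) : ∃ c : ℂ, a • v = c • v := by
  induction m generalizing a with
  | zero =>
    obtain ⟨c, rfl⟩ := subAlg_of_le_one (by omega) ha
    exact ⟨c, algebraMap_smul A c v⟩
  | succ m ih =>
  rcases m with _ | m
  · obtain ⟨c, rfl⟩ := subAlg_of_le_one (by omega) ha
    exact ⟨c, algebraMap_smul A c v⟩
  set c₀ := qInt q (ct r (m + 1)) with hc₀
  have hvm : jm q t (m + 1) • v = c₀ • v := hv (m + 1) (by omega)
  have hvo : ∀ y ∈ orbit t (m + 1) v, jm q t (m + 1) • y = c₀ • y :=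
    fun y hy => h.jm_smul_orbit (by omega) hvm hy
  -- The smaller subalgebra commutes with this Jucys-Murphy element, so its orbit of v lies in the
  -- c₀-eigenspace, and O collects the other eigenvalues. The aim is to show that modulo O the
  -- larger subalgebra reaches nothing outside that orbit.
  set O : Submodule ℂ M := Submodule.span ℂ {u : M | ∃ d, d ≠ c₀ ∧ jm q t (m + 1) • u = d • u}
    with hO
  have hOb : ∀ b ∈ subAlg t (m + 1), ∀ u ∈ O, b • u ∈ O := by
    intro b hb u hu
    have hc : Commute b (jm q t (m + 1)) :=
      commute_subAlg (fun i hi => h.commute_jm (by omega) (by omega) (by omega) (by omega)) hb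
    induction hu using Submodule.span_induction with
    | mem u hu =>
      obtain ⟨d, hd, hu⟩ := hu
      exact Submodule.subset_span ⟨d, hd, by
        rw [smul_smul, ← hc.eq, mul_smul, hu, smul_smul_comm']⟩
    | zero => rw [smul_zero]; exact O.zero_mem
    | add u w _ _ hu hw => rw [smul_add]; exact O.add_mem hu hw
    | smul c u _ hu => rw [smul_smul_comm']; exact O.smul_mem c hu
  have hmid : ∀ y ∈ shapeSpan q t (orbit t (m + 1) v) (m + 1) (cnt r (m + 1)),
      t m • y ∈ orbit t (m + 1) v ⊔ O := by
    intro y hy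
    unfold shapeSpan at hy
    induction hy using Submodule.span_induction with
    | mem y hy =>
      obtain ⟨hyo, r₁, hr₁, hp, hy⟩ := hy
      -- The vector y also has eigenvalue c₀ at position m + 1, and r₁ has the shape of r there, so
      -- the weight of y is r₁ followed by the last letter of r.
      obtain ⟨r', hr'1, hr'2⟩ : ∃ r' : ℕ → ℕ, (∀ i < m + 1, r₁ i = r' i) ∧
          r' (m + 1) = r (m + 1) :=
        ⟨Function.update r₁ (m + 1) (r (m + 1)),
          fun i hi => (Function.update_of_ne (by omega) _ _).symm, Function.update_self _ _ _⟩
      have hp' : cnt r' (m + 1) = cnt r (m + 1) := by rw [← hp, cnt_congr hr'1]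
      have hct : ct r' (m + 1) = ct r (m + 1) := by rw [ct, ct, hp', hr'2]
      have hr' : Lattice (m + 1 + 1) r' := lattice_succ (hr₁.congr hr'1) (by
        rw [hp', hr'2]; exact hr.addable (by omega))
      have hy' : Wt q t (m + 1 + 1) r' y := Wt_succ (Wt_congr hy hr'1) (by rw [hct, hvo y hyo])
      by_cases h1 : r' m = r' (m + 1)
      · rw [h.t_smul_row hg hm (by omega) hr' hy' h1]
        exact Submodule.mem_sup_left (Submodule.smul_mem _ _ hyo)
      by_cases h2 : Vertical r' m
      · rw [h.t_smul_vertical hg hm (by omega) hr' hy' h2]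
        exact Submodule.mem_sup_left (Submodule.neg_mem _ hyo)
      have hs : Swappable r' m := ⟨h1, h2⟩
      rw [t_smul_swappable h.q_ne hg hm (by omega) hr' y hs]
      refine Submodule.smul_mem _ _ (Submodule.add_mem _ (Submodule.mem_sup_right
        (Submodule.subset_span ⟨_, (content_ne h.q_ne hg hm hr' (by omega) hs).symm.trans_eq ?_, ?_⟩))
        (Submodule.mem_sup_left (Submodule.smul_mem _ _ hyo)))
      · rw [hct]
      · have := h.Wt_tauOf hm hy' (by omega) h1 (m + 1) (by omega)
        rwa [ct_swapAt_right h1] at this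
    | zero => rw [smul_zero]; exact Submodule.zero_mem _
    | add u w _ _ hu hw => rw [smul_add]; exact Submodule.add_mem _ hu hw
    | smul c u _ hu => rw [smul_smul_comm']; exact Submodule.smul_mem _ c hu
  have hmem : a • v ∈ orbit t (m + 1) v ⊔ O := by
    have hx := h.subAlg_succ hm ha
    clear hav ha
    induction hx using Submodule.span_induction with
    | mem x hx =>
      rcases hx with hx | ⟨b, hb, b', hb', rfl⟩
      · exact Submodule.mem_sup_left (mem_orbit.2 ⟨x, hx, rfl⟩)
      · rw [mul_smul, mul_smul]
        have h1 := hmid _ (h.smul_mem_shapeSpan_orbit hg (by omega) (hr.mono (by omega))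
          (Wt_mono hv (by omega)) hb')
        obtain ⟨e, he, o, ho, heo⟩ := Submodule.mem_sup.1 h1
        rw [← heo, smul_add]
        exact Submodule.add_mem _ (Submodule.mem_sup_left (smul_mem_orbit hb he))
          (Submodule.mem_sup_right (hOb b hb o ho))
    | zero => rw [zero_smul]; exact Submodule.zero_mem _
    | add x y _ _ hx hy => rw [add_smul]; exact Submodule.add_mem _ hx hy
    | smul c x _ hx => rw [smul_assoc]; exact Submodule.smul_mem _ c hx
  obtain ⟨e, he, o, ho, heo⟩ := Submodule.mem_sup.1 hmem
  -- Both a • v and e have eigenvalue c₀, so o is a c₀-eigenvector inside O. Hence a may be replaced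
  -- by an element of the smaller subalgebra.
  have ho' : o = 0 := by
    by_contra h0
    refine eigenvalue_of_mem_span (C := fun d => d ≠ c₀) ho (b := c₀) ?_ h0 rfl
    have h1 := hav (m + 1) (by omega)
    rw [← heo, smul_add, smul_add, hvo e he] at h1
    exact add_left_cancel h1
  rw [ho', add_zero] at heo
  obtain ⟨b, hb, rfl⟩ := mem_orbit.1 he
  rw [← heo] at hav ⊢
  exact ih (by omega) (hr.mono (by omega)) (Wt_mono hv (by omega)) hb (Wt_mono hav (by omega))

/-- A weight vector can be moved to every tableau of the same shape. -/
theorem transport (h : HeckeFam n q t) (hg : QGood n q) {r r' : ℕ → ℕ} (hr : r ∈ latticeWords n)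
    (hr' : r' ∈ latticeWords n) (hc : cnt r n = cnt r' n) {v : M} (hv : Wt q t n r v) :
    ∃ a b : A, Wt q t n r' (a • v) ∧ b • a • v = v := by
  have hP : SwapClosed n 0 n fun s => ∃ a b : A, Wt q t n s (a • v) ∧ b • a • v = v := by
    rintro s k hs - hk hsw ⟨a, b, h1, h2⟩
    set c := (1 + q * qInt q (ct s k) - qInt q (ct s (k + 1))) *
      (1 + q * qInt q (ct s (k + 1)) - qInt q (ct s k)) with hcdef
    have hcne : c ≠ 0 := tauOf_tauOf_ne h.q_ne hg le_rfl hs hk hsw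
    refine ⟨tauOf q t s k * a, b * (c⁻¹ • tauOf q t (swapAt s k) k), ?_, ?_⟩
    · rw [mul_smul]; exact h.Wt_tauOf le_rfl h1 hk hsw.1
    · rw [mul_smul, mul_smul, smul_assoc, h.tauOf_swap_tauOf hk hsw.1, ← hcdef, smul_smul,
        inv_mul_cancel₀ hcne, one_smul, h2]
  refine hP.connected le_rfl hr.1 hr'.1 (fun i hi => ?_) hc
    ⟨1, 1, by rwa [one_smul], by rw [one_smul, one_smul]⟩
  rw [hr.2 i (by omega), hr'.2 i (by omega)]

theorem cnt_eq_of_wtProj_ne_zero (hq : q ≠ 0) (hg : QGood n q) {r : ℕ → ℕ} (hr : Lattice n r)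
    {K : Submodule ℂ M} {p : ℕ → ℕ} {x : M} (hx : x ∈ shapeSpan q t K n p)
    (h0 : wtProj n q t r • x ≠ 0) : cnt r n = p := by
  by_contra hp
  refine h0 ?_
  unfold shapeSpan at hx
  induction hx using Submodule.span_induction with
  | mem y hy =>
    obtain ⟨-, r', hr', hp', hy⟩ := hy
    refine wtProj_smul_of_ne hq hg hr hr' hy ?_
    by_contra! he
    exact hp (by rw [cnt_congr he, hp'])
  | zero => rw [smul_zero]
  | add u w _ _ hu hw =>
    by_cases h1 : wtProj n q t r • u = 0
    · by_cases h2 : wtProj n q t r • w = 0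
      · rw [smul_add, h1, h2, add_zero]
      · exact absurd (hw h2) h2
    · exact absurd (hu h1) h1
  | smul c u _ hu =>
    by_cases h1 : wtProj n q t r • u = 0
    · rw [smul_smul_comm', h1, smul_zero]
    · exact absurd (hu h1) h1

/-- A weight vector generates only vectors of the same shape. -/
theorem cnt_eq_of_wtProj_smul_ne_zero (h : HeckeFam n q t) (hg : QGood n q)
    (htop : subAlg t n = ⊤) {r r' : ℕ → ℕ} (hr : Lattice n r) (hr' : Lattice n r') {v : M}
    (hv : Wt q t n r v) (a : A) (h0 : wtProj n q t r' • a • v ≠ 0) : cnt r' n = cnt r n :=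
  cnt_eq_of_wtProj_ne_zero h.q_ne hg hr'
    (h.smul_mem_shapeSpan_orbit hg le_rfl hr hv (htop ▸ Algebra.mem_top)) h0

/-- Weight vectors of the same weight have the same annihilator. -/
theorem annihilator_le (h : HeckeFam n q t) (hg : QGood n q) (htop : subAlg t n = ⊤)
    {M' : Type*} [AddCommGroup M'] [Module ℂ M'] [Module A M'] [IsScalarTower ℂ A M']
    {r : ℕ → ℕ} (hr : r ∈ latticeWords n) {v : M} {v' : M'} (hv : Wt q t n r v)
    (hv' : Wt q t n r v') (h0 : v ≠ 0) {a : A} (ha : a • v = 0) : a • v' = 0 := by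
  by_contra hav
  -- The pair is again a weight vector, so by multiplicity one an algebra element returning z to its
  -- weight scales both coordinates equally. As a kills v, that scalar is 0, and transporting back
  -- shows that every component of a • z vanishes.
  set z : M × M' := (v, v')
  have hz : Wt q t n r z := fun k hk => Prod.ext (hv k hk) (hv' k hk)
  have hu : a • z ≠ 0 := fun he => hav (congrArg Prod.snd he)
  obtain ⟨s, hs, hsu⟩ := h.exists_wtProj_ne_zero hg hu
  have hc := h.cnt_eq_of_wtProj_smul_ne_zero hg htop hr.1 hs.1 hz a hsu
  obtain ⟨b, b', h1, h2⟩ := h.transport hg hs hr hc (h.Wt_wtProj hg hs.1 (a • z))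
  have h3 : b • wtProj n q t s • a • z = (b * (wtProj n q t s * a)) • z := by
    rw [mul_smul, mul_smul]
  obtain ⟨c, hcz⟩ := h.multiplicity_one hg le_rfl hr.1 hz
    (a := b * (wtProj n q t s * a)) (htop ▸ Algebra.mem_top) (h3 ▸ h1)
  rw [← h3] at hcz
  have h4 : c • v = 0 := by
    have := congrArg Prod.fst hcz
    simp only [Prod.smul_fst, z, ha, smul_zero] at this
    exact this.symm
  rw [(smul_eq_zero.1 h4).resolve_right h0, zero_smul] at hcz
  rw [hcz, smul_zero] at h2
  exact hsu h2.symm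

/-! ### Weight components of `q`-invariant vectors -/

theorem mem_span_latticeWords (h : HeckeFam n q t) (hg : QGood n q) (v : M) :
    v ∈ Submodule.span ℂ {u : M | ∃ r ∈ latticeWords n, Wt q t n r u} := by
  refine Submodule.span_mono ?_ (h.mem_span_Wt hg le_rfl v)
  rintro u ⟨r, hr, hu⟩
  obtain ⟨s, hs, he⟩ := exists_latticeWord hr
  exact ⟨s, hs, Wt_congr hu he⟩

theorem wtProj_smul_of_words_ne (hq : q ≠ 0) (hg : QGood n q) {r r' : ℕ → ℕ}
    (hr : r ∈ latticeWords n) (hr' : r' ∈ latticeWords n) (hne : r ≠ r') {u : M}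
    (hu : Wt q t n r' u) : wtProj n q t r • u = 0 :=
  wtProj_smul_of_ne hq hg hr.1 hr'.1 hu (exists_ne_of_latticeWords hr hr' hne)

/-- The intertwining element of the positions `k` and `k + 1`, in terms of the Jucys-Murphy
elements. -/
def phiElt (q : ℂ) (t : ℕ → A) (k : ℕ) : A :=
  t k * (jm q t (k + 1) - jm q t k) - (1 + (q - 1) • jm q t (k + 1))

theorem phiElt_smul {k : ℕ} {r : ℕ → ℕ} {u : M} (hk : k + 1 < n) (hu : Wt q t n r u) :
    phiElt q t k • u = tauOf q t r k • u := by
  rw [phiElt, tauOf, tau_smul, sub_smul, mul_smul, sub_smul, add_smul, smul_assoc, hu k (by omega),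
    hu (k + 1) hk, ← sub_smul, smul_smul_comm', one_smul]
  generalize t k • u = w
  module

/-- With t k equal to q or -1 and contents differing by one, the two terms of the intertwiner
cancel. So `phiElt` is one algebra element that either moves a weight to the exchanged one or kills
it, and it can be applied to vectors that are not weight vectors. -/
theorem phiElt_smul_not_swappable (h : HeckeFam n q t) (hg : QGood n q) {k : ℕ} (hk : k + 1 < n)
    {r : ℕ → ℕ} (hr : Lattice n r) {u : M} (hu : Wt q t n r u) (hs : ¬ Swappable r k) :
    phiElt q t k • u = 0 := by
  rw [phiElt_smul hk hu, tauOf, tau_smul]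
  by_cases h1 : r k = r (k + 1)
  · rw [h.t_smul_row hg le_rfl hk hr hu h1]
    have : ct r (k + 1) = ct r k + 1 := by
      unfold ct; rw [cnt_succ, ← h1, if_pos rfl]; push_cast; ring
    rw [this, qInt_add_one h.q_ne]
    module
  · have hV : Vertical r k := by
      by_contra hV
      exact hs ⟨h1, hV⟩
    rw [h.t_smul_vertical hg le_rfl hk hr hu hV]
    have : ct r k = ct r (k + 1) + 1 := by
      unfold ct; rw [cnt_succ, if_neg h1, ← hV.2, hV.1]; push_cast; ring
    rw [this, qInt_add_one h.q_ne]
    module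

theorem wtProj_phiElt_smul (h : HeckeFam n q t) (hg : QGood n q) {k : ℕ} (hk : k + 1 < n)
    {r : ℕ → ℕ} (hr : r ∈ latticeWords n) (hs : Swappable r k) (Y : M) :
    wtProj n q t (swapAt r k) • phiElt q t k • Y = tauOf q t r k • wtProj n q t r • Y := by
  have hY := h.mem_span_latticeWords hg Y
  induction hY using Submodule.span_induction with
  | mem u hu =>
    obtain ⟨s, hsw, hu⟩ := hu
    by_cases hsr : r = s
    · subst hsr
      rw [wtProj_smul_self hr.1 hu fun _ _ => rfl, phiElt_smul hk hu,
        wtProj_smul_self (hr.1.swapAt hk hs) (h.Wt_tauOf le_rfl hu hk hs.1) fun _ _ => rfl]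
    · rw [wtProj_smul_of_words_ne h.q_ne hg hr hsw hsr hu, smul_zero]
      by_cases hss : Swappable s k
      · rw [phiElt_smul hk hu]
        refine wtProj_smul_of_words_ne h.q_ne hg (latticeWords_swapAt hr hk hs)
          (latticeWords_swapAt hsw hk hss) (fun he => hsr ?_) (h.Wt_tauOf le_rfl hu hk hss.1)
        rw [← swapAt_swapAt r k, he, swapAt_swapAt]
      · rw [h.phiElt_smul_not_swappable hg hk hsw.1 hu hss, smul_zero]
  | zero => simp
  | add u w _ _ hu hw => simp only [smul_add, hu, hw]
  | smul c u _ hu => simp only [smul_smul_comm' c, hu]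

theorem wtProj_phiElt_smul_eq_zero (h : HeckeFam n q t) (hg : QGood n q) {k : ℕ} (hk : k + 1 < n)
    {r : ℕ → ℕ} (hr : r ∈ latticeWords n) (hs : ¬ Swappable r k) (Y : M) :
    wtProj n q t r • phiElt q t k • Y = 0 := by
  have hY := h.mem_span_latticeWords hg Y
  induction hY using Submodule.span_induction with
  | mem u hu =>
    obtain ⟨s, hsw, hu⟩ := hu
    by_cases hss : Swappable s k
    · rw [phiElt_smul hk hu]
      refine wtProj_smul_of_words_ne h.q_ne hg hr
          (latticeWords_swapAt hsw hk hss) ?_ (h.Wt_tauOf le_rfl hu hk hss.1)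
      rintro rfl
      exact hs (hss.swapAt hsw.1 hk)
    · rw [h.phiElt_smul_not_swappable hg hk hsw.1 hu hss, smul_zero]
  | zero => simp
  | add u w _ _ hu hw => simp only [smul_add, hu, hw, add_zero]
  | smul c u _ hu => simp only [smul_smul_comm' c, hu, smul_zero]

theorem wtProj_jm_smul (h : HeckeFam n q t) (hg : QGood n q) {k : ℕ} (hk : k < n)
    {r : ℕ → ℕ} (hr : r ∈ latticeWords n) (Y : M) :
    wtProj n q t r • jm q t k • Y = qInt q (ct r k) • wtProj n q t r • Y := by
  have hY := h.mem_span_latticeWords hg Y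
  induction hY using Submodule.span_induction with
  | mem u hu =>
    obtain ⟨s, hsw, hu⟩ := hu
    rw [hu k hk, smul_smul_comm']
    by_cases hsr : r = s
    · rw [hsr]
    · rw [wtProj_smul_of_words_ne h.q_ne hg hr hsw hsr hu, smul_zero, smul_zero]
  | zero => simp
  | add u w _ _ hu hw => simp only [smul_add, hu, hw]
  | smul c u _ hu =>
    rw [smul_smul_comm', smul_smul_comm', smul_smul_comm', hu, smul_comm c]

/-- Moving t k to the right, where it acts as q, makes the intertwiner a polynomial in commuting
Jucys-Murphy elements. -/
theorem phiElt_smul_invariant (h : HeckeFam n q t) {k : ℕ} (hk : k + 1 < n) {Y : M}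
    (hY : t k • Y = q • Y) :
    phiElt q t k • Y = q • jm q t k • Y + Y - jm q t (k + 1) • Y := by
  have h1 : t k * jm q t (k + 1) = jm q t k * t k + 1 + (q - 1) • jm q t (k + 1) :=
    h.mul_jm_succ hk
  have h2 : t k * jm q t k = jm q t (k + 1) * t k - 1 - (q - 1) • jm q t (k + 1) := by
    rw [h.jm_succ_mul hk]; abel
  rw [phiElt, mul_sub, h1, h2]
  simp only [sub_smul, add_smul, mul_smul, smul_assoc, one_smul, hY]
  rw [smul_smul_comm', smul_smul_comm']
  generalize jm q t k • Y = a
  generalize jm q t (k + 1) • Y = b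
  module

/-- The component of `phiElt` • Y at the exchanged word is computed twice: by intertwining it is the
left side, by invariance it is a scalar times the component of Y. So components of Y at words
differing by an exchange determine each other. -/
theorem tauOf_wtProj_smul (h : HeckeFam n q t) (hg : QGood n q) {k : ℕ} (hk : k + 1 < n)
    {r : ℕ → ℕ} (hr : r ∈ latticeWords n) (hs : Swappable r k) {Y : M} (hY : t k • Y = q • Y) :
    tauOf q t r k • wtProj n q t r • Y =
      (1 + q * qInt q (ct r (k + 1)) - qInt q (ct r k)) • wtProj n q t (swapAt r k) • Y := by
  have hr' := latticeWords_swapAt hr hk hs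
  rw [← h.wtProj_phiElt_smul hg hk hr hs, h.phiElt_smul_invariant hk hY, smul_sub, smul_add,
    smul_smul_comm', h.wtProj_jm_smul hg (by omega) hr', h.wtProj_jm_smul hg hk hr',
    ct_swapAt_left hs.1, ct_swapAt_right hs.1]
  generalize wtProj n q t (swapAt r k) • Y = w
  module

/-- For a vector that is `q`-invariant at the positions in `[j, m)`, all weight components of the
same shape and the same restriction to the first `j` positions generate the same module. -/
theorem swapClosed_component (h : HeckeFam n q t) (hg : QGood n q) {j m : ℕ} (hm : m ≤ n) {Y : M}
    (hY : ∀ k, j ≤ k → k + 1 < m → t k • Y = q • Y) (r₀ : ℕ → ℕ) :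
    SwapClosed n j m fun r => r ∈ latticeWords n ∧
      ∃ a : A, wtProj n q t r • Y = a • wtProj n q t r₀ • Y := by
  rintro r k hr hj hk hs ⟨hrw, a, ha⟩
  refine ⟨latticeWords_swapAt hrw (by omega) hs, ?_⟩
  have h1 := h.tauOf_wtProj_smul hg (by omega) hrw hs (hY k hj hk)
  have h2 := right_ne_zero_of_mul (tauOf_tauOf_ne h.q_ne hg le_rfl hr (by omega) hs)
  refine ⟨(1 + q * qInt q (ct r (k + 1)) - qInt q (ct r k))⁻¹ • (tauOf q t r k * a), ?_⟩
  rw [smul_assoc, mul_smul, ← ha, h1, smul_smul, inv_mul_cancel₀ h2, one_smul]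

/-- If the component at the exchanged word were zero, the intertwiner would kill the given one,
against its invertibility. -/
theorem swapClosed_wtProj_ne_zero (h : HeckeFam n q t) (hg : QGood n q) {j m : ℕ} (hm : m ≤ n)
    {Y : M} (hY : ∀ k, j ≤ k → k + 1 < m → t k • Y = q • Y) :
    SwapClosed n j m fun r => r ∈ latticeWords n ∧ wtProj n q t r • Y ≠ 0 := by
  rintro r k hr hj hk hs ⟨hrw, h0⟩
  refine ⟨latticeWords_swapAt hrw (by omega) hs, fun h1 => h0 ?_⟩
  have h2 := h.tauOf_wtProj_smul hg (by omega) hrw hs (hY k hj hk)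
  rw [h1, smul_zero] at h2
  have h3 := h.tauOf_swap_tauOf (r := r) (show k + 1 < n by omega) hs.1 (wtProj n q t r • Y)
  rw [h2, smul_zero] at h3
  exact (smul_eq_zero.1 h3.symm).resolve_left
    (tauOf_tauOf_ne h.q_ne hg le_rfl hr (by omega) hs)

/-- The weights that occur in a vector which is `q`-invariant at the positions in `[j, m)` are
horizontal strips there. -/
theorem horizontal_of_invariant (h : HeckeFam n q t) (hg : QGood n q) {j m : ℕ} (hj : j ≤ n)
    (hm : m ≤ n) {Y : M} (hY : ∀ k, j ≤ k → k + 1 < m → t k • Y = q • Y) {r : ℕ → ℕ}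
    (hr : r ∈ latticeWords n) (h0 : wtProj n q t r • Y ≠ 0) (a : ℕ) :
    cnt r m (a + 1) ≤ cnt r j a := by
  refine (h.swapClosed_wtProj_ne_zero hg hm hY).horizontal hm ?_ hr.1 ⟨hr, h0⟩ hj a
  rintro s k hs hjk hkm hV ⟨hsw, hs0⟩
  refine hs0 ?_
  -- At vertical neighbours this component is 0, while invariance gives ([c + 1] - [c - 1]) times
  -- the component of Y, with c the content at k.
  have h1 := h.wtProj_phiElt_smul_eq_zero hg (show k + 1 < n by omega) hsw
    (fun hsw' => hsw'.2 hV) Y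
  rw [h.phiElt_smul_invariant (by omega) (hY k hjk hkm), smul_sub, smul_add, smul_smul_comm',
    h.wtProj_jm_smul hg (by omega) hsw, h.wtProj_jm_smul hg (by omega) hsw] at h1
  have h2 : (qInt q (ct s k + 1) - qInt q (ct s (k + 1))) • wtProj n q t s • Y = 0 := by
    rw [← h1, qInt_add_one h.q_ne]
    generalize wtProj n q t s • Y = w
    module
  refine (smul_eq_zero.1 h2).resolve_left (sub_ne_zero.2 ?_)
  have h3 : ct s (k + 1) = ct s k + -1 := by
    unfold ct
    rw [cnt_succ, if_neg (by have := hV.1; omega), ← hV.2, hV.1]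
    push_cast
    ring
  rw [h3]
  refine hg.ne h.q_ne (by omega) ?_
  rw [abs_le]
  omega

end HeckeFam
end HeckeStrip
end

noncomputable section
open scoped RightActions
namespace HeckeStrip

open Polynomial MulOpposite

set_option linter.unusedSectionVars false

/-! ### The generators of the Hecke algebra -/

section generators

variable {n : ℕ} {q : ℂ}

theorem T_eq {i : ℕ} (hi : i + 1 < n) :
    T n q (i + 1) = Hecke.mk n q (FreeAlgebra.ι ℂ ⟨i, by omega⟩) := by
  rw [T, dif_pos ⟨by omega, hi⟩]
  rfl

theorem mk_rel {x y : FreeAlgebra ℂ (Fin (n - 1))} (h : HeckeRel n q x y) :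
    Hecke.mk n q x = Hecke.mk n q y := RingQuot.mkAlgHom_rel ℂ h

theorem T_quad {i : ℕ} (hi : i + 1 < n) :
    T n q (i + 1) * T n q (i + 1) = (q - 1) • T n q (i + 1) + q • (1 : Hecke n q) := by
  rw [T_eq hi]
  have := mk_rel (HeckeRel.quad (n := n) (q := q) ⟨i, by omega⟩)
  simpa only [map_mul, map_add, map_smul, map_one] using this

theorem T_comm {i j : ℕ} (hij : i + 2 ≤ j) (hj : j + 1 < n) :
    T n q (i + 1) * T n q (j + 1) = T n q (j + 1) * T n q (i + 1) := by
  rw [T_eq (show i + 1 < n by omega), T_eq hj]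
  have := mk_rel (HeckeRel.comm (n := n) (q := q) ⟨i, by omega⟩ ⟨j, by omega⟩ hij)
  simpa only [map_mul] using this

theorem T_braid {i : ℕ} (hi : i + 2 < n) :
    T n q (i + 1) * T n q (i + 2) * T n q (i + 1) =
      T n q (i + 2) * T n q (i + 1) * T n q (i + 2) := by
  rw [T_eq (show i + 1 < n by omega), T_eq (show i + 1 + 1 < n by omega)]
  have := mk_rel (HeckeRel.braid (n := n) (q := q) ⟨i, by omega⟩ ⟨i + 1, by omega⟩ rfl)
  simpa only [map_mul] using this

theorem heckeFam_T (hq : q ≠ 0) : HeckeFam n q fun i => T n q (i + 1) :=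
  ⟨hq, fun _ hi => T_quad hi, fun _ _ hij hj => T_comm hij hj, fun _ hi => T_braid hi⟩

/-- The generators acting from the right. -/
def gen (n : ℕ) (q : ℂ) (i : ℕ) : (Hecke n q)ᵐᵒᵖ := op (T n q (i + 1))

/-- Right modules are treated as left modules over the opposite algebra; the defining relations are
symmetric under reversal. -/
theorem heckeFam_gen (hq : q ≠ 0) : HeckeFam n q (gen n q) := by
  refine ⟨hq, fun i hi => ?_, fun i j hij hj => ?_, fun i hi => ?_⟩
  · exact (op_mul _ _).symm.trans ((congrArg op (T_quad hi)).trans (by simp [gen]))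
  · exact ((op_mul _ _).symm.trans ((congrArg op (T_comm hij hj).symm).trans (op_mul _ _)))
  · have := congrArg op (T_braid (q := q) hi)
    simp only [op_mul] at this
    simp only [gen, mul_assoc] at this ⊢
    exact this

theorem subAlg_gen_eq_top : HeckeFam.subAlg (gen n q) n = ⊤ := by
  rw [eq_top_iff]
  rintro x -
  obtain ⟨x, rfl⟩ := op_surjective x
  obtain ⟨f, rfl⟩ := RingQuot.mkAlgHom_surjective ℂ (HeckeRel n q) x
  change op (Hecke.mk n q f) ∈ _
  induction f using FreeAlgebra.induction with
  | grade0 r =>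
    rw [AlgHom.commutes]
    exact Subalgebra.algebraMap_mem _ r
  | grade1 i =>
    have := HeckeFam.t_mem_subAlg (t := gen n q) (m := n) (i := i) (by have := i.2; omega)
    rwa [gen, T_eq (by have := i.2; omega)] at this
  | mul f g hf hg => rw [map_mul, op_mul]; exact mul_mem hg hf
  | add f g hf hg => rw [map_add, op_add]; exact add_mem hf hg

theorem Ico_map_succ_prod {R : Type*} [Monoid R] (f : ℕ → R) {i k : ℕ} (h : i ≤ k) :
    ((List.Ico i (k + 1)).map f).prod = ((List.Ico i k).map f).prod * f k := by
  rw [List.Ico.succ_top h]; simp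

theorem Ico_reverse_map_succ_prod {R : Type*} [Monoid R] (f : ℕ → R) {i k : ℕ} (h : i ≤ k) :
    ((List.Ico i (k + 1)).reverse.map f).prod = f k * ((List.Ico i k).reverse.map f).prod := by
  rw [List.Ico.succ_top h]; simp

theorem commute_list_prod {R ι : Type*} [Monoid R] (f : ι → R) (l : List ι) (x : R)
    (h : ∀ i ∈ l, Commute x (f i)) : Commute x (l.map f).prod := by
  refine Commute.list_prod_right _ _ fun y hy => ?_
  obtain ⟨i, hi, rfl⟩ := List.mem_map.1 hy
  exact h i hi

/-- The definition has the largest generator innermost, while the recursion `jm` needs it outermost;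
braiding passes between the two. -/
theorem transpT_succ {i k : ℕ} (hi : 1 ≤ i) (hik : i ≤ k) (hk : k + 1 < n) :
    transpT n q i (k + 2) = T n q (k + 1) * transpT n q i (k + 1) * T n q (k + 1) := by
  obtain ⟨k, rfl⟩ : ∃ k', k = k' + 1 := ⟨k - 1, by omega⟩
  have hc : ∀ j ∈ List.Ico i (k + 1), Commute (T n q (k + 1 + 1)) (T n q j) := fun j hj => by
    obtain ⟨h1, h2⟩ := List.Ico.mem.1 hj
    obtain ⟨j, rfl⟩ : ∃ j', j = j' + 1 := ⟨j - 1, by omega⟩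
    exact (T_comm (show j + 2 ≤ k + 1 by omega) hk).symm
  have h1 := commute_list_prod (T n q) (List.Ico i (k + 1)) _ hc
  have h2 := commute_list_prod (T n q) (List.Ico i (k + 1)).reverse _ fun j hj =>
    hc j (List.mem_reverse.1 hj)
  simp only [transpT, show k + 1 + 2 - 1 = k + 1 + 1 by omega, Nat.add_sub_cancel,
    Ico_map_succ_prod (T n q) hik, Ico_reverse_map_succ_prod (T n q) hik]
  set L := ((List.Ico i (k + 1)).map (T n q)).prod
  set L' := ((List.Ico i (k + 1)).reverse.map (T n q)).prod
  have hbr := T_braid (q := q) hk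
  calc L * T n q (k + 1) * T n q (k + 1 + 1) * (T n q (k + 1) * L')
      = L * (T n q (k + 1) * T n q (k + 2) * T n q (k + 1)) * L' := by noncomm_ring
    _ = (L * T n q (k + 1 + 1)) * T n q (k + 1) * (T n q (k + 1 + 1) * L') := by
        rw [hbr]; noncomm_ring
    _ = _ := by rw [h1.symm.eq, h2.eq]; noncomm_ring

theorem jucysMurphy_succ (hq : q ≠ 0) {k : ℕ} (hk : k + 1 < n) :
    jucysMurphy n q (k + 2) =
      q⁻¹ • (T n q (k + 1) * jucysMurphy n q (k + 1) * T n q (k + 1) + T n q (k + 1)) := by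
  rw [jucysMurphy, Finset.sum_Ico_succ_top (by omega), jucysMurphy, Finset.mul_sum, Finset.sum_mul,
    smul_add, Finset.smul_sum]
  congr 1
  · refine Finset.sum_congr rfl fun i hi => ?_
    obtain ⟨h1, h2⟩ := Finset.mem_Ico.1 hi
    rw [transpT_succ h1 (by omega) hk, mul_smul_comm, smul_mul_assoc, smul_smul, ← zpow_neg_one,
      ← zpow_add₀ hq]
    congr 2
    push_cast
    ring
  · have e : ((k + 1 : ℕ) : ℤ) - ((k + 1 + 1 : ℕ) : ℤ) = -1 := by push_cast; ring
    rw [transpT, e, zpow_neg_one]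
    simp

theorem op_jucysMurphy (hq : q ≠ 0) {k : ℕ} (hk : k < n) :
    op (jucysMurphy n q (k + 1)) = jm q (gen n q) k := by
  induction k with
  | zero => simp [jucysMurphy, jm]
  | succ k ih =>
    rw [jucysMurphy_succ hq hk, jm, ← ih (by omega)]
    simp only [gen, op_smul, op_add, op_mul, mul_assoc]

end generators

/-! ### The action of the Young idempotents -/

instance (n : ℕ) (q : ℂ) : IsScalarTower ℂ (Hecke n q)ᵐᵒᵖ (WordSpace n) where
  smul_assoc c a v := by
    change (wordRep n q (c • a.unop)).unop v = c • (wordRep n q a.unop).unop v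
    rw [map_smul]
    rfl

section young

variable {R : Type*} [Ring R] [Algebra ℂ R] {M : Type*} [AddCommGroup M] [Module ℂ M]
  [Module Rᵐᵒᵖ M] [IsScalarTower ℂ Rᵐᵒᵖ M]

theorem op_aeval_smul {x : R} {u : M} {c : ℂ} (hu : op x • u = c • u) (Q : ℂ[X]) :
    op (aeval x Q) • u = eval c Q • u := by
  induction Q using Polynomial.induction_on with
  | C a =>
    rw [aeval_C, eval_C]
    exact algebraMap_smul Rᵐᵒᵖ a u
  | add p q hp hq => simp only [map_add, op_add, add_smul, eval_add, hp, hq]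
  | monomial k a ih =>
    rw [pow_succ, ← mul_assoc, map_mul, op_mul, mul_smul, ih, aeval_X, smul_smul_comm', hu,
      smul_smul]
    simp only [eval_mul, eval_X]

theorem op_list_prod_smul {ι : Type*} (l : List ι) (f : ι → R) (g : ι → ℂ) (u : M)
    (h : ∀ i ∈ l, op (f i) • u = g i • u) : op (l.map f).prod • u = (l.map g).prod • u := by
  induction l with
  | nil => simp
  | cons i l ih =>
    rw [List.map_cons, List.prod_cons, op_mul, mul_smul, h i List.mem_cons_self, smul_smul_comm',
      ih fun j hj => h j (List.mem_cons_of_mem _ hj), smul_smul, List.map_cons, List.prod_cons]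

end young

/-- The word of a tableau: the row of the entry `i + 1`. -/
def rowWord {lam : YoungDiagram} (T : SYT lam) (i : ℕ) : ℕ := (T.cell (i + 1)).1

/-- The passage to the opposite algebra reverses the factors, which is harmless: weight vectors
span, and on them all factors are scalars. -/
theorem youngIdempotent_smul {n : ℕ} {q : ℂ} (hq : q ≠ 0) (hg : QGood n q)
    {M : Type*} [AddCommGroup M] [Module ℂ M] [Module (Hecke n q)ᵐᵒᵖ M]
    [IsScalarTower ℂ (Hecke n q)ᵐᵒᵖ M] {lam : YoungDiagram} (T : SYT lam)
    (hc : ∀ i < n, T.content (i + 1) = ct (rowWord T) i) (x : M) :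
    op (youngIdempotent n q T) • x = wtProj n q (gen n q) (rowWord T) • x := by
  classical
  have hx := (heckeFam_gen hq).mem_span_Wt hg le_rfl x
  induction hx using Submodule.span_induction with
  | mem u hu =>
    obtain ⟨r, hr, hu⟩ := hu
    have e : List.Ico 1 (n + 1) = (List.range n).map (· + 1) := by
      have := List.Ico.map_add 0 n 1
      rw [zero_add, List.Ico.zero_bot] at this
      rw [← this]
      exact List.map_congr_left fun i _ => add_comm 1 i
    have h1 : ∀ m < n, op (aeval (jucysMurphy n q (m + 1)) (Lagrange.basis
        ((contents (m + 1)).image (qInt q)) id (qInt q (T.content (m + 1))))) • u =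
        eval (qInt q (ct r m)) (Lagrange.basis ((contents (m + 1)).image (qInt q)) id
          (qInt q (ct (rowWord T) m))) • u := fun m hm => by
      rw [op_aeval_smul (by rw [op_jucysMurphy hq hm]; exact hu m hm), hc m hm]
    rw [youngIdempotent, e, List.map_map, wtProj]
    refine (op_list_prod_smul _ _ (fun m => eval (qInt q (ct r m)) (Lagrange.basis
      ((contents (m + 1)).image (qInt q)) id (qInt q (ct (rowWord T) m)))) u fun m hm => ?_).trans
      (list_prod_smul _ _ _ u fun m hm => ?_).symm
    · rw [Function.comp_apply]
      convert h1 m (List.mem_range.1 hm)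
    · convert aeval_smul_of_eigen (hu m (List.mem_range.1 hm)) _
  | zero => simp
  | add u w _ _ hu hw => simp only [smul_add, hu, hw]
  | smul c u _ hu => simp only [smul_smul_comm' c, hu]

/-! ### The action of the generators on words -/

section words

variable {n : ℕ} {q : ℂ}

theorem gen_smul {i : ℕ} (hi : i + 1 < n) (v : WordSpace n) :
    gen n q i • v = exch q (⟨i, by omega⟩ : Fin n) ⟨i + 1, hi⟩ v := by
  have := wordRep_gen n q ⟨i, by omega⟩
  rw [gen, T_eq hi]
  exact congrArg (fun f => f v) this

end words

end HeckeStrip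
end

noncomputable section
open scoped RightActions
namespace HeckeStrip

set_option linter.unusedSectionVars false

/-! ### Tableaux and lattice words -/

theorem card_bot : (⊥ : YoungDiagram).card = 0 := by simp [YoungDiagram.card]

theorem rowLen_eq_card_filter (lam : YoungDiagram) (a : ℕ) :
    lam.rowLen a = (lam.cells.filter fun c => c.1 = a).card := by
  rw [YoungDiagram.rowLen_eq_card]; rfl

theorem row_lt_card {lam : YoungDiagram} {c : ℕ × ℕ} (hc : c ∈ lam) : c.1 < lam.card := by
  have h : (Finset.range (c.1 + 1)).image (fun i => (i, c.2)) ⊆ lam.cells := by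
    intro d hd
    obtain ⟨i, hi, rfl⟩ := Finset.mem_image.1 hd
    rw [Finset.mem_range] at hi
    exact (YoungDiagram.mem_cells _).2 (lam.up_left_mem (by omega) le_rfl hc)
  have := Finset.card_le_card h
  rw [Finset.card_image_of_injective _ fun i j hij => (Prod.mk.inj hij).1, Finset.card_range] at this
  exact this

theorem card_eq_sum_rowLen {lam : YoungDiagram} {n : ℕ} (h : ∀ c ∈ lam, c.1 < n) :
    lam.card = ∑ a ∈ Finset.range n, lam.rowLen a := by
  rw [YoungDiagram.card, Finset.card_eq_sum_card_fiberwise (f := Prod.fst) (t := Finset.range n)]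
  · simp only [rowLen_eq_card_filter]
  · intro c hc
    exact Finset.mem_coe.2 (Finset.mem_range.2 (h c ((YoungDiagram.mem_cells _).1 hc)))

section skew

variable {mu lam : YoungDiagram} (t : SkewSYT mu lam)

theorem SkewSYT.cell_mem {k : ℕ} (h : mu.card < k ∧ k ≤ lam.card) :
    t.cell k ∈ lam.cells \ mu.cells := by
  rw [SkewSYT.cell, dif_pos h]
  exact (t.entry.symm ⟨k, h⟩).2

theorem SkewSYT.entry_cell {k : ℕ} (h : mu.card < k ∧ k ≤ lam.card) :
    t.entry ⟨t.cell k, t.cell_mem h⟩ = ⟨k, h⟩ := by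
  have : (⟨t.cell k, t.cell_mem h⟩ : {c : ℕ × ℕ // c ∈ lam.cells \ mu.cells}) =
      t.entry.symm ⟨k, h⟩ := Subtype.ext (dif_pos h)
  rw [this, Equiv.apply_symm_apply]

theorem SkewSYT.cell_entry (c : {c : ℕ × ℕ // c ∈ lam.cells \ mu.cells}) :
    t.cell (t.entry c).1 = c.1 := by
  rw [SkewSYT.cell, dif_pos (t.entry c).2]
  simp

theorem SkewSYT.card_row (hle : mu ≤ lam) (a : ℕ) :
    ((Finset.Ico mu.card lam.card).filter fun i => (t.cell (i + 1)).1 = a).card + mu.rowLen a =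
      lam.rowLen a := by
  have h1 : ((Finset.Ico mu.card lam.card).filter fun i => (t.cell (i + 1)).1 = a).card =
      ((lam.cells \ mu.cells).filter fun c => c.1 = a).card := by
    refine Finset.card_bij (fun i _ => t.cell (i + 1)) ?_ ?_ ?_
    · intro i hi
      obtain ⟨h1, h2⟩ := Finset.mem_filter.1 hi
      rw [Finset.mem_Ico] at h1
      exact Finset.mem_filter.2 ⟨t.cell_mem ⟨by omega, by omega⟩, h2⟩
    · intro i hi i' hi' he
      have h1 := Finset.mem_Ico.1 (Finset.mem_filter.1 hi).1
      have h2 := Finset.mem_Ico.1 (Finset.mem_filter.1 hi').1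
      have e1 := t.entry_cell (k := i + 1) ⟨by omega, by omega⟩
      have e2 := t.entry_cell (k := i' + 1) ⟨by omega, by omega⟩
      simp only [he] at e1
      have := Subtype.ext_iff.1 (e1.symm.trans e2)
      simpa using this
    · intro c hc
      obtain ⟨h1, h2⟩ := Finset.mem_filter.1 hc
      have h3 := t.cell_entry ⟨c, h1⟩
      have h4 := (t.entry ⟨c, h1⟩).2
      refine ⟨(t.entry ⟨c, h1⟩).1 - 1, Finset.mem_filter.2 ⟨Finset.mem_Ico.2 ⟨by omega, by omega⟩, ?_⟩, ?_⟩
      · rw [Nat.sub_add_cancel (by omega), h3, h2]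
      · rw [Nat.sub_add_cancel (by omega), h3]
  have h2 : (lam.cells \ mu.cells).filter (fun c => c.1 = a) =
      lam.cells.filter (fun c => c.1 = a) \ mu.cells.filter (fun c => c.1 = a) := by
    ext c; simp only [Finset.mem_filter, Finset.mem_sdiff]; tauto
  rw [h1, h2, rowLen_eq_card_filter, rowLen_eq_card_filter]
  exact Finset.card_sdiff_add_card_eq_card
    (Finset.filter_subset_filter _ (YoungDiagram.cells_subset_iff.2 hle))

end skew

section straight

variable {lam : YoungDiagram} (t : SYT lam)

theorem SkewSYT.mem_of_le {k : ℕ} (h : 0 < k ∧ k ≤ lam.card) {c : ℕ × ℕ}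
    (h1 : c.1 ≤ (t.cell k).1) (h2 : c.2 ≤ (t.cell k).2) : c ∈ lam.cells \ (⊥ : YoungDiagram).cells := by
  have h0 := t.cell_mem (k := k) ⟨by simpa [card_bot] using h.1, h.2⟩
  simp only [YoungDiagram.cells_bot, Finset.sdiff_empty, YoungDiagram.mem_cells] at h0 ⊢
  exact lam.up_left_mem h1 h2 h0

theorem rowWord_row (a b : ℕ) (hc : (a, b) ∈ lam.cells \ (⊥ : YoungDiagram).cells) {m : ℕ}
    (hm : (t.entry ⟨(a, b), hc⟩).1 ≤ m) : b + 1 ≤ cnt (rowWord t) m a := by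
  have hmem : ∀ b' ≤ b, (a, b') ∈ lam.cells \ (⊥ : YoungDiagram).cells := fun b' hb' => by
    simp only [YoungDiagram.cells_bot, Finset.sdiff_empty, YoungDiagram.mem_cells] at hc ⊢
    exact lam.up_left_mem le_rfl hb' hc
  have hle : ∀ b' (hb' : b' ≤ b), (t.entry ⟨(a, b'), hmem b' hb'⟩).1 ≤ m := fun b' hb' => by
    rcases hb'.lt_or_eq with h | rfl
    · exact (t.row_lt ⟨(a, b'), hmem b' hb'⟩ ⟨(a, b), hc⟩ rfl h).le.trans hm
    · exact hm
  rw [cnt]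
  refine (Finset.card_range (b + 1)).symm.trans_le (Finset.card_le_card_of_injOn
    (fun b' => if h : b' ≤ b then (t.entry ⟨(a, b'), hmem b' h⟩).1 - 1 else 0) ?_ ?_)
  · intro b' hb'
    have hb'' : b' ≤ b := Nat.lt_succ_iff.1 (Finset.mem_range.1 (Finset.mem_coe.1 hb'))
    simp only [dif_pos hb'']
    have h0 := (t.entry ⟨(a, b'), hmem b' hb''⟩).2
    have h1 := hle b' hb''
    refine Finset.mem_coe.2 (Finset.mem_filter.2 ⟨Finset.mem_range.2 (by omega), ?_⟩)
    rw [rowWord, Nat.sub_add_cancel (by omega), t.cell_entry]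
  · intro x hx y hy hxy
    have hx' : x ≤ b := Nat.lt_succ_iff.1 (Finset.mem_range.1 (Finset.mem_coe.1 hx))
    have hy' : y ≤ b := Nat.lt_succ_iff.1 (Finset.mem_range.1 (Finset.mem_coe.1 hy))
    simp only [dif_pos hx', dif_pos hy'] at hxy
    have h0 := (t.entry ⟨(a, x), hmem x hx'⟩).2
    have h1 := (t.entry ⟨(a, y), hmem y hy'⟩).2
    have h2 := t.entry.injective (Subtype.ext (show (t.entry ⟨(a, x), hmem x hx'⟩).1 =
      (t.entry ⟨(a, y), hmem y hy'⟩).1 by omega))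
    exact (Prod.mk.inj (Subtype.ext_iff.1 h2)).2

/-- The boxes left of an entry are exactly those of its row with smaller entries. -/
theorem cell_snd {i : ℕ} (hi : i < lam.card) :
    (t.cell (i + 1)).2 = cnt (rowWord t) i (rowWord t i) := by
  have hk : (⊥ : YoungDiagram).card < i + 1 ∧ i + 1 ≤ lam.card := ⟨by simp [card_bot], hi⟩
  have e := t.entry_cell hk
  apply le_antisymm
  · rcases Nat.eq_zero_or_pos (t.cell (i + 1)).2 with h0 | h0
    · omega
    have hc := t.mem_of_le (k := i + 1) (c := ((t.cell (i + 1)).1, (t.cell (i + 1)).2 - 1))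
      ⟨by omega, hi⟩ le_rfl (Nat.sub_le _ _)
    have h1 := t.row_lt ⟨_, hc⟩ ⟨_, t.cell_mem hk⟩ rfl (by simp only; omega)
    rw [e] at h1
    have h2 := rowWord_row t _ _ hc (m := i) (by simpa using Nat.lt_succ_iff.1 h1)
    rw [rowWord]
    omega
  · rw [cnt]
    refine (Finset.card_le_card_of_injOn (fun l => (t.cell (l + 1)).2) ?_ ?_).trans_eq
      (Finset.card_range (t.cell (i + 1)).2)
    · intro l hl
      obtain ⟨h1, h2⟩ := Finset.mem_filter.1 (Finset.mem_coe.1 hl)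
      rw [Finset.mem_range] at h1
      have hk' : (⊥ : YoungDiagram).card < l + 1 ∧ l + 1 ≤ lam.card := ⟨by simp [card_bot], by omega⟩
      refine Finset.mem_coe.2 (Finset.mem_range.2 ?_)
      by_contra! h3
      rcases h3.lt_or_eq with h4 | h4
      · have h5 := t.row_lt ⟨_, t.cell_mem hk⟩ ⟨_, t.cell_mem hk'⟩ h2.symm h4
        rw [e, t.entry_cell hk'] at h5
        simp only at h5
        omega
      · have h5 : (⟨_, t.cell_mem hk⟩ : {c : ℕ × ℕ // c ∈ lam.cells \ (⊥ : YoungDiagram).cells}) =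
          ⟨_, t.cell_mem hk'⟩ := Subtype.ext (Prod.ext h2.symm h4)
        have h6 := congrArg t.entry h5
        rw [e, t.entry_cell hk'] at h6
        have := Subtype.ext_iff.1 h6
        simp only at this
        omega
    · intro l hl l' hl' he
      obtain ⟨h1, h2⟩ := Finset.mem_filter.1 (Finset.mem_coe.1 hl)
      obtain ⟨h1', h2'⟩ := Finset.mem_filter.1 (Finset.mem_coe.1 hl')
      rw [Finset.mem_range] at h1 h1'
      have hk1 : (⊥ : YoungDiagram).card < l + 1 ∧ l + 1 ≤ lam.card := ⟨by simp [card_bot], by omega⟩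
      have hk2 : (⊥ : YoungDiagram).card < l' + 1 ∧ l' + 1 ≤ lam.card := ⟨by simp [card_bot], by omega⟩
      have h5 : (⟨_, t.cell_mem hk1⟩ : {c : ℕ × ℕ // c ∈ lam.cells \ (⊥ : YoungDiagram).cells}) =
          ⟨_, t.cell_mem hk2⟩ := Subtype.ext (Prod.ext (h2.trans h2'.symm) he)
      have h6 := congrArg t.entry h5
      rw [t.entry_cell hk1, t.entry_cell hk2] at h6
      have := Subtype.ext_iff.1 h6
      simp only at this
      omega

theorem content_eq_ct {i : ℕ} (hi : i < lam.card) : t.content (i + 1) = ct (rowWord t) i := by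
  rw [SkewSYT.content, ct, cell_snd t hi, rowWord]

theorem lattice_rowWord : Lattice lam.card (rowWord t) := by
  suffices ∀ m ≤ lam.card, Lattice m (rowWord t) from this _ le_rfl
  intro m hm
  induction m with
  | zero => exact lattice_zero _
  | succ m ih =>
    refine lattice_succ (ih (by omega)) fun a ha => ?_
    have hk : (⊥ : YoungDiagram).card < m + 1 ∧ m + 1 ≤ lam.card := ⟨by simp [card_bot], hm⟩
    rw [← cell_snd t (by omega)]
    have hc := t.mem_of_le (k := m + 1) (c := (a, (t.cell (m + 1)).2)) ⟨by omega, hm⟩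
      (show a ≤ _ from le_of_lt ha) le_rfl
    have h1 := t.col_lt ⟨_, hc⟩ ⟨_, t.cell_mem hk⟩ rfl ha
    rw [t.entry_cell hk] at h1
    exact rowWord_row t _ _ hc (m := m) (by simpa using Nat.lt_succ_iff.1 h1)

theorem cnt_rowWord (a : ℕ) : cnt (rowWord t) lam.card a = lam.rowLen a := by
  have := t.card_row bot_le a
  have h0 : (⊥ : YoungDiagram).rowLen a = 0 := by
    rw [rowLen_eq_card_filter]; simp
  rw [h0, add_zero] at this
  rw [card_bot, ← Finset.range_eq_Ico] at this
  exact this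

end straight

/-- The entry i + 1 is placed at the end of row r i as it stands before position i. The lattice
condition gives increasing columns. -/
theorem exists_SYT {lam : YoungDiagram} {r : ℕ → ℕ} (hr : Lattice lam.card r)
    (hc : ∀ a, cnt r lam.card a = lam.rowLen a) :
    ∃ t : SYT lam, ∀ i < lam.card, rowWord t i = r i := by
  have mem : ∀ i < lam.card, (r i, cnt r i (r i)) ∈ lam.cells \ (⊥ : YoungDiagram).cells := by
    intro i hi
    simp only [YoungDiagram.cells_bot, Finset.sdiff_empty, YoungDiagram.mem_cells]
    rw [YoungDiagram.mem_iff_lt_rowLen, ← hc]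
    have : cnt r (i + 1) (r i) ≤ cnt r lam.card (r i) := cnt_mono r _ hi
    rw [cnt_succ, if_pos rfl] at this
    omega
  let f : {k : ℕ // (⊥ : YoungDiagram).card < k ∧ k ≤ lam.card} →
      {c : ℕ × ℕ // c ∈ lam.cells \ (⊥ : YoungDiagram).cells} := fun k =>
    ⟨(r (k.1 - 1), cnt r (k.1 - 1) (r (k.1 - 1))), mem _ (by
      have h1 := k.2.1; have h2 := k.2.2; omega)⟩
  have step : ∀ k k' : {k : ℕ // (⊥ : YoungDiagram).card < k ∧ k ≤ lam.card}, k.1 < k'.1 →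
      r (k.1 - 1) = r (k'.1 - 1) → (f k).1.2 < (f k').1.2 := by
    intro k k' hlt he
    have h1 := k.2.1
    have h2 : cnt r (k.1 - 1 + 1) (r (k.1 - 1)) ≤ cnt r (k'.1 - 1) (r (k.1 - 1)) :=
      cnt_mono r _ (by omega)
    rw [cnt_succ, if_pos rfl, he] at h2
    change cnt r (k.1 - 1) (r (k.1 - 1)) < cnt r (k'.1 - 1) (r (k'.1 - 1))
    rw [he]
    omega
  have hf : Function.Bijective f := by
    constructor
    · intro k k' he
      have h1 := Prod.mk.inj (Subtype.ext_iff.1 he)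
      rcases lt_trichotomy k.1 k'.1 with h | h | h
      · exact absurd h1.2 (step k k' h h1.1).ne
      · exact Subtype.ext h
      · exact absurd h1.2 (step k' k h h1.1.symm).ne'
    · rintro ⟨⟨a, b⟩, hab⟩
      have hab' : b < lam.rowLen a := by
        simp only [YoungDiagram.cells_bot, Finset.sdiff_empty, YoungDiagram.mem_cells] at hab
        rwa [YoungDiagram.mem_iff_lt_rowLen] at hab
      rw [← hc] at hab'
      obtain ⟨i, -, h2, h3, h4⟩ := exists_letter_with_count (j := 0) (by simp) hab'
      refine ⟨⟨i + 1, by simp [card_bot], h2⟩, Subtype.ext (Prod.ext ?_ ?_)⟩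
      · exact h3
      · change cnt r i (r i) = b
        rw [h3, h4]
  let E := Equiv.ofBijective f hf
  have hE : ∀ c, f (E.symm c) = c := fun c => E.apply_symm_apply c
  refine ⟨⟨E.symm, ?_, ?_⟩, ?_⟩
  · intro c d h1 h2
    rw [← hE c, ← hE d] at h1 h2
    by_contra! h3
    rcases h3.lt_or_eq with h4 | h4
    · have := step _ _ h4 h1.symm
      omega
    · have := Subtype.ext h4
      rw [this] at h2
      omega
  · intro c d h1 h2
    rw [← hE c, ← hE d] at h1 h2
    by_contra! h3
    rcases h3.lt_or_eq with h4 | h4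
    · set k := E.symm c
      set k' := E.symm d
      change cnt r (k.1 - 1) (r (k.1 - 1)) = cnt r (k'.1 - 1) (r (k'.1 - 1)) at h1
      change r (k.1 - 1) < r (k'.1 - 1) at h2
      have h0 := k'.2.1
      have h6 := k.2.2
      have h5 : cnt r (k'.1 - 1 + 1) (r (k'.1 - 1)) ≤ cnt r (k.1 - 1) (r (k'.1 - 1)) :=
        cnt_mono r _ (by omega)
      rw [cnt_succ, if_pos rfl] at h5
      have := hr (k.1 - 1) (by omega) h2.le
      omega
    · have := Subtype.ext h4
      rw [this] at h2
      omega
  · intro i hi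
    have h : (⊥ : YoungDiagram).card < i + 1 ∧ i + 1 ≤ lam.card := ⟨by simp [card_bot], hi⟩
    rw [rowWord, SkewSYT.cell, dif_pos h]
    change (f ⟨i + 1, h⟩).1.1 = r i
    rfl

theorem exists_youngDiagram {n : ℕ} {r : ℕ → ℕ} (hr : Lattice n r) :
    ∃ nu : YoungDiagram, nu.card = n ∧ ∀ a, nu.rowLen a = cnt r n a := by
  have hsupp : ∀ a b, b < cnt r n a → a < n ∧ b < n := fun a b hb => by
    have h1 : cnt r n a ≤ n := (Finset.card_filter_le _ _).trans (by simp)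
    refine ⟨?_, by omega⟩
    by_contra! h2
    rw [cnt_eq_zero_of_lattice hr le_rfl h2] at hb
    omega
  let nu : YoungDiagram :=
    ⟨(Finset.range n ×ˢ Finset.range n).filter fun c => c.2 < cnt r n c.1, by
      rintro ⟨a, b⟩ ⟨a', b'⟩ hle hab
      have h1 : a' ≤ a := hle.1
      have h2 : b' ≤ b := hle.2
      have h3 : b < cnt r n a := (Finset.mem_filter.1 (Finset.mem_coe.1 hab)).2
      have h4 := hr n le_rfl h1
      have h5 : b' < cnt r n a' := by omega
      have h6 := hsupp a' b' h5
      exact Finset.mem_coe.2 (Finset.mem_filter.2 ⟨Finset.mem_product.2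
        ⟨Finset.mem_range.2 h6.1, Finset.mem_range.2 h6.2⟩, h5⟩)⟩
  have hmem : ∀ a b, (a, b) ∈ nu ↔ b < cnt r n a := fun a b => by
    rw [← YoungDiagram.mem_cells]
    constructor
    · intro h; exact (Finset.mem_filter.1 h).2
    · intro h
      have h6 := hsupp a b h
      exact Finset.mem_filter.2 ⟨Finset.mem_product.2
        ⟨Finset.mem_range.2 h6.1, Finset.mem_range.2 h6.2⟩, h⟩
  have hrow : ∀ a, nu.rowLen a = cnt r n a := fun a => by
    have h : ∀ b, b < nu.rowLen a ↔ b < cnt r n a := fun b => by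
      rw [← YoungDiagram.mem_iff_lt_rowLen, hmem]
    have h1 := h (nu.rowLen a)
    have h2 := h (cnt r n a)
    omega
  refine ⟨nu, ?_, hrow⟩
  rw [card_eq_sum_rowLen (n := n) fun c hc => (hsupp c.1 c.2 ((hmem _ _).1 hc)).1]
  simp only [hrow, sum_cnt_range]
  rw [Finset.filter_true_of_mem, Finset.card_range]
  intro i hi
  rw [Finset.mem_range] at hi
  have := addable_le_self (hr.addable hi)
  omega

theorem le_of_rowLen_le {mu nu : YoungDiagram} (h : ∀ a, mu.rowLen a ≤ nu.rowLen a) : mu ≤ nu := by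
  rw [← YoungDiagram.cells_subset_iff]
  rintro ⟨a, b⟩ hab
  rw [YoungDiagram.mem_cells, YoungDiagram.mem_iff_lt_rowLen] at hab ⊢
  exact hab.trans_le (h a)

/-- Interlacing: a row of nu never extends beyond the row of mu above it. -/
theorem isHorizontalStrip_of_rowLen {mu nu : YoungDiagram} (h : ∀ a, mu.rowLen a ≤ nu.rowLen a)
    (h' : ∀ a, nu.rowLen (a + 1) ≤ mu.rowLen a) : IsHorizontalStrip mu nu := by
  refine ⟨le_of_rowLen_le h, ?_⟩
  have key : ∀ c d : ℕ × ℕ, c ∈ nu.cells \ mu.cells → d ∈ nu.cells \ mu.cells → c.2 = d.2 →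
      ¬ c.1 < d.1 := by
    rintro ⟨a, b⟩ ⟨a', b'⟩ hc hd (rfl : b = b') (hlt : a < a')
    rw [Finset.mem_sdiff, YoungDiagram.mem_cells, YoungDiagram.mem_cells,
      YoungDiagram.mem_iff_lt_rowLen, YoungDiagram.mem_iff_lt_rowLen] at hc hd
    have h1 := h' a
    have h2 := nu.rowLen_anti (a + 1) a' hlt
    omega
  intro c hc d hd he
  have h1 := key c d hc hd he
  have h2 := key d c hd hc he.symm
  exact Prod.ext (by omega) he

end HeckeStrip
end

noncomputable section
open scoped RightActions
namespace HeckeStrip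

/-! ### Reading words and dominance -/

/-- The partial sums of a sequence. -/
def psum (p : ℕ → ℕ) (a : ℕ) : ℕ := ∑ b ∈ Finset.range a, p b

theorem psum_zero (p : ℕ → ℕ) : psum p 0 = 0 := rfl

theorem psum_succ (p : ℕ → ℕ) (a : ℕ) : psum p (a + 1) = psum p a + p a := Finset.sum_range_succ p a

theorem psum_mono (p : ℕ → ℕ) : Monotone (psum p) :=
  monotone_nat_of_le_succ fun a => by rw [psum_succ]; exact Nat.le_add_right _ _

open Classical in
/-- The word `0 ⋯ 0 1 ⋯ 1 2 ⋯` with `p a` letters `a`. -/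
def readWord (p : ℕ → ℕ) (i : ℕ) : ℕ := if h : ∃ a, i < psum p (a + 1) then Nat.find h else 0

theorem readWord_eq_iff {p : ℕ → ℕ} {N i a : ℕ} (hi : i < psum p N) :
    readWord p i = a ↔ psum p a ≤ i ∧ i < psum p (a + 1) := by
  have h : ∃ a, i < psum p (a + 1) := ⟨N, hi.trans_le (psum_mono p (Nat.le_succ N))⟩
  rw [readWord, dif_pos h, Nat.find_eq_iff]
  constructor
  · rintro ⟨h1, h2⟩
    refine ⟨?_, h1⟩
    cases a with
    | zero => rw [psum_zero]; omega
    | succ a => exact not_lt.1 (h2 a (Nat.lt_succ_self a))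
  · rintro ⟨h1, h2⟩
    exact ⟨h2, fun b hb => not_lt.2 ((psum_mono p (show b + 1 ≤ a from hb)).trans h1)⟩

theorem cnt_readWord {p : ℕ → ℕ} {N k : ℕ} (hk : k ≤ psum p N) (a : ℕ) :
    cnt (readWord p) k a = min k (psum p (a + 1)) - psum p a := by
  rw [cnt, ← Nat.card_Ico]
  congr 1
  ext i
  rw [Finset.mem_filter, Finset.mem_range, Finset.mem_Ico, lt_min_iff]
  constructor
  · rintro ⟨h1, h2⟩
    have := (readWord_eq_iff (h1.trans_le hk)).1 h2
    exact ⟨this.1, h1, this.2⟩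
  · rintro ⟨h1, h2, h3⟩
    exact ⟨h2, (readWord_eq_iff (h2.trans_le hk)).2 ⟨h1, h3⟩⟩

theorem cnt_readWord_self {p : ℕ → ℕ} {N : ℕ} (h0 : ∀ b, N ≤ b → p b = 0) (a : ℕ) :
    cnt (readWord p) (psum p N) a = p a := by
  rw [cnt_readWord le_rfl, psum_succ]
  rcases lt_or_ge a N with h | h
  · have := psum_mono p (show a + 1 ≤ N from h)
    rw [psum_succ] at this
    omega
  · have := h0 a h
    have h2 := psum_mono p h
    omega

theorem lattice_readWord {p : ℕ → ℕ} (hp : Antitone p) (N : ℕ) :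
    Lattice (psum p N) (readWord p) := by
  intro k hk
  refine antitone_nat_of_succ_le fun a => ?_
  rw [cnt_readWord hk, cnt_readWord hk, psum_succ, psum_succ]
  have := hp (show a ≤ a + 1 by omega)
  omega

theorem readWord_of_le {p : ℕ → ℕ} {N : ℕ} (h0 : ∀ b, N ≤ b → p b = 0) {i : ℕ}
    (hi : psum p N ≤ i) : readWord p i = 0 := by
  rw [readWord, dif_neg]
  rintro ⟨a, ha⟩
  have : psum p (a + 1) ≤ psum p N := by
    rcases le_total (a + 1) N with h | h
    · exact psum_mono p h
    · rw [psum, psum, ← Finset.sum_range_add_sum_Ico p h, Finset.sum_eq_zero (s := Finset.Ico _ _)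
        fun b hb => h0 b (Finset.mem_Ico.1 hb).1, add_zero]
  omega

theorem readWord_mem_latticeWords {p : ℕ → ℕ} (hp : Antitone p) {N : ℕ} (h0 : ∀ b, N ≤ b → p b = 0) :
    readWord p ∈ latticeWords (psum p N) :=
  ⟨lattice_readWord hp N, fun _ hi => readWord_of_le h0 hi⟩

section dominance

variable {r s : ℕ → ℕ}

theorem cnt_eq_zero_of_horizontal (h0 : s 0 = 0)
    (hA : ∀ a b, cnt r (s (a + 1)) (b + 1) ≤ cnt r (s a) b) {a b : ℕ} (hab : a ≤ b) :
    cnt r (s a) b = 0 := by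
  induction a generalizing b with
  | zero => rw [h0, cnt_zero]
  | succ a ih =>
    obtain ⟨b, rfl⟩ : ∃ b', b = b' + 1 := ⟨b - 1, by omega⟩
    exact Nat.le_zero.1 ((hA a b).trans (ih (by omega)).le)

theorem sum_cnt_of_horizontal (h0 : s 0 = 0)
    (hA : ∀ a b, cnt r (s (a + 1)) (b + 1) ≤ cnt r (s a) b) (a : ℕ) :
    ∑ b ∈ Finset.range a, cnt r (s a) b = s a := by
  rw [sum_cnt_range, Finset.filter_true_of_mem, Finset.card_range]
  intro i hi
  by_contra! h
  have h1 := cnt_eq_zero_of_horizontal h0 hA h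
  have h2 : cnt r (i + 1) (r i) ≤ cnt r (s a) (r i) := cnt_mono r _ (Finset.mem_range.1 hi)
  rw [cnt_succ, if_pos rfl] at h2
  omega

/-- A horizontal strip opens at most one new row, so after a strips all s a boxes lie in the first a
rows. -/
theorem le_sum_of_horizontal (h0 : s 0 = 0) {n : ℕ} (hn : ∀ a, s a ≤ n)
    (hA : ∀ a b, cnt r (s (a + 1)) (b + 1) ≤ cnt r (s a) b) (a : ℕ) :
    s a ≤ ∑ b ∈ Finset.range a, cnt r n b := by
  rw [← sum_cnt_of_horizontal h0 hA a]
  exact Finset.sum_le_sum fun b _ => cnt_mono r b (hn a)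

/-- The extremal case: when block a begins, the rows above a are already full, and the rows below a
stay empty until it ends. -/
theorem eq_of_horizontal {n : ℕ} (hn : ∀ a, psum (cnt r n) a ≤ n)
    (hA : ∀ a b, cnt r (psum (cnt r n) (a + 1)) (b + 1) ≤ cnt r (psum (cnt r n) a) b) {a i : ℕ}
    (h1 : psum (cnt r n) a ≤ i) (h2 : i < psum (cnt r n) (a + 1)) : r i = a := by
  have e1 : cnt r (i + 1) (r i) ≤ cnt r (psum (cnt r n) (a + 1)) (r i) := cnt_mono r _ h2
  have e2 : cnt r (psum (cnt r n) a) (r i) ≤ cnt r i (r i) := cnt_mono r _ h1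
  have e3 : cnt r (psum (cnt r n) (a + 1)) (r i) ≤ cnt r n (r i) := cnt_mono r _ (hn _)
  rw [cnt_succ, if_pos rfl] at e1
  rcases lt_trichotomy (r i) a with h | h | h
  · have h3 := (Finset.sum_eq_sum_iff_of_le fun b _ => cnt_mono r b (hn a)).1
      (sum_cnt_of_horizontal (s := psum (cnt r n)) rfl hA a) (r i) (Finset.mem_range.2 h)
    simp only at h3
    omega
  · exact h
  · have := cnt_eq_zero_of_horizontal (s := psum (cnt r n)) rfl hA (show a + 1 ≤ r i from h)
    omega

/-- A vertical strip adds at most one box to a row, so after c strips a row has at most c boxes and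
at most its final length. -/
theorem le_sum_of_vertical (h0 : s 0 = 0) {n : ℕ} (hn : ∀ a, s a ≤ n) (hr : Lattice n r)
    (hB : ∀ c b, cnt r (s (c + 1)) b ≤ cnt r (s c) b + 1) (c : ℕ) :
    s c ≤ ∑ b ∈ Finset.range n, min (cnt r n b) c := by
  have h1 : ∀ c b, cnt r (s c) b ≤ c := fun c b => by
    induction c with
    | zero => rw [h0, cnt_zero]
    | succ c ih => exact (hB c b).trans (by omega)
  have h2 : ∑ b ∈ Finset.range n, cnt r (s c) b = s c := by
    rw [sum_cnt_range, Finset.filter_true_of_mem, Finset.card_range]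
    intro i hi
    have h3 := (Finset.mem_range.1 hi).trans_le (hn c)
    have := addable_le_self (hr.addable h3)
    omega
  rw [← h2]
  exact Finset.sum_le_sum fun b _ => le_min (cnt_mono r b (hn c)) (h1 c b)

theorem eq_of_dominance {n : ℕ} {p h : ℕ → ℕ} (hp : Antitone p) (hp0 : ∀ b, n ≤ b → p b = 0)
    (hh0 : ∀ b, n ≤ b → h b = 0) (hsum : psum p n = psum h n)
    (hA : ∀ a, psum p a ≤ psum h a)
    (hB : ∀ c, ∑ b ∈ Finset.range n, min (p b) c ≤ ∑ b ∈ Finset.range n, min (h b) c) : h = p := by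
  by_contra hne
  have hex : ∃ b, h b ≠ p b := by
    by_contra! hc
    exact hne (funext hc)
  classical
  let b := Nat.find hex
  have hb : h b ≠ p b := Nat.find_spec hex
  have hlt : ∀ i < b, h i = p i := fun i hi => not_not.1 (Nat.find_min hex hi)
  have hbn : b < n := by
    by_contra! hc
    exact hb (by rw [hp0 b hc, hh0 b hc])
  have h1 := hA (b + 1)
  have h2 : psum h b = psum p b := Finset.sum_congr rfl fun i hi => hlt i (Finset.mem_range.1 hi)
  rw [psum_succ, psum_succ, h2] at h1
  -- At the first difference b, `hA` gives h b > p b. Truncation at p b does not shorten the rows of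
  -- p from b on, but cuts row b of h; as the totals agree, this contradicts `hB`.
  have h3 := hB (p b)
  have h4 : ∑ i ∈ Finset.range n, (min (h i) (p b) + p i) <
      ∑ i ∈ Finset.range n, (min (p i) (p b) + h i) := by
    refine Finset.sum_lt_sum (fun i _ => ?_) ⟨b, Finset.mem_range.2 hbn, by omega⟩
    rcases lt_or_ge i b with hi | hi
    · rw [hlt i hi]
    · have := hp hi
      omega
  rw [Finset.sum_add_distrib, Finset.sum_add_distrib] at h4
  have h5 : ∑ i ∈ Finset.range n, p i = ∑ i ∈ Finset.range n, h i := hsum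
  omega

end dominance

section columns

/-- The lengths of the columns of the diagram with rows `p 0, …, p (n - 1)`. -/
def colCount (n : ℕ) (p : ℕ → ℕ) (c : ℕ) : ℕ := ((Finset.range n).filter fun b => c < p b).card

variable {n : ℕ} {p : ℕ → ℕ}

theorem psum_colCount (c : ℕ) :
    psum (colCount n p) c = ∑ b ∈ Finset.range n, min (p b) c := by
  induction c with
  | zero => simp [psum]
  | succ c ih =>
    rw [psum_succ, ih, colCount, Finset.card_filter, ← Finset.sum_add_distrib]
    refine Finset.sum_congr rfl fun b _ => ?_
    split_ifs <;> omega

theorem psum_colCount_le (c : ℕ) : psum (colCount n p) c ≤ psum p n := by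
  rw [psum_colCount]
  exact Finset.sum_le_sum fun b _ => min_le_left _ _

theorem psum_colCount_self (h : ∀ b, p b ≤ n) : psum (colCount n p) n = psum p n := by
  rw [psum_colCount]
  exact Finset.sum_congr rfl fun b _ => min_eq_left (h b)

theorem lt_colCount_iff (hp : Antitone p) (hp0 : ∀ b, n ≤ b → p b = 0) {a c : ℕ} :
    a < colCount n p c ↔ c < p a := by
  constructor
  · intro h
    by_contra! h1
    refine h.not_ge ((Finset.card_le_card (t := Finset.range a) fun b hb => ?_).trans_eq
      (Finset.card_range a))
    have h2 := (Finset.mem_filter.1 hb).2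
    rw [Finset.mem_range]
    by_contra! h3
    have := hp h3
    omega
  · intro h
    refine (Finset.card_range (a + 1)).symm.trans_le (Finset.card_le_card fun b hb => ?_)
    have h2 := hp (Nat.lt_succ_iff.1 (Finset.mem_range.1 hb))
    refine Finset.mem_filter.2 ⟨Finset.mem_range.2 ?_, by omega⟩
    by_contra! h3
    have := hp0 b h3
    omega

/-- The word of the column reading of the diagram with rows `p 0, …, p (n - 1)`. -/
def colWord (n : ℕ) (p : ℕ → ℕ) (i : ℕ) : ℕ :=
  i - psum (colCount n p) (readWord (colCount n p) i)

theorem colWord_injOn {i i' : ℕ} (hi : i < psum (colCount n p) n) (hi' : i' < psum (colCount n p) n)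
    (hb : readWord (colCount n p) i = readWord (colCount n p) i')
    (hw : colWord n p i = colWord n p i') : i = i' := by
  have h1 := ((readWord_eq_iff hi).1 rfl).1
  have h2 := ((readWord_eq_iff hi').1 rfl).1
  rw [colWord, colWord, hb] at hw
  rw [hb] at h1
  omega

theorem cnt_colWord (hp : Antitone p) (hp0 : ∀ b, n ≤ b → p b = 0) (h : ∀ b, p b ≤ n) (a : ℕ) :
    cnt (colWord n p) (psum (colCount n p) n) a = p a := by
  rw [cnt]
  refine (Finset.card_bij (t := Finset.range (p a)) (fun i _ => readWord (colCount n p) i)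
    ?_ ?_ ?_).trans (Finset.card_range _)
  · intro i hi
    obtain ⟨h1, h2⟩ := Finset.mem_filter.1 hi
    have h3 := (readWord_eq_iff (Finset.mem_range.1 h1)).1 rfl
    rw [Finset.mem_range, ← lt_colCount_iff hp hp0]
    rw [psum_succ] at h3
    rw [colWord] at h2
    omega
  · intro i hi i' hi' he
    obtain ⟨h1, h2⟩ := Finset.mem_filter.1 hi
    obtain ⟨h1', h2'⟩ := Finset.mem_filter.1 hi'
    exact colWord_injOn (Finset.mem_range.1 h1) (Finset.mem_range.1 h1') he (h2.trans h2'.symm)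
  · intro c hc
    rw [Finset.mem_range] at hc
    have hcn : c + 1 ≤ n := hc.trans_le (h a)
    have h1 := psum_mono (colCount n p) hcn
    have h2 := (lt_colCount_iff hp hp0).2 hc
    rw [psum_succ] at h1
    have h3 : readWord (colCount n p) (psum (colCount n p) c + a) = c :=
      (readWord_eq_iff (N := n) (by omega)).2 ⟨by omega, by rw [psum_succ]; omega⟩
    refine ⟨psum (colCount n p) c + a, Finset.mem_filter.2 ⟨Finset.mem_range.2 (by omega), ?_⟩, h3⟩
    rw [colWord, h3]
    omega

end columns

end HeckeStrip
end

/-! ### Word modules and the nonvanishing of the Specht vector -/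

noncomputable section
open scoped RightActions
namespace HeckeStrip

set_option linter.unusedSectionVars false

/-! ### The word modules -/

theorem cnt_eq_card_fin {n : ℕ} (r : ℕ → ℕ) (a : ℕ) :
    (Finset.univ.filter fun i : Fin n => r i = a).card = cnt r n a := by
  rw [cnt]
  refine Finset.card_bij (fun i _ => (i : ℕ)) ?_ ?_ ?_
  · intro i hi
    exact Finset.mem_filter.2 ⟨Finset.mem_range.2 i.2, (Finset.mem_filter.1 hi).2⟩
  · intro i _ i' _ he
    exact Fin.ext he
  · intro i hi
    obtain ⟨h1, h2⟩ := Finset.mem_filter.1 hi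
    exact ⟨⟨i, Finset.mem_range.1 h1⟩, Finset.mem_filter.2 ⟨Finset.mem_univ _, h2⟩, rfl⟩

theorem hasContent_iff {n : ℕ} {lam : YoungDiagram} {r : ℕ → ℕ} :
    HasContent lam (fun i : Fin n => r i) ↔ ∀ a, cnt r n a = lam.rowLen a := by
  simp only [HasContent, cnt_eq_card_fin]

theorem rowLen_eq_zero {lam : YoungDiagram} {a : ℕ} (h : lam.card ≤ a) : lam.rowLen a = 0 := by
  by_contra h1
  have h2 : (a, 0) ∈ lam := YoungDiagram.mem_iff_lt_rowLen.2 (Nat.pos_of_ne_zero h1)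
  have := row_lt_card h2
  simp only at this
  omega

theorem psum_rowLen (lam : YoungDiagram) : psum lam.rowLen lam.card = lam.card :=
  (card_eq_sum_rowLen fun _ hc => row_lt_card hc).symm

theorem rowLen_le_card (lam : YoungDiagram) (a : ℕ) : lam.rowLen a ≤ lam.card := by
  rw [rowLen_eq_card_filter]
  exact Finset.card_filter_le _ _

theorem rowLen_antitone (lam : YoungDiagram) : Antitone lam.rowLen := fun a b h => lam.rowLen_anti a b h

theorem of_mem_wordModule {n : ℕ} (q : ℂ) {lam : YoungDiagram} {w : Fin n → ℕ} (hw : HasContent lam w) :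
    WordSpace.of w ∈ wordModule n q lam :=
  Submodule.subset_span (s := WordSpace.of '' {w : Fin n → ℕ | HasContent lam w}) ⟨w, hw, rfl⟩

theorem smul_mem_complex {n : ℕ} {q : ℂ} (K : Submodule (Hecke n q)ᵐᵒᵖ (WordSpace n)) (c : ℂ)
    {x : WordSpace n} (hx : x ∈ K) : c • x ∈ K := by
  rw [← one_smul (Hecke n q)ᵐᵒᵖ x, ← smul_assoc]
  exact K.smul_mem _ hx

section cyclic

variable {n : ℕ} {q : ℂ}

/-- For a descent the exchanged word appears with coefficient q, which is invertible. -/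
theorem of_comp_swap_mem (hq : q ≠ 0) (K : Submodule (Hecke n q)ᵐᵒᵖ (WordSpace n)) {i : ℕ}
    (hi : i + 1 < n) {w : Fin n → ℕ} (hw : WordSpace.of w ∈ K) :
    WordSpace.of (w ∘ Equiv.swap (⟨i, by omega⟩ : Fin n) ⟨i + 1, hi⟩) ∈ K := by
  have h1 : gen n q i • WordSpace.of w ∈ K := K.smul_mem _ hw
  rw [gen_smul hi] at h1
  set a : Fin n := ⟨i, by omega⟩
  set b : Fin n := ⟨i + 1, hi⟩
  rcases lt_trichotomy (w a) (w b) with h | h | h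
  · rwa [exch_lt q h] at h1
  · have : w ∘ Equiv.swap a b = w := by
      ext x
      simp only [Function.comp, Equiv.swap_apply_def]
      split_ifs with h2 h3 <;> simp [*]
    rwa [this]
  · rw [exch_gt q h] at h1
    have h2 := smul_mem_complex K q⁻¹ (K.sub_mem h1 (smul_mem_complex K (q - 1) hw))
    rwa [add_sub_cancel_right, smul_smul, inv_mul_cancel₀ hq, one_smul] at h2

theorem of_comp_perm_mem (hq : q ≠ 0) (K : Submodule (Hecke n q)ᵐᵒᵖ (WordSpace n))
    {w : Fin n → ℕ} (hw : WordSpace.of w ∈ K) (σ : Equiv.Perm (Fin n)) :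
    WordSpace.of (w ∘ σ) ∈ K := by
  obtain _ | n := n
  · rwa [Subsingleton.elim (w ∘ σ) w]
  · have hσ : σ ∈ Submonoid.closure (Set.range fun i : Fin n => Equiv.swap i.castSucc i.succ) := by
      rw [Equiv.Perm.mclosure_swap_castSucc_succ]
      exact Submonoid.mem_top σ
    induction hσ using Submonoid.closure_induction generalizing w with
    | mem σ hσ =>
      obtain ⟨i, rfl⟩ := hσ
      exact of_comp_swap_mem hq K (i := i) (by omega) hw
    | one => exact hw
    | mul σ τ _ _ h1 h2 => exact h2 (h1 hw)

theorem exists_perm_of_hasContent {lam : YoungDiagram} {w w' : Fin n → ℕ} (hw : HasContent lam w)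
    (hw' : HasContent lam w') : ∃ σ : Equiv.Perm (Fin n), w' = w ∘ σ := by
  have e : ∀ c, Nonempty ({i // w' i = c} ≃ {i // w i = c}) := fun c => by
    rw [← Fintype.card_eq, Fintype.card_subtype, Fintype.card_subtype, hw c, hw' c]
  exact ⟨Equiv.ofFiberEquiv fun c => (e c).some, funext fun i => (Equiv.ofFiberEquiv_map _ i).symm⟩

/-- Each word generates its word module. -/
theorem exists_smul_of (hq : q ≠ 0) {lam : YoungDiagram} {w w' : Fin n → ℕ} (hw : HasContent lam w)
    (hw' : HasContent lam w') : ∃ a : (Hecke n q)ᵐᵒᵖ, a • WordSpace.of w = WordSpace.of w' := by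
  obtain ⟨σ, rfl⟩ := exists_perm_of_hasContent hw hw'
  exact Submodule.mem_span_singleton.1 (of_comp_perm_mem hq _ (Submodule.mem_span_singleton_self _) σ)

theorem exists_smul_of_mem_wordModule (hq : q ≠ 0) {lam : YoungDiagram} {w : Fin n → ℕ}
    (hw : HasContent lam w) {y : WordSpace n} (hy : y ∈ wordModule n q lam) :
    ∃ a : (Hecke n q)ᵐᵒᵖ, a • WordSpace.of w = y := by
  have hy' : y ∈ Submodule.span ℂ (WordSpace.of '' {w : Fin n → ℕ | HasContent lam w}) := hy
  rw [← Submodule.mem_span_singleton]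
  clear hy
  induction hy' using Submodule.span_induction with
  | mem x hx =>
    obtain ⟨w', hw', rfl⟩ := hx
    exact Submodule.mem_span_singleton.2 (exists_smul_of hq hw hw')
  | zero => exact Submodule.zero_mem _
  | add x y _ _ hx hy => exact Submodule.add_mem _ hx hy
  | smul c x _ hx => exact smul_mem_complex _ c hx

end cyclic

/-! ### The sign functional of a column reading -/

section signForm

variable {n : ℕ} (q : ℂ) (p : ℕ → ℕ)

/-- The matrix that compares a word with the column reading word inside the blocks. -/
def blockMatrix (w : Fin n → ℕ) : Matrix (Fin n) (Fin n) ℂ :=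
  fun i l => if readWord (colCount n p) i = readWord (colCount n p) l ∧ w i = colWord n p l
    then 1 else 0

/-- The alternating functional of the column blocks. -/
def signForm : WordSpace n →ₗ[ℂ] ℂ := WordSpace.lift fun w => (blockMatrix p w).det

theorem signForm_of (w : Fin n → ℕ) : signForm p (WordSpace.of w) = (blockMatrix p w).det :=
  WordSpace.lift_of _ _

theorem det_blockMatrix_swap {a b : Fin n} (hab : a ≠ b)
    (h : readWord (colCount n p) a = readWord (colCount n p) b) (w : Fin n → ℕ) :
    (blockMatrix p (w ∘ Equiv.swap a b)).det = -(blockMatrix p w).det := by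
  have e : blockMatrix p (w ∘ Equiv.swap a b) = (blockMatrix p w).submatrix (Equiv.swap a b) id := by
    ext i l
    have : readWord (colCount n p) (Equiv.swap a b i) = readWord (colCount n p) i := by
      rw [Equiv.swap_apply_def]
      split_ifs with h1 h2 <;> simp [*]
    simp only [blockMatrix, Matrix.submatrix_apply, Function.comp, id, this]
  rw [e, Matrix.det_permute, Equiv.Perm.sign_swap hab]
  simp

/-- The undeformed alternating form is a sign eigenvector for every q: equal letters give
determinant 0, and a descent gives -q + (q - 1) = -1. -/
theorem signForm_gen_smul {i : ℕ} (hi : i + 1 < n)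
    (h : readWord (colCount n p) i = readWord (colCount n p) (i + 1)) (v : WordSpace n) :
    signForm p (gen n q i • v) = -signForm p v := by
  rw [gen_smul hi]
  set a : Fin n := ⟨i, by omega⟩
  set b : Fin n := ⟨i + 1, hi⟩
  have hab : a ≠ b := fun h => by simp [a, b] at h
  suffices (signForm p) ∘ₗ exch q a b = -signForm p from congrArg (fun f => f v) this
  refine WordSpace.hom_ext fun w => ?_
  rw [LinearMap.comp_apply, LinearMap.neg_apply]
  have hs := det_blockMatrix_swap p hab h w
  rcases lt_trichotomy (w a) (w b) with h1 | h1 | h1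
  · rw [exch_lt q h1, signForm_of, signForm_of, hs]
  · have e : w ∘ Equiv.swap a b = w := by
      ext x
      simp only [Function.comp, Equiv.swap_apply_def]
      split_ifs with h2 h3 <;> simp [*]
    rw [e] at hs
    rw [exch_eq q h1, map_smul, signForm_of, self_eq_neg.1 hs, smul_zero, neg_zero]
  · rw [exch_gt q h1, map_add, map_smul, map_smul, signForm_of, signForm_of, hs]
    simp only [smul_eq_mul]
    ring

theorem signForm_colWord (h : n ≤ psum (colCount n p) n) :
    signForm p (WordSpace.of fun i : Fin n => colWord n p i) = 1 := by
  have : blockMatrix p (fun i : Fin n => colWord n p i) = 1 := by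
    ext i l
    rw [blockMatrix, Matrix.one_apply]
    refine if_congr ⟨fun h1 => ?_, fun h1 => by rw [h1]; exact ⟨rfl, rfl⟩⟩ rfl rfl
    exact Fin.ext (colWord_injOn (i.2.trans_le h) (l.2.trans_le h) h1.1 h1.2)
  rw [signForm_of, this, Matrix.det_one]

end signForm

/-! ### The Specht vector -/

section spechtVector

variable {n : ℕ} {q : ℂ} {lam : YoungDiagram}

/-- The row reading word of a Young diagram. -/
def rowReading (lam : YoungDiagram) : ℕ → ℕ := readWord lam.rowLen

theorem rowReading_mem (hlam : lam.card = n) : rowReading lam ∈ latticeWords n := by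
  have := readWord_mem_latticeWords (rowLen_antitone lam) fun b hb => rowLen_eq_zero (lam := lam) hb
  rwa [psum_rowLen, hlam] at this

theorem cnt_rowReading (hlam : lam.card = n) : cnt (rowReading lam) n = lam.rowLen := by
  funext a
  have := cnt_readWord_self (fun b hb => rowLen_eq_zero (lam := lam) hb) a
  rwa [psum_rowLen, hlam] at this

/-- The word of the row reading tableau, as a vector. -/
def rowVector (n : ℕ) (lam : YoungDiagram) : WordSpace n :=
  WordSpace.of fun i : Fin n => rowReading lam i

theorem hasContent_rowReading (hlam : lam.card = n) :
    HasContent lam (fun i : Fin n => rowReading lam i) :=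
  hasContent_iff.2 (congrFun (cnt_rowReading hlam))

theorem psum_rowLen_le (hlam : lam.card = n) (a : ℕ) : psum lam.rowLen a ≤ n := by
  rw [← hlam]
  rcases le_total a lam.card with h | h
  · exact (psum_mono _ h).trans (psum_rowLen lam).le
  · rw [psum, ← Finset.sum_range_add_sum_Ico _ h, Finset.sum_eq_zero (s := Finset.Ico _ _)
      fun b hb => rowLen_eq_zero (Finset.mem_Ico.1 hb).1, add_zero]
    exact (psum_rowLen lam).le

/-- Within one block the letters of the row reading word are equal, so the word is q-invariant
there. -/
theorem horizontal_rowVector (hq : q ≠ 0) (hg : QGood n q) (hlam : lam.card = n) {r : ℕ → ℕ}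
    (hr : r ∈ latticeWords n) (h0 : wtProj n q (gen n q) r • rowVector n lam ≠ 0) (a b : ℕ) :
    cnt r (psum lam.rowLen (a + 1)) (b + 1) ≤ cnt r (psum lam.rowLen a) b := by
  refine (heckeFam_gen hq).horizontal_of_invariant hg (psum_rowLen_le hlam a)
    (psum_rowLen_le hlam (a + 1)) (fun k hk hk' => ?_) hr h0 b
  have hkn := hk'.trans_le (psum_rowLen_le hlam (a + 1))
  have e1 : rowReading lam k = a := (readWord_eq_iff (N := a + 1) (by omega)).2 ⟨hk, by omega⟩
  have e2 : rowReading lam (k + 1) = a := (readWord_eq_iff (N := a + 1) hk').2 ⟨by omega, hk'⟩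
  rw [gen_smul hkn, rowVector, exch_eq q (by simp only [e1, e2])]

/-- The only component of the shape `lam` of the row reading word is that of its own weight. -/
theorem eq_rowReading (hq : q ≠ 0) (hg : QGood n q) (hlam : lam.card = n) {r : ℕ → ℕ}
    (hr : r ∈ latticeWords n) (h0 : wtProj n q (gen n q) r • rowVector n lam ≠ 0)
    (hc : cnt r n = lam.rowLen) : r = rowReading lam := by
  have hA := horizontal_rowVector hq hg hlam hr h0
  funext i
  rcases lt_or_ge i n with hi | hi
  · have hi' : i < psum lam.rowLen lam.card := by rwa [psum_rowLen, hlam]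
    have h1 := (readWord_eq_iff hi').1 rfl
    simp only [← hc] at h1 hA
    refine (eq_of_horizontal ?_ hA h1.1 h1.2).trans ?_
    · rw [hc]; exact psum_rowLen_le hlam
    · rw [hc, rowReading]
  · rw [hr.2 i hi, (rowReading_mem hlam).2 i hi]

theorem tauOf_signForm_ne_zero (hq : q ≠ 0) (hg : QGood n q) (p : ℕ → ℕ) {r : ℕ → ℕ} {k : ℕ}
    (hr : Lattice n r) (hk : k + 1 < n) (hs : Swappable r k)
    (h : readWord (colCount n p) k = readWord (colCount n p) (k + 1)) {y : WordSpace n}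
    (hy : signForm p y ≠ 0) : signForm p (HeckeFam.tauOf q (gen n q) r k • y) ≠ 0 := by
  have h2 := right_ne_zero_of_mul (HeckeFam.tauOf_tauOf_ne hq hg le_rfl hr hk hs)
  rw [HeckeFam.tauOf, HeckeFam.tau_smul, map_sub, LinearMap.map_smul, LinearMap.map_smul,
    signForm_gen_smul q p hk h]
  have e : (qInt q (ct r (k + 1)) - qInt q (ct r k)) • -signForm p y -
      (1 + (q - 1) * qInt q (ct r (k + 1))) • signForm p y =
      -((1 + q * qInt q (ct r (k + 1)) - qInt q (ct r k)) * signForm p y) := by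
    simp only [smul_eq_mul]; ring
  rw [e]
  exact neg_ne_zero.2 (mul_ne_zero h2 hy)

/-- Take a weight component of the column reading word on which `signForm` is nonzero. Intertwiners
inside a column block scale the form by nonzero factors, so nonvanishing persists under exchanges.
At row neighbours a generator acts by q on the vector and by -1 on the form, which is impossible as
1 + q ≠ 0. -/
theorem exists_vertical_weight (hq : q ≠ 0) (hg : QGood n q) (hlam : lam.card = n) :
    ∃ r ∈ latticeWords n, (∃ y ∈ wordModule n q lam, y ≠ 0 ∧ Wt q (gen n q) n r y) ∧
      ∀ c b, cnt r (psum (colCount n lam.rowLen) (c + 1)) b ≤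
        cnt r (psum (colCount n lam.rowLen) c) b + 1 := by
  set p := lam.rowLen
  have h := heckeFam_gen (n := n) hq
  have hp0 : ∀ b, n ≤ b → p b = 0 := fun b hb => rowLen_eq_zero (hlam.trans_le hb)
  have hpn : ∀ b, p b ≤ n := fun b => hlam ▸ rowLen_le_card lam b
  have hsum : psum (colCount n p) n = n := by
    rw [psum_colCount_self hpn, ← hlam, psum_rowLen]
  have hle : ∀ c, psum (colCount n p) c ≤ n := fun c =>
    (psum_colCount_le c).trans_eq (by rw [← hlam, psum_rowLen])
  let P : (ℕ → ℕ) → Prop := fun r => r ∈ latticeWords n ∧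
    ∃ y ∈ wordModule n q lam, Wt q (gen n q) n r y ∧ signForm p y ≠ 0
  have hblk : ∀ c k, psum (colCount n p) c ≤ k → k + 1 < psum (colCount n p) (c + 1) →
      readWord (colCount n p) k = readWord (colCount n p) (k + 1) := fun c k h1 h2 => by
    rw [(readWord_eq_iff (N := c + 1) (a := c) (by omega)).2 ⟨h1, by omega⟩,
      (readWord_eq_iff (N := c + 1) (a := c) h2).2 ⟨by omega, h2⟩]
  have hP : ∀ c, SwapClosed n (psum (colCount n p) c) (psum (colCount n p) (c + 1)) P := by
    rintro c r k hr hk hk' hs ⟨hrw, y, hy, hyr, hy0⟩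
    have hkn := hk'.trans_le (hle (c + 1))
    exact ⟨latticeWords_swapAt hrw hkn hs, _, Submodule.smul_mem _ _ hy,
      h.Wt_tauOf le_rfl hyr hkn hs.1,
      tauOf_signForm_ne_zero hq hg p hr hkn hs (hblk c k hk hk') hy0⟩
  have hV : ∀ c r k, Lattice n r → psum (colCount n p) c ≤ k →
      k + 1 < psum (colCount n p) (c + 1) → r k = r (k + 1) → ¬ P r := by
    rintro c r k hr hk hk' he ⟨hrw, y, hy, hyr, hy0⟩
    have hkn := hk'.trans_le (hle (c + 1))
    have h1 := signForm_gen_smul q p hkn (hblk c k hk hk') y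
    rw [h.t_smul_row hg le_rfl hkn hr hyr he, map_smul, smul_eq_mul] at h1
    have h2 : (q + 1) * signForm p y = 0 := by rw [add_mul, h1]; ring
    exact hg.ne_neg_one hq (by omega)
      ((add_comm 1 q).trans ((mul_eq_zero.1 h2).resolve_right hy0))
  have hcol : HasContent lam (fun i : Fin n => colWord n p i) := hasContent_iff.2 fun a => by
    have := cnt_colWord (rowLen_antitone lam) hp0 hpn a
    rwa [hsum] at this
  have h1 := signForm_colWord p hsum.ge
  rw [← h.sum_wtProj_smul hg (WordSpace.of fun i : Fin n => colWord n p i), map_sum] at h1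
  obtain ⟨r, hr, hr0⟩ := Finset.exists_ne_zero_of_sum_ne_zero (h1.trans_ne one_ne_zero)
  have hrw : r ∈ latticeWords n := (latticeWords_finite n).mem_toFinset.1 hr
  have hy := Submodule.smul_mem _ (wtProj n q (gen n q) r) (of_mem_wordModule q hcol)
  have hw := h.Wt_wtProj hg hrw.1 (WordSpace.of fun i : Fin n => colWord n p i)
  refine ⟨r, hrw, ⟨_, hy, fun h0 => hr0 (by rw [h0, map_zero]), hw⟩, fun c b => ?_⟩
  exact (hP c).vertical (hle _) (hV c) hrw.1 ⟨hrw, _, hy, hw, hr0⟩ (hle c) b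

/-- The weight vector that generates the Specht module. -/
def spechtVector (n : ℕ) (q : ℂ) (lam : YoungDiagram) : WordSpace n :=
  wtProj n q (gen n q) (rowReading lam) • rowVector n lam

/-- The row reading word generates the word module, so the vector from `exists_vertical_weight`
comes from some component r' of it, of the same shape. Horizontal strips for r' and vertical strips
for r bound this shape from both sides, so it is `lam`, and then r' is the row reading word. -/
theorem spechtVector_ne_zero (hq : q ≠ 0) (hg : QGood n q) (hlam : lam.card = n) :
    spechtVector n q lam ≠ 0 := by
  have h := heckeFam_gen (n := n) hq
  obtain ⟨r, hr, ⟨y, hy, hy0, hyr⟩, hB⟩ := exists_vertical_weight hq hg hlam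
  obtain ⟨a, rfl⟩ := exists_smul_of_mem_wordModule hq (hasContent_rowReading hlam) hy
  change a • rowVector n lam ≠ 0 at hy0
  have h1 : wtProj n q (gen n q) r • a • rowVector n lam ≠ 0 := by
    obtain ⟨c, hc, hc'⟩ : ∃ c : ℂ, c ≠ 0 ∧
        wtProj n q (gen n q) r • a • rowVector n lam = c • a • rowVector n lam :=
      ⟨1, one_ne_zero, by
        rw [one_smul]; exact HeckeFam.wtProj_smul_self hr.1 hyr fun i _ => rfl⟩
    rw [hc']
    exact smul_ne_zero hc hy0
  rw [← h.sum_wtProj_smul hg (rowVector n lam), Finset.smul_sum, Finset.smul_sum] at h1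
  obtain ⟨r', hr', h2⟩ := Finset.exists_ne_zero_of_sum_ne_zero h1
  rw [Set.Finite.mem_toFinset] at hr'
  have hc := h.cnt_eq_of_wtProj_smul_ne_zero hg subAlg_gen_eq_top hr'.1 hr.1
    (h.Wt_wtProj hg hr'.1 (rowVector n lam)) a h2
  have h3 : wtProj n q (gen n q) r' • rowVector n lam ≠ 0 := fun h0 => h2 (by simp [h0])
  have hA := horizontal_rowVector hq hg hlam hr' h3
  have hp0 : ∀ b, n ≤ b → lam.rowLen b = 0 := fun b hb => rowLen_eq_zero (hlam.trans_le hb)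
  have hsumr : psum (cnt r n) n = n := by
    rw [psum, sum_cnt_range, Finset.filter_true_of_mem, Finset.card_range]
    intro i hi
    rw [Finset.mem_range] at hi
    have := addable_le_self (hr.1.addable hi)
    omega
  have hcr : cnt r n = lam.rowLen := by
    refine eq_of_dominance (rowLen_antitone lam) hp0
      (fun b hb => cnt_eq_zero_of_lattice hr.1 le_rfl hb) ?_ ?_ ?_
    · rw [hsumr, ← hlam, psum_rowLen]
    · intro a
      rw [hc]
      exact le_sum_of_horizontal (psum_zero _) (psum_rowLen_le hlam) hA a
    · intro c
      rw [← psum_colCount]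
      refine le_sum_of_vertical (psum_zero _) (fun c => ?_) hr.1 hB c
      exact (psum_colCount_le c).trans_eq (by rw [← hlam, psum_rowLen])
  have := eq_rowReading hq hg hlam hr' h3 (hc ▸ hcr)
  rwa [this] at h3

end spechtVector

end HeckeStrip
end

/-! ### Cyclic Specht modules, shuffle elements and the consequence of semisimplicity -/

noncomputable section
open scoped RightActions
namespace HeckeStrip

set_option linter.unusedSectionVars false

open MulOpposite

/-! ### Specht modules are cyclic -/

section specht

variable {n : ℕ} {q : ℂ} {lam : YoungDiagram}

theorem rowWord_mem_latticeWords (hlam : lam.card = n) (t : SYT lam) : rowWord t ∈ latticeWords n := by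
  refine ⟨hlam ▸ lattice_rowWord t, fun i hi => ?_⟩
  rw [rowWord, SkewSYT.cell, dif_neg (by omega)]

theorem seminormalUnit_eq (hq : q ≠ 0) (hg : QGood n q) (hlam : lam.card = n) (t : SYT lam) :
    seminormalUnit n q t =
      wtProj n q (gen n q) (rowWord t) • WordSpace.of fun i : Fin n => rowWord t i :=
  youngIdempotent_smul hq hg t (fun _ hi => content_eq_ct t (hlam ▸ hi)) _

/-- The word of t is a multiple of the row reading word. Projected to the weight of t, only
components of shape `lam` of the latter survive, and `spechtVector` is the only one. -/
theorem seminormalUnit_mem (hq : q ≠ 0) (hg : QGood n q) (hlam : lam.card = n) (t : SYT lam) :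
    seminormalUnit n q t ∈ Submodule.span (Hecke n q)ᵐᵒᵖ {spechtVector n q lam} := by
  have h := heckeFam_gen (n := n) hq
  have ht := rowWord_mem_latticeWords hlam t
  have hc : cnt (rowWord t) n = lam.rowLen := funext fun a => by rw [← hlam]; exact cnt_rowWord t a
  obtain ⟨a, ha⟩ := exists_smul_of hq (hasContent_rowReading hlam) (hasContent_iff.2 (congrFun hc))
  rw [seminormalUnit_eq hq hg hlam, ← ha]
  change _ • a • rowVector n lam ∈ _
  rw [← h.sum_wtProj_smul hg (rowVector n lam), Finset.smul_sum, Finset.smul_sum]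
  refine Submodule.sum_mem _ fun r hr => ?_
  rw [Set.Finite.mem_toFinset] at hr
  by_cases h0 : wtProj n q (gen n q) (rowWord t) • a • wtProj n q (gen n q) r • rowVector n lam = 0
  · rw [h0]
    exact Submodule.zero_mem _
  · have hrc := h.cnt_eq_of_wtProj_smul_ne_zero hg subAlg_gen_eq_top hr.1 ht.1
      (h.Wt_wtProj hg hr.1 (rowVector n lam)) a h0
    have hr0 : wtProj n q (gen n q) r • rowVector n lam ≠ 0 := fun h1 => h0 (by simp [h1])
    rw [eq_rowReading hq hg hlam hr hr0 (hrc ▸ hc)]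
    exact Submodule.smul_mem _ _ (Submodule.smul_mem _ _ (Submodule.mem_span_singleton_self _))

theorem specht_eq_span (hq : q ≠ 0) (hg : QGood n q) (hlam : lam.card = n) :
    specht n q lam = Submodule.span (Hecke n q)ᵐᵒᵖ {spechtVector n q lam} := by
  refine le_antisymm (Submodule.span_le.2 ?_) (Submodule.span_le.2 ?_)
  · rintro _ ⟨t, rfl⟩
    exact seminormalUnit_mem hq hg hlam t
  · rintro _ rfl
    have hr := rowReading_mem hlam
    obtain ⟨t, ht⟩ := exists_SYT (lam := lam) (hlam ▸ hr.1)
      fun a => by rw [hlam, cnt_rowReading hlam]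
    have e : rowWord t = rowReading lam := by
      funext i
      rcases lt_or_ge i n with hi | hi
      · exact ht i (hlam ▸ hi)
      · rw [hr.2 i hi, (rowWord_mem_latticeWords hlam t).2 i hi]
    refine Submodule.subset_span ⟨t, ?_⟩
    beta_reduce
    rw [seminormalUnit_eq hq hg hlam, e]
    rfl

theorem Wt_spechtVector (hq : q ≠ 0) (hg : QGood n q) (hlam : lam.card = n) :
    Wt q (gen n q) n (rowReading lam) (spechtVector n q lam) :=
  (heckeFam_gen hq).Wt_wtProj hg (rowReading_mem hlam).1 _

theorem spechtVector_mem_wordModule (hlam : lam.card = n) :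
    spechtVector n q lam ∈ wordModule n q lam :=
  Submodule.smul_mem _ _ (of_mem_wordModule q (hasContent_rowReading hlam))

end specht

/-! ### Shuffle elements -/

section shuffle

variable {A : Type*} [Ring A] [Algebra ℂ A]

/-- The sum `1 + t (k-1) + t (k-1) t (k-2) + ⋯`. -/
def shuf (t : ℕ → A) : ℕ → A
  | 0 => 1
  | k + 1 => 1 + t k * shuf t k

/-- The product `shuf t j * shuf t (j + 1) * ⋯` of `d` factors. -/
def shufProd (t : ℕ → A) (j : ℕ) : ℕ → A
  | 0 => 1
  | d + 1 => shufProd t j d * shuf t (j + d)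

namespace HeckeFam

variable {n : ℕ} {q : ℂ} {t : ℕ → A}

theorem shift (h : HeckeFam n q t) (j : ℕ) : HeckeFam (n - j) q fun i => t (j + i) where
  q_ne := h.q_ne
  quad i hi := h.quad (j + i) (by omega)
  comm i i' hi hi' := h.comm (j + i) (j + i') (by omega) (by omega)
  braid i hi := h.braid (j + i) (by omega)

theorem shuf_mem_subAlg (t : ℕ → A) (k : ℕ) : shuf t k ∈ subAlg t (k + 1) := by
  induction k with
  | zero => exact one_mem _
  | succ k ih =>
    exact add_mem (one_mem _) (mul_mem (t_mem_subAlg (by omega)) (subAlg_mono (by omega) ih))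

theorem commute_shuf (h : HeckeFam n q t) {i k : ℕ} (hi : i + 1 < n) (hk : k < i) :
    Commute (t i) (shuf t k) :=
  (commute_subAlg (fun l hl => (h.commute_far (by omega) hi (by omega))) (shuf_mem_subAlg t k)).symm

theorem t_mul_shuf_mul_shuf (h : HeckeFam n q t) {k : ℕ} (hk : k + 1 < n) :
    t k * (shuf t k * shuf t (k + 1)) = q • (shuf t k * shuf t (k + 1)) := by
  induction k with
  | zero =>
    have := h.quad 0 hk
    simp only [shuf, mul_one, one_mul, mul_add, this]
    module
  | succ k ih =>
    have ih := ih (by omega)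
    have hc := h.commute_shuf (i := k + 1) (k := k) hk (by omega)
    have hb := h.braid k (by omega)
    have hs := h.quad (k + 1) hk
    simp only [shuf] at ih ⊢
    generalize shuf t k = Z at *
    generalize t (k + 1) = S at *
    generalize t k = T at *
    -- The first four terms form (1 + S)(1 + T Z), where S acts by q through the quadratic relation.
    -- In the last term the braid relation turns S T S into T S T and the induction hypothesis
    -- absorbs T.
    have e : (1 + T * Z) * (1 + S * (1 + T * Z)) =
        1 + T * Z + S + S * T * Z + T * S * (Z * (1 + T * Z)) := by
      have : T * S * (Z * (1 + T * Z)) = T * Z * S * (1 + T * Z) := by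
        rw [mul_assoc T Z S, ← hc.eq]; noncomm_ring
      rw [this]
      noncomm_ring
    have e2 : S * (T * S * (Z * (1 + T * Z))) = q • (T * S * (Z * (1 + T * Z))) := by
      rw [← mul_assoc, ← mul_assoc S, ← hb, mul_assoc (T * S), ih, mul_smul_comm]
    have e3 : S * (1 + T * Z + S + S * T * Z) = q • (1 + T * Z + S + S * T * Z) := by
      have e4 : S * (1 + T * Z + S + S * T * Z) = S + S * T * Z + S * S + S * S * (T * Z) := by
        noncomm_ring
      rw [e4, hs, add_mul, smul_mul_assoc, smul_mul_assoc, one_mul, ← mul_assoc]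
      module
    rw [e, mul_add, e2, e3, ← smul_add]

/-- The generator t i commutes with the factors before `shuf t i`, and the pair `shuf t i`, `shuf t
(i + 1)` absorbs it. -/
theorem t_mul_shufProd (h : HeckeFam n q t) {i j d : ℕ} (hi : i + 1 < n) (hji : j ≤ i)
    (hd : i + 1 < j + d) : t i * shufProd t j d = q • shufProd t j d := by
  induction d with
  | zero => omega
  | succ d ih =>
    rcases lt_or_ge (i + 1) (j + d) with h1 | h1
    · rw [shufProd, ← mul_assoc, ih h1, smul_mul_assoc]
    · obtain ⟨d, rfl⟩ : ∃ d', d = d' + 1 := ⟨d - 1, by omega⟩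
      obtain rfl : i = j + d := by omega
      have hc : ∀ e ≤ d, Commute (t (j + d)) (shufProd t j e) := fun e he => by
        induction e with
        | zero => exact Commute.one_right _
        | succ e ih' => exact (ih' (by omega)).mul_right (h.commute_shuf hi (by omega))
      have := h.t_mul_shuf_mul_shuf hi
      rw [shufProd, shufProd, mul_assoc, ← mul_assoc, (hc d le_rfl).eq, mul_assoc]
      rw [show j + (d + 1) = j + d + 1 by ring, this, mul_smul_comm]

end HeckeFam

/-- The `q`-factorial. -/
def qFactorial (q : ℂ) (n : ℕ) : ℂ := ∏ k ∈ Finset.range n, qInt q ((k : ℤ) + 1)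

theorem qFactorial_succ (q : ℂ) (n : ℕ) : qFactorial q (n + 1) = qFactorial q n * qInt q ((n : ℤ) + 1) :=
  Finset.prod_range_succ _ _

theorem qFactorial_ne_zero_iff {q : ℂ} {n : ℕ} : qFactorial q n ≠ 0 ↔ QGood n q := by
  rw [qFactorial, Finset.prod_ne_zero_iff]
  constructor
  · intro h k hk hkn
    have := h (k - 1) (Finset.mem_range.2 (by omega))
    rwa [Nat.cast_sub hk, Nat.cast_one, sub_add_cancel] at this
  · intro h k hk
    have := h (k + 1) (by omega) (Finset.mem_range.1 hk)
    rwa [Nat.cast_add, Nat.cast_one] at this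

section eigen

variable {q : ℂ} {t : ℕ → A} {c : A}

theorem shuf_mul (hq : q ≠ 0) {k : ℕ} (h : ∀ i < k, t i * c = q • c) :
    shuf t k * c = qInt q ((k : ℤ) + 1) • c := by
  induction k with
  | zero => simp [shuf, qInt_one hq]
  | succ k ih =>
    rw [shuf, add_mul, one_mul, mul_assoc, ih fun i hi => h i (by omega), mul_smul_comm,
      h k (by omega), Nat.cast_succ, qInt_add_one hq (k + 1)]
    module

theorem mul_shuf (hq : q ≠ 0) {k : ℕ} (h : ∀ i < k, c * t i = q • c) :
    c * shuf t k = qInt q ((k : ℤ) + 1) • c := by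
  induction k with
  | zero => simp [shuf, qInt_one hq]
  | succ k ih =>
    rw [shuf, mul_add, mul_one, ← mul_assoc, h k (by omega), smul_mul_assoc,
      ih fun i hi => h i (by omega), Nat.cast_succ, qInt_add_one hq (k + 1)]
    module

theorem shufProd_mul (hq : q ≠ 0) {d : ℕ} (h : ∀ i, i + 1 < d → t i * c = q • c) :
    shufProd t 0 d * c = qFactorial q d • c := by
  induction d with
  | zero => simp [shufProd, qFactorial]
  | succ d ih =>
    rw [shufProd, zero_add, mul_assoc, shuf_mul hq fun i hi => h i (by omega), mul_smul_comm,
      ih fun i hi => h i (by omega), smul_smul, qFactorial_succ, mul_comm]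

theorem mul_shufProd (hq : q ≠ 0) {d : ℕ} (h : ∀ i, i + 1 < d → c * t i = q • c) :
    c * shufProd t 0 d = qFactorial q d • c := by
  induction d with
  | zero => simp [shufProd, qFactorial]
  | succ d ih =>
    rw [shufProd, zero_add, ← mul_assoc, ih fun i hi => h i (by omega), smul_mul_assoc,
      mul_shuf hq fun i hi => h i (by omega), smul_smul, qFactorial_succ]

end eigen

end shuffle

section bottomToRandom

variable {n : ℕ} {q : ℂ}

theorem bottomToRandom_eq_shuf (k : ℕ) :
    bottomToRandom n q (k + 1) = shuf (fun i => T n q (i + 1)) k := by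
  induction k with
  | zero => simp [bottomToRandom, shuf]
  | succ k ih =>
    rw [shuf, ← ih, bottomToRandom, bottomToRandom, Finset.sum_Icc_succ_top (by omega), add_comm]
    congr 1
    · simp
    · rw [Finset.mul_sum]
      refine Finset.sum_congr rfl fun i hi => ?_
      rw [Finset.mem_Icc] at hi
      rw [Ico_reverse_map_succ_prod _ hi.2]

theorem Ico_bottomToRandom_prod (j d : ℕ) :
    ((List.Ico (j + 1) (j + d + 1)).map (bottomToRandom n q)).prod =
      shufProd (fun i => T n q (i + 1)) j d := by
  induction d with
  | zero => simp [shufProd]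
  | succ d ih =>
    rw [shufProd, ← ih, ← bottomToRandom_eq_shuf, ← Ico_map_succ_prod _ (by omega)]
    rfl

theorem cElt_eq_shufProd {j : ℕ} (hj : j ≤ n) :
    cElt n q j = shufProd (fun i => T n q (i + 1)) j (n - j) := by
  rw [← Ico_bottomToRandom_prod, show j + (n - j) = n by omega]
  rfl

theorem T_mul_cElt (hq : q ≠ 0) {i j : ℕ} (hji : j ≤ i) (hi : i + 1 < n) :
    T n q (i + 1) * cElt n q j = q • cElt n q j := by
  rw [cElt_eq_shufProd (by omega)]
  exact (heckeFam_T hq).t_mul_shufProd hi hji (by omega)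

end bottomToRandom

/-! ### The symmetrizer does not vanish -/

section nonvanishing

variable {n : ℕ} {q : ℂ}

/-- The span of a set of words. -/
def wordSpan (S : Set (Fin n → ℕ)) : Submodule ℂ (WordSpace n) := Submodule.span ℂ (WordSpace.of '' S)

theorem exch_mem_wordSpan {S : Set (Fin n → ℕ)} {a b : Fin n}
    (hS : ∀ w ∈ S, w ∘ Equiv.swap a b ∈ S) {v : WordSpace n} (hv : v ∈ wordSpan S) :
    exch q a b v ∈ wordSpan S := by
  have key : ∀ w ∈ S, WordSpace.of w ∈ wordSpan S := fun w hw => Submodule.subset_span ⟨w, hw, rfl⟩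
  induction hv using Submodule.span_induction with
  | mem x hx =>
    obtain ⟨w, hw, rfl⟩ := hx
    rcases lt_trichotomy (w a) (w b) with h | h | h
    · rw [exch_lt q h]; exact key _ (hS w hw)
    · rw [exch_eq q h]; exact Submodule.smul_mem _ _ (key _ hw)
    · rw [exch_gt q h]
      exact Submodule.add_mem _ (Submodule.smul_mem _ _ (key _ (hS w hw)))
        (Submodule.smul_mem _ _ (key _ hw))
  | zero => rw [map_zero]; exact Submodule.zero_mem _
  | add x y _ _ hx hy => rw [map_add]; exact Submodule.add_mem _ hx hy
  | smul c x _ hx => rw [map_smul]; exact Submodule.smul_mem _ _ hx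

theorem subAlg_smul_mem_wordSpan {S : Set (Fin n → ℕ)} {m : ℕ} (hm : m ≤ n)
    (hS : ∀ i, (hi : i + 1 < m) → ∀ w ∈ S,
      w ∘ Equiv.swap (⟨i, by omega⟩ : Fin n) ⟨i + 1, by omega⟩ ∈ S)
    {a : (Hecke n q)ᵐᵒᵖ} (ha : a ∈ HeckeFam.subAlg (gen n q) m) {v : WordSpace n}
    (hv : v ∈ wordSpan S) : a • v ∈ wordSpan S := by
  refine HeckeFam.smul_mem_of_subAlg (fun i hi y hy => ?_) ha hv
  rw [gen_smul (by omega)]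
  exact exch_mem_wordSpan (hS i hi) hy

/-- The coefficient of the word `0, 1, …, n - 1`. -/
def idCoeff (n : ℕ) : WordSpace n →ₗ[ℂ] ℂ := Finsupp.lapply (fun i => i : Fin n → ℕ)

theorem idCoeff_of (w : Fin n → ℕ) : idCoeff n (WordSpace.of w) = if w = (fun i => i : Fin n → ℕ) then 1 else 0 :=
  Finsupp.single_apply

theorem op_shuf_mem (k : ℕ) :
    op (shuf (fun i => T n q (i + 1)) k) ∈ HeckeFam.subAlg (gen n q) (k + 1) := by
  induction k with
  | zero => exact one_mem _
  | succ k ih =>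
    rw [shuf, op_add, op_mul, op_one]
    exact add_mem (one_mem _) (mul_mem (HeckeFam.subAlg_mono (by omega) ih)
      (HeckeFam.t_mem_subAlg (i := k) (by omega)))

theorem swap_apply_of_val_ne {i x : ℕ} (hi : i + 1 < n) (hx : x < n) (h1 : x ≠ i) (h2 : x ≠ i + 1) :
    Equiv.swap (⟨i, by omega⟩ : Fin n) ⟨i + 1, hi⟩ ⟨x, hx⟩ = ⟨x, hx⟩ :=
  Equiv.swap_apply_of_ne_of_ne (fun h => h1 (Fin.mk.inj h)) (fun h => h2 (Fin.mk.inj h))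

/-- The words that agree with `0, 1, …, n - 1` from the position `k` on, with small letters before. -/
def initialWords (n k : ℕ) : Set (Fin n → ℕ) :=
  {w | ∀ i : Fin n, if (i : ℕ) < k then w i < k else w i = i}

theorem initialWords_mono {k : ℕ} : initialWords n k ⊆ initialWords n (k + 1) := fun w hw i => by
  have := hw i
  split_ifs at this ⊢ <;> omega

theorem initialWords_swap {k i : ℕ} (hi : i + 1 < n) (hik : i + 1 < k) {w : Fin n → ℕ}
    (hw : w ∈ initialWords n k) :
    w ∘ Equiv.swap (⟨i, by omega⟩ : Fin n) ⟨i + 1, hi⟩ ∈ initialWords n k := by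
  rintro ⟨x, hx⟩
  by_cases h1 : x = i
  · have := hw ⟨i + 1, hi⟩
    subst h1
    simp only [Function.comp, Equiv.swap_apply_left]
    simp only [if_pos hik] at this
    rwa [if_pos (by omega)]
  · by_cases h2 : x = i + 1
    · have := hw ⟨i, by omega⟩
      subst h2
      simp only [Function.comp, Equiv.swap_apply_right]
      rw [if_pos (show i < k by omega)] at this
      rwa [if_pos hik]
    · rw [Function.comp, swap_apply_of_val_ne hi hx h1 h2]
      exact hw ⟨x, hx⟩

theorem shuf_smul_initial {k : ℕ} (hk : k < n) {v : WordSpace n}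
    (hv : v ∈ wordSpan (initialWords n k)) :
    op (shuf (fun i => T n q (i + 1)) k) • v ∈ wordSpan (initialWords n (k + 1)) ∧
      idCoeff n (op (shuf (fun i => T n q (i + 1)) k) • v) = idCoeff n v := by
  constructor
  · exact subAlg_smul_mem_wordSpan hk (fun i hi w hw => initialWords_swap (by omega) hi hw)
      (op_shuf_mem k) (Submodule.span_mono (Set.image_mono initialWords_mono) hv)
  · obtain _ | k := k
    · simp [shuf]
    rw [shuf, op_add, op_mul, op_one, add_smul, one_smul, mul_smul, map_add, add_eq_left]
    -- Since `op` reverses products, `gen n q k` acts first. It puts a letter at most k into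
    -- position k + 1, which the remaining generators do not reach, so the word 0, 1, …, n - 1
    -- cannot reappear.
    set L : Set (Fin n → ℕ) := {w | w ⟨k + 1, hk⟩ ≤ k}
    have h1 : gen n q k • v ∈ wordSpan L := by
      rw [gen_smul hk]
      induction hv using Submodule.span_induction with
      | mem x hx =>
        obtain ⟨w, hw, rfl⟩ := hx
        have e1 := hw ⟨k, by omega⟩
        have e2 := hw ⟨k + 1, hk⟩
        rw [if_pos (show k < k + 1 by omega)] at e1
        simp only [lt_irrefl, if_false] at e2
        rw [exch_lt q (e1.trans_eq e2.symm)]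
        refine Submodule.subset_span ⟨_, ?_, rfl⟩
        change w (Equiv.swap _ _ _) ≤ k
        rw [Equiv.swap_apply_right]
        omega
      | zero => rw [map_zero]; exact Submodule.zero_mem _
      | add x y _ _ hx hy => rw [map_add]; exact Submodule.add_mem _ hx hy
      | smul c x _ hx => rw [map_smul]; exact Submodule.smul_mem _ _ hx
    have h2 := subAlg_smul_mem_wordSpan (q := q) (S := L) (m := k + 1) hk.le (fun i hi w hw => by
      change w (Equiv.swap _ _ _) ≤ k
      rwa [swap_apply_of_val_ne (by omega) hk (by omega) (by omega)]) (op_shuf_mem k) h1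
    have h3 : wordSpan L ≤ LinearMap.ker (idCoeff n) := by
      refine Submodule.span_le.2 ?_
      rintro _ ⟨w, hw, rfl⟩
      rw [SetLike.mem_coe, LinearMap.mem_ker, idCoeff_of, if_neg]
      rintro rfl
      have : k + 1 ≤ k := hw
      omega
    exact h3 h2

theorem shufProd_ne_zero : shufProd (fun i => T n q (i + 1)) 0 n ≠ 0 := by
  set v : WordSpace n := WordSpace.of (fun i => i : Fin n → ℕ)
  suffices ∀ d ≤ n, op (shufProd (fun i => T n q (i + 1)) 0 d) • v ∈ wordSpan (initialWords n d) ∧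
      idCoeff n (op (shufProd (fun i => T n q (i + 1)) 0 d) • v) = 1 by
    intro h
    have h1 := (this n le_rfl).2
    rw [h, op_zero, zero_smul, map_zero] at h1
    exact zero_ne_one h1
  intro d hd
  induction d with
  | zero =>
    rw [shufProd, op_one, one_smul, idCoeff_of, if_pos rfl]
    exact ⟨Submodule.subset_span ⟨_, fun i => by simp, rfl⟩, rfl⟩
  | succ d ih =>
    obtain ⟨h1, h2⟩ := ih (by omega)
    rw [shufProd, zero_add, op_mul, mul_smul, ← h2]
    exact shuf_smul_initial hd h1

theorem exists_mul_eq_smul {c : Hecke n q} {z : ℂ}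
    (hc : ∀ i, i + 1 < n → T n q (i + 1) * c = z • c) (a : Hecke n q) : ∃ b : ℂ, a * c = b • c := by
  have ha : op a ∈ HeckeFam.subAlg (gen n q) n := subAlg_gen_eq_top ▸ Algebra.mem_top
  suffices ∀ x ∈ HeckeFam.subAlg (gen n q) n, ∃ b : ℂ, unop x * c = b • c from this _ ha
  intro x hx
  induction hx using Algebra.adjoin_induction with
  | mem x hx =>
    obtain ⟨i, hi, rfl⟩ := hx
    exact ⟨z, hc i hi⟩
  | algebraMap r => exact ⟨r, by rw [MulOpposite.algebraMap_apply, unop_op, Algebra.smul_def]⟩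
  | add x y _ _ hx hy =>
    obtain ⟨b, hb⟩ := hx
    obtain ⟨b', hb'⟩ := hy
    exact ⟨b + b', by rw [unop_add, add_mul, hb, hb', add_smul]⟩
  | mul x y _ _ hx hy =>
    obtain ⟨b, hb⟩ := hx
    obtain ⟨b', hb'⟩ := hy
    exact ⟨b * b', by rw [unop_mul, mul_assoc, hb, mul_smul_comm, hb', smul_smul]⟩

/-- The symmetrizer c spans a left ideal and satisfies c² = [n]! c. If [n]! = 0 and J is a
complement, write 1 = b c + f with f in J; then c = c f lies in J, so c = 0, against
`shufProd_ne_zero`. -/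
theorem qGood_of_isSemisimpleRing (hq : q ≠ 0) (hss : IsSemisimpleRing (Hecke n q)) : QGood n q := by
  rw [← qFactorial_ne_zero_iff]
  intro h0
  set c : Hecke n q := shufProd (fun i => T n q (i + 1)) 0 n
  have hc : ∀ i, i + 1 < n → T n q (i + 1) * c = q • c := fun i hi =>
    (heckeFam_T hq).t_mul_shufProd hi (Nat.zero_le _) (by omega)
  have hcc : c * c = 0 := by rw [shufProd_mul hq hc, h0, zero_smul]
  obtain ⟨J, hJ⟩ := exists_isCompl (Submodule.span (Hecke n q) {c})
  obtain ⟨e, he, f, hf, hef⟩ := Submodule.mem_sup.1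
    (hJ.sup_eq_top ▸ Submodule.mem_top : (1 : Hecke n q) ∈ _)
  obtain ⟨a, rfl⟩ := Submodule.mem_span_singleton.1 he
  obtain ⟨b, hb⟩ := exists_mul_eq_smul hc a
  have h1 : c * f = c := by
    rw [← eq_sub_iff_add_eq'] at hef
    rw [hef, smul_eq_mul, hb, mul_sub, mul_smul_comm, hcc, smul_zero, sub_zero, mul_one]
  have h2 : c ∈ J := by
    rw [← h1]
    exact J.smul_mem c hf
  exact shufProd_ne_zero (hJ.disjoint.le_bot ⟨Submodule.mem_span_singleton_self c, h2⟩)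

end nonvanishing

end HeckeStrip
end

noncomputable section
open scoped RightActions
namespace HeckeStrip

set_option linter.unusedSectionVars false

open MulOpposite

theorem nonempty_span_singleton_equiv {A M M' : Type*} [Ring A] [AddCommGroup M] [Module A M]
    [AddCommGroup M'] [Module A M'] {x : M} {y : M'} (h : ∀ a : A, a • x = 0 ↔ a • y = 0) :
    Nonempty (Submodule.span A {x} ≃ₗ[A] Submodule.span A {y}) := by
  have e : LinearMap.ker (LinearMap.toSpanSingleton A M x) =
      LinearMap.ker (LinearMap.toSpanSingleton A M' y) := by
    ext a
    simp only [LinearMap.mem_ker, LinearMap.toSpanSingleton_apply, h]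
  exact ⟨(LinearEquiv.ofEq _ _ (LinearMap.range_toSpanSingleton x)).symm ≪≫ₗ
    (LinearMap.quotKerEquivRange _).symm ≪≫ₗ Submodule.quotEquivOfEq _ _ e ≪≫ₗ
    LinearMap.quotKerEquivRange _ ≪≫ₗ LinearEquiv.ofEq _ _ (LinearMap.range_toSpanSingleton y)⟩

/-! ### Projection to the components of a shape -/

section shape

variable {A : Type*} [Ring A] [Algebra ℂ A]
variable {M : Type*} [AddCommGroup M] [Module ℂ M] [Module A M] [IsScalarTower ℂ A M]

open Classical in
/-- The sum of the projections to the weights of the shape `p`. -/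
def shapeProj (n : ℕ) (q : ℂ) (t : ℕ → A) (p : ℕ → ℕ) : A :=
  ∑ r ∈ (latticeWords_finite n).toFinset.filter fun r => cnt r n = p, wtProj n q t r

namespace HeckeFam

variable {n : ℕ} {q : ℂ} {t : ℕ → A} {p : ℕ → ℕ}

theorem shapeProj_smul_eq (h : HeckeFam n q t) (hg : QGood n q) (htop : subAlg t n = ⊤)
    {r : ℕ → ℕ} (hr : r ∈ latticeWords n) (hc : cnt r n = p) {u : M} (hu : Wt q t n r u) (a : A) :
    shapeProj n q t p • a • u = a • u := by
  classical
  conv_rhs => rw [← h.sum_wtProj_smul hg (a • u)]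
  rw [shapeProj, Finset.sum_smul, Finset.sum_filter]
  refine Finset.sum_congr rfl fun s hs => ?_
  rw [Set.Finite.mem_toFinset] at hs
  split_ifs with h1
  · rfl
  · by_contra h0
    exact h1 (hc ▸ h.cnt_eq_of_wtProj_smul_ne_zero hg htop hr.1 hs.1 hu a (Ne.symm h0))

theorem shapeProj_smul_eq_zero (h : HeckeFam n q t) (hg : QGood n q) (htop : subAlg t n = ⊤)
    {r : ℕ → ℕ} (hr : r ∈ latticeWords n) (hc : cnt r n ≠ p) {u : M} (hu : Wt q t n r u) (a : A) :
    shapeProj n q t p • a • u = 0 := by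
  classical
  rw [shapeProj, Finset.sum_smul]
  refine Finset.sum_eq_zero fun s hs => ?_
  obtain ⟨h1, h2⟩ := Finset.mem_filter.1 hs
  rw [Set.Finite.mem_toFinset] at h1
  by_contra h0
  exact hc (h2 ▸ (h.cnt_eq_of_wtProj_smul_ne_zero hg htop hr.1 h1.1 hu a h0).symm)

/-- A weight vector generates only vectors of its own shape, so the projection is the identity or
zero on the module it generates. -/
theorem shapeProj_smul_comm (h : HeckeFam n q t) (hg : QGood n q) (htop : subAlg t n = ⊤)
    (a : A) (x : M) : shapeProj n q t p • a • x = a • shapeProj n q t p • x := by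
  have hx := h.mem_span_latticeWords hg x
  induction hx using Submodule.span_induction with
  | mem u hu =>
    obtain ⟨r, hr, hu⟩ := hu
    by_cases hc : cnt r n = p
    · have h1 := h.shapeProj_smul_eq hg htop hr hc hu 1
      rw [one_smul] at h1
      rw [h1, h.shapeProj_smul_eq hg htop hr hc hu]
    · have h1 := h.shapeProj_smul_eq_zero hg htop hr hc hu 1
      rw [one_smul] at h1
      rw [h1, h.shapeProj_smul_eq_zero hg htop hr hc hu, smul_zero]
  | zero => simp only [smul_zero]
  | add u w _ _ hu hw => simp only [smul_add, hu, hw]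
  | smul c u _ hu => simp only [smul_smul_comm' c, hu]

theorem shapeProj_smul_shapeProj (h : HeckeFam n q t) (hg : QGood n q) (htop : subAlg t n = ⊤)
    (x : M) : shapeProj n q t p • shapeProj n q t p • x = shapeProj n q t p • x := by
  have hx := h.mem_span_latticeWords hg x
  induction hx using Submodule.span_induction with
  | mem u hu =>
    obtain ⟨r, hr, hu⟩ := hu
    by_cases hc : cnt r n = p
    · rw [h.shapeProj_smul_eq hg htop hr hc hu]
    · have h1 := h.shapeProj_smul_eq_zero hg htop hr hc hu 1
      rw [one_smul] at h1
      rw [h1, smul_zero]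
  | zero => simp only [smul_zero]
  | add u w _ _ hu hw => simp only [smul_add, hu, hw]
  | smul c u _ hu => simp only [smul_smul_comm' c, hu]

end HeckeFam

end shape

/-! ### The isotypic projector -/

section isotypic

variable {n : ℕ} {q : ℂ} {lam : YoungDiagram}
variable {M : Type*} [AddCommGroup M] [Module ℂ M] [Module (Hecke n q)ᵐᵒᵖ M]
  [IsScalarTower ℂ (Hecke n q)ᵐᵒᵖ M]

/-- A weight vector of shape `lam` generates a copy of the Specht module. -/
theorem nonempty_equiv_specht (hq : q ≠ 0) (hg : QGood n q) (hlam : lam.card = n) {r : ℕ → ℕ}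
    (hr : r ∈ latticeWords n) (hc : cnt r n = lam.rowLen) {y : M} (hy : Wt q (gen n q) n r y)
    (h0 : y ≠ 0) :
    Nonempty (Submodule.span (Hecke n q)ᵐᵒᵖ {y} ≃ₗ[(Hecke n q)ᵐᵒᵖ] specht n q lam) := by
  have h := heckeFam_gen (n := n) hq
  have hr0 := rowReading_mem hlam
  obtain ⟨a, b, h1, h2⟩ := h.transport hg hr hr0 (hc.trans (cnt_rowReading hlam).symm) hy
  have e : Submodule.span (Hecke n q)ᵐᵒᵖ {y} = Submodule.span (Hecke n q)ᵐᵒᵖ {a • y} := by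
    refine le_antisymm (Submodule.span_le.2 ?_) (Submodule.span_le.2 ?_)
    · rintro _ rfl
      exact Submodule.mem_span_singleton.2 ⟨b, h2⟩
    · rintro _ rfl
      exact Submodule.mem_span_singleton.2 ⟨a, rfl⟩
  rw [e, specht_eq_span hq hg hlam]
  have ha : a • y ≠ 0 := fun h3 => h0 (by rw [← h2, h3, smul_zero])
  have hw := Wt_spechtVector hq hg hlam
  exact nonempty_span_singleton_equiv fun c =>
    ⟨h.annihilator_le hg subAlg_gen_eq_top hr0 h1 hw ha,
      h.annihilator_le hg subAlg_gen_eq_top hr0 hw h1 (spechtVector_ne_zero hq hg hlam)⟩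

theorem shapeProj_smul_specht (hq : q ≠ 0) (hg : QGood n q) (hlam : lam.card = n) {x : WordSpace n}
    (hx : x ∈ specht n q lam) : shapeProj n q (gen n q) lam.rowLen • x = x := by
  rw [specht_eq_span hq hg hlam] at hx
  obtain ⟨a, rfl⟩ := Submodule.mem_span_singleton.1 hx
  exact (heckeFam_gen hq).shapeProj_smul_eq hg subAlg_gen_eq_top (rowReading_mem hlam)
    (cnt_rowReading hlam) (Wt_spechtVector hq hg hlam) a

instance (n : ℕ) (q : ℂ) : IsScalarTower ℂ (Hecke n q)ᵐᵒᵖ (Hecke n q) where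
  smul_assoc c a x := by
    rw [MulOpposite.smul_eq_mul_unop, MulOpposite.smul_eq_mul_unop, unop_smul, mul_smul_comm]

/-- This existence is what gives the `epsilon` in `isotypicProjector` its defining property.
Components of shape `lam` generate copies of the Specht module, and conversely the projection is the
identity on every copy. -/
theorem isIsotypicProjector_shapeProj (hq : q ≠ 0) (hg : QGood n q) (hlam : lam.card = n) :
    IsIsotypicProjector (Hecke n q) (specht n q lam)
      (unop (shapeProj n q (gen n q) lam.rowLen)) := by
  have h := heckeFam_gen (n := n) hq
  classical
  have htop := subAlg_gen_eq_top (n := n) (q := q)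
  set P := shapeProj n q (gen n q) lam.rowLen with hP
  have hmul : ∀ x : Hecke n q, x * unop P = P • x := fun x => rfl
  refine ⟨?_, fun x => ?_, fun x => ?_⟩
  · have := h.shapeProj_smul_shapeProj (p := lam.rowLen) hg htop (1 : Hecke n q)
    rwa [← hP, ← hmul, ← hmul, one_mul] at this
  · have := h.shapeProj_smul_comm (p := lam.rowLen) hg htop (op x) (1 : Hecke n q)
    rw [← hP, ← hmul, ← hmul, one_mul, op_smul_eq_mul, one_mul, op_smul_eq_mul] at this
    exact this
  · rw [hmul]
    constructor
    · intro hx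
      rw [← hx, hP, shapeProj, Finset.sum_smul]
      refine Submodule.sum_mem _ fun r hr => ?_
      obtain ⟨h1, h2⟩ := Finset.mem_filter.1 hr
      rw [Set.Finite.mem_toFinset] at h1
      by_cases h0 : wtProj n q (gen n q) r • x = 0
      · rw [h0]; exact Submodule.zero_mem _
      · exact le_sSup (a := Submodule.span (Hecke n q)ᵐᵒᵖ {wtProj n q (gen n q) r • x})
          (nonempty_equiv_specht hq hg hlam h1 h2 (h.Wt_wtProj hg h1.1 x) h0)
          (Submodule.mem_span_singleton_self _)
    · let K : Submodule (Hecke n q)ᵐᵒᵖ (Hecke n q) :=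
        { carrier := {y | P • y = y}
          zero_mem' := smul_zero P
          add_mem' := fun {a b} ha hb => by
            rw [Set.mem_ofPred_eq] at ha hb ⊢
            rw [smul_add, ha, hb]
          smul_mem' := fun c y hy => by
            rw [Set.mem_ofPred_eq] at hy ⊢
            rw [h.shapeProj_smul_comm hg htop, hy] }
      intro hx
      suffices isotypicComponent (Hecke n q)ᵐᵒᵖ (Hecke n q) (specht n q lam) ≤ K from this hx
      refine sSup_le ?_
      rintro m ⟨e⟩ y hy
      change P • y = y
      have h1 : P • e ⟨y, hy⟩ = e ⟨y, hy⟩ :=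
        Subtype.ext (shapeProj_smul_specht hq hg hlam (e ⟨y, hy⟩).2)
      rw [← map_smul] at h1
      exact Subtype.ext_iff.1 (e.injective h1)

/-- The isotypic projector annihilates the vectors whose orbits have no components of shape
`lam`. -/
theorem isotypicProjector_smul_eq_zero (hq : q ≠ 0) (hg : QGood n q) (hlam : lam.card = n) {v : M}
    (hv : ∀ a : (Hecke n q)ᵐᵒᵖ, wtProj n q (gen n q) (rowReading lam) • a • v = 0) :
    op (isotypicProjector n q lam) • v = 0 := by
  have hp : IsIsotypicProjector (Hecke n q) (specht n q lam) (isotypicProjector n q lam) :=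
    Classical.epsilon_spec ⟨_, isIsotypicProjector_shapeProj hq hg hlam⟩
  -- The projector lies in the isotypic component, so it suffices that F vanishes on each right
  -- ideal isomorphic to the Specht module. There it sends the generator to a vector of the row
  -- reading weight in the orbit of v, which is 0 by `hv`.
  let F : Hecke n q →ₗ[(Hecke n q)ᵐᵒᵖ] M :=
    { toFun := fun x => op x • v
      map_add' := fun x y => by rw [op_add, add_smul]
      map_smul' := fun a x => by
        rw [MulOpposite.smul_eq_mul_unop, op_mul, op_unop, mul_smul]; rfl }
  suffices isotypicComponent (Hecke n q)ᵐᵒᵖ (Hecke n q) (specht n q lam) ≤ LinearMap.ker F from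
    this ((hp.range _).1 hp.idem)
  refine sSup_le ?_
  rintro m ⟨e⟩
  let G : specht n q lam →ₗ[(Hecke n q)ᵐᵒᵖ] M := F ∘ₗ m.subtype ∘ₗ e.symm.toLinearMap
  have hmem : spechtVector n q lam ∈ specht n q lam := by
    rw [specht_eq_span hq hg hlam]
    exact Submodule.mem_span_singleton_self _
  have h1 : wtProj n q (gen n q) (rowReading lam) • (⟨_, hmem⟩ : specht n q lam) = ⟨_, hmem⟩ :=
    Subtype.ext (HeckeFam.wtProj_smul_self (rowReading_mem hlam).1 (Wt_spechtVector hq hg hlam)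
      fun i _ => rfl)
  have h2 : G ⟨_, hmem⟩ = 0 := by
    rw [← h1, map_smul]
    exact hv (op (e.symm ⟨_, hmem⟩ : Hecke n q))
  have h3 : ∀ z, G z = 0 := fun z => by
    have hz : (z : WordSpace n) ∈ Submodule.span (Hecke n q)ᵐᵒᵖ {spechtVector n q lam} :=
      specht_eq_span hq hg hlam ▸ z.2
    obtain ⟨a, ha⟩ := Submodule.mem_span_singleton.1 hz
    have : z = a • ⟨_, hmem⟩ := Subtype.ext ha.symm
    rw [this, map_smul, h2, smul_zero]
  intro y hy
  have := h3 (e ⟨y, hy⟩)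
  simpa [G] using this

end isotypic

end HeckeStrip
end

noncomputable section
open scoped RightActions
namespace HeckeStrip

set_option linter.unusedSectionVars false

open MulOpposite

/-- The target is cyclic, so it is enough to reach its generator. -/
theorem surjective_toModule {A ι M : Type*} [Ring A] [DecidableEq ι] {S : ι → Type*}
    [∀ i, AddCommGroup (S i)] [∀ i, Module A (S i)] [AddCommGroup M] [Module A M] {y : M}
    (f : ∀ i, S i →ₗ[A] Submodule.span A {y})
    (hy : y ∈ ⨆ i, LinearMap.range ((Submodule.span A {y}).subtype ∘ₗ f i)) :
    Function.Surjective (DirectSum.toModule A ι _ f) := by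
  have hle : ⨆ i, LinearMap.range ((Submodule.span A {y}).subtype ∘ₗ f i) ≤
      LinearMap.range ((Submodule.span A {y}).subtype ∘ₗ DirectSum.toModule A ι _ f) := by
    refine iSup_le fun i => ?_
    rintro _ ⟨x, rfl⟩
    exact ⟨DirectSum.lof A ι S i x, by simp⟩
  obtain ⟨x, hx⟩ := hle hy
  rintro ⟨z, hz⟩
  obtain ⟨a, rfl⟩ := Submodule.mem_span_singleton.1 hz
  refine ⟨a • x, Subtype.ext ?_⟩
  rw [map_smul]
  exact congrArg (a • ·) hx

/-! ### The concatenation operator -/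

section phi

variable {j n : ℕ} {q : ℂ} {mu lam : YoungDiagram} (t : SkewSYT mu lam)

/-- The word `w` followed by the rows of `t`. -/
def extWord (j : ℕ) {mu lam : YoungDiagram} (t : SkewSYT mu lam) (w : Fin j → ℕ) (i : ℕ) : ℕ :=
  if h : i < j then w ⟨i, h⟩ else (t.cell (i + 1)).1

theorem phi_of (w : Fin j → ℕ) :
    phi j n t (WordSpace.of w) = WordSpace.of fun i : Fin n => extWord j t w i :=
  WordSpace.lift_of _ _

theorem phi_gen_smul (hjn : j ≤ n) {i : ℕ} (hi : i + 1 < j) (v : WordSpace j) :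
    phi j n t (gen j q i • v) = gen n q i • phi j n t v := by
  rw [gen_smul hi, gen_smul (hi.trans_le hjn)]
  suffices phi j n t ∘ₗ exch q (⟨i, by omega⟩ : Fin j) ⟨i + 1, hi⟩ =
      exch q (⟨i, by omega⟩ : Fin n) ⟨i + 1, by omega⟩ ∘ₗ phi j n t from
    congrArg (fun f => f v) this
  refine WordSpace.hom_ext fun w => ?_
  rw [LinearMap.comp_apply, LinearMap.comp_apply, phi_of]
  set a : Fin j := ⟨i, by omega⟩
  set b : Fin j := ⟨i + 1, hi⟩
  set a' : Fin n := ⟨i, by omega⟩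
  set b' : Fin n := ⟨i + 1, by omega⟩
  have ha : extWord j t w a' = w a := dif_pos _
  have hb : extWord j t w b' = w b := dif_pos hi
  have hs : (fun x : Fin n => extWord j t (w ∘ Equiv.swap a b) x) =
      (fun x : Fin n => extWord j t w x) ∘ Equiv.swap a' b' := by
    funext ⟨x, hx⟩
    by_cases h1 : x = i
    · subst h1
      rw [Function.comp, Equiv.swap_apply_left, hb]
      change extWord j t _ (a : ℕ) = _
      rw [extWord, dif_pos a.2]
      change w (Equiv.swap a b a) = w b
      rw [Equiv.swap_apply_left]
    · by_cases h2 : x = i + 1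
      · subst h2
        rw [Function.comp, Equiv.swap_apply_right, ha]
        change extWord j t _ (b : ℕ) = _
        rw [extWord, dif_pos b.2]
        change w (Equiv.swap a b b) = w a
        rw [Equiv.swap_apply_right]
      · rw [Function.comp, swap_apply_of_val_ne (by omega) hx h1 h2]
        simp only [extWord]
        split_ifs with h3
        · rw [Function.comp, swap_apply_of_val_ne hi h3 h1 h2]
        · rfl
  rcases lt_trichotomy (w a) (w b) with h | h | h
  · rw [exch_lt q h, phi_of, exch_lt q (by rwa [ha, hb]), hs]
  · rw [exch_eq q h, map_smul, phi_of, exch_eq q (by rwa [ha, hb])]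
  · rw [exch_gt q h, map_add, map_smul, map_smul, phi_of, phi_of, exch_gt q (by rwa [ha, hb]), hs]

theorem phi_smul (hjn : j ≤ n) (a : (Hecke j q)ᵐᵒᵖ) :
    ∃ a' ∈ HeckeFam.subAlg (gen n q) j, ∀ v, phi j n t (a • v) = a' • phi j n t v := by
  have ha : a ∈ HeckeFam.subAlg (gen j q) j := subAlg_gen_eq_top ▸ Algebra.mem_top
  induction ha using Algebra.adjoin_induction with
  | mem x hx =>
    obtain ⟨i, hi, rfl⟩ := hx
    exact ⟨gen n q i, HeckeFam.t_mem_subAlg hi, phi_gen_smul t hjn hi⟩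
  | algebraMap c =>
    refine ⟨algebraMap ℂ _ c, Subalgebra.algebraMap_mem _ c, fun v => ?_⟩
    rw [algebraMap_smul, algebraMap_smul, map_smul]
  | add x y _ _ hx hy =>
    obtain ⟨a, ha, h1⟩ := hx
    obtain ⟨b, hb, h2⟩ := hy
    exact ⟨a + b, add_mem ha hb, fun v => by rw [add_smul, map_add, h1, h2, add_smul]⟩
  | mul x y _ _ hx hy =>
    obtain ⟨a, ha, h1⟩ := hx
    obtain ⟨b, hb, h2⟩ := hy
    exact ⟨a * b, mul_mem ha hb, fun v => by rw [mul_smul, h1, h2, mul_smul]⟩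

theorem phi_jm_smul (hjn : j ≤ n) {k : ℕ} (hk : k < j) (v : WordSpace j) :
    phi j n t (jm q (gen j q) k • v) = jm q (gen n q) k • phi j n t v := by
  induction k generalizing v with
  | zero => simp [jm]
  | succ k ih =>
    have ih := ih (by omega)
    have hg := phi_gen_smul (q := q) t hjn hk
    simp only [jm, smul_assoc, add_smul, mul_smul, LinearMap.map_smul, map_add, hg, ih]

theorem Wt_phi (hjn : j ≤ n) {r : ℕ → ℕ} {v : WordSpace j} (hv : Wt q (gen j q) j r v) :
    Wt q (gen n q) j r (phi j n t v) := fun k hk => by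
  rw [← phi_jm_smul t hjn hk, hv k hk, LinearMap.map_smul]

theorem phi_mem_wordModule (hmu : mu.card = j) (hlam : lam.card = n) (hle : mu ≤ lam)
    {v : WordSpace j} (hv : v ∈ wordModule j q mu) : phi j n t v ∈ wordModule n q lam := by
  have hjn : j ≤ n := by
    rw [← hmu, ← hlam]
    exact Finset.card_le_card (YoungDiagram.cells_subset_iff.2 hle)
  have hv' : v ∈ Submodule.span ℂ (WordSpace.of '' {w : Fin j → ℕ | HasContent mu w}) := hv
  clear hv
  induction hv' using Submodule.span_induction with
  | mem x hx =>
    obtain ⟨w, hw, rfl⟩ := hx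
    rw [phi_of]
    refine of_mem_wordModule q (hasContent_iff.2 fun a => ?_)
    have h1 : cnt (extWord j t w) j a = mu.rowLen a := by
      rw [← hw a, ← cnt_eq_card_fin]
      congr 1
      ext i
      simp [extWord]
    have h2 := t.card_row hle a
    rw [← h1, hmu, hlam] at h2
    rw [← h2, cnt, cnt, show Finset.range n = Finset.range j ∪ Finset.Ico j n by
        ext; simp; omega, Finset.filter_union,
      Finset.card_union_of_disjoint, add_comm]
    · congr 2
      refine Finset.filter_congr fun i hi => ?_
      rw [extWord, dif_neg (by have := (Finset.mem_Ico.1 hi).1; omega)]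
    · refine Finset.disjoint_filter_filter (Finset.disjoint_left.2 fun i h3 h4 => ?_)
      have := Finset.mem_range.1 h3
      have := (Finset.mem_Ico.1 h4).1
      omega
  | zero => rw [map_zero]; exact Submodule.zero_mem _
  | add x y _ _ hx hy => rw [map_add]; exact Submodule.add_mem _ hx hy
  | smul c x _ hx => rw [map_smul]; exact smul_mem_complex _ c hx

end phi

/-! ### The symmetrized vector -/

section symmetrizer

variable {j n : ℕ} {q : ℂ}

theorem QGood.mono {m n : ℕ} {q : ℂ} (hg : QGood n q) (h : m ≤ n) : QGood m q :=
  fun k hk hkm => hg k hk (hkm.trans h)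

/-- The symmetrizer of the positions from `j` on. -/
def tailSym (n : ℕ) (q : ℂ) (j : ℕ) : (Hecke n q)ᵐᵒᵖ := shufProd (fun i => gen n q (j + i)) 0 (n - j)

theorem gen_mul_tailSym (hq : q ≠ 0) {k : ℕ} (hjk : j ≤ k) (hk : k + 1 < n) :
    gen n q k * tailSym n q j = q • tailSym n q j := by
  have := ((heckeFam_gen (n := n) hq).shift j).t_mul_shufProd (i := k - j) (j := 0) (d := n - j)
    (by omega) (Nat.zero_le _) (by omega)
  rwa [Nat.add_sub_cancel' hjk] at this

/-- In the opposite algebra T_i C_j = q C_j becomes absorption from the right. At the cost of a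
nonzero scalar, vectors may thus be symmetrized in the tail before C_j is applied. -/
theorem op_cElt_mul_tailSym (hq : q ≠ 0) :
    op (cElt n q j) * tailSym n q j = qFactorial q (n - j) • op (cElt n q j) := by
  refine mul_shufProd hq fun i hi => ?_
  rw [gen, ← op_mul, T_mul_cElt hq (by omega) (by omega), op_smul]

theorem commute_tailSym (hq : q ≠ 0) (hjn : j ≤ n) {a : (Hecke n q)ᵐᵒᵖ}
    (ha : a ∈ HeckeFam.subAlg (gen n q) j) : Commute a (tailSym n q j) := by
  have h := heckeFam_gen (n := n) hq
  refine HeckeFam.commute_subAlg (fun i hi => ?_) ha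
  have hs : ∀ k, k < n - j → Commute (gen n q i) (shuf (fun i => gen n q (j + i)) k) := fun k hk =>
    (HeckeFam.commute_subAlg (fun l hl => (h.commute_far (by omega) (by omega) (by omega)))
      (HeckeFam.shuf_mem_subAlg _ k)).symm
  have hp : ∀ d, d ≤ n - j → Commute (gen n q i) (shufProd (fun i => gen n q (j + i)) 0 d) :=
    fun d hd => by
      induction d with
      | zero => exact Commute.one_right _
      | succ d ih => exact (ih (by omega)).mul_right (hs _ (by omega))
  exact hp _ le_rfl

theorem jm_mem_subAlg {A : Type*} [Ring A] [Algebra ℂ A] (q : ℂ) (t : ℕ → A) (k : ℕ) :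
    jm q t k ∈ HeckeFam.subAlg t (k + 1) := by
  induction k with
  | zero => exact zero_mem _
  | succ k ih =>
    have h1 := HeckeFam.t_mem_subAlg (t := t) (show k + 1 < k + 1 + 1 by omega)
    exact Subalgebra.smul_mem _
      (add_mem (mul_mem (mul_mem h1 (HeckeFam.subAlg_mono (by omega) ih)) h1) h1) _

variable {mu lam : YoungDiagram} (t : SkewSYT mu lam)

/-- The vector that generates the module of the concatenations, symmetrized in the tail. -/
def stripVector (j n : ℕ) (q : ℂ) {mu lam : YoungDiagram} (t : SkewSYT mu lam) : WordSpace n :=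
  tailSym n q j • phi j n t (spechtVector j q mu)

theorem stripVector_mem (hmu : mu.card = j) (hlam : lam.card = n) (hle : mu ≤ lam) :
    stripVector j n q t ∈ wordModule n q lam :=
  Submodule.smul_mem _ _ (phi_mem_wordModule t hmu hlam hle (spechtVector_mem_wordModule hmu))

theorem gen_smul_stripVector (hq : q ≠ 0) {k : ℕ} (hjk : j ≤ k) (hk : k + 1 < n) :
    gen n q k • stripVector j n q t = q • stripVector j n q t := by
  rw [stripVector, smul_smul, gen_mul_tailSym hq hjk hk, smul_assoc]

theorem Wt_stripVector (hq : q ≠ 0) (hg : QGood n q) (hjn : j ≤ n) (hmu : mu.card = j) :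
    Wt q (gen n q) j (rowReading mu) (stripVector j n q t) :=
  HeckeFam.Wt_of_commute (Wt_phi t hjn (Wt_spechtVector hq (hg.mono hjn) hmu)) fun k hk =>
    (commute_tailSym hq hjn (HeckeFam.subAlg_mono hk (jm_mem_subAlg q _ k))).symm

/-- Insert the tail symmetrizer, then commute it past the action on the first j positions, so that
it meets the image of the generator of the Specht module. -/
theorem phi_smul_cElt_mem (hq : q ≠ 0) (hg : QGood n q) (hjn : j ≤ n) (hmu : mu.card = j)
    {u : WordSpace j} (hu : u ∈ specht j q mu) :
    op (cElt n q j) • phi j n t u ∈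
      Submodule.span (Hecke n q)ᵐᵒᵖ {stripVector j n q t} := by
  rw [specht_eq_span hq (hg.mono hjn) hmu] at hu
  obtain ⟨a, rfl⟩ := Submodule.mem_span_singleton.1 hu
  obtain ⟨a', ha', h1⟩ := phi_smul t hjn a
  have h2 := qFactorial_ne_zero_iff.2 (hg.mono (Nat.sub_le n j))
  rw [h1, ← one_smul ℂ (op (cElt n q j)), ← inv_mul_cancel₀ h2, mul_smul,
    ← op_cElt_mul_tailSym hq, smul_assoc, mul_smul, smul_smul (tailSym n q j),
    ← (commute_tailSym hq hjn ha').eq, mul_smul]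
  exact smul_mem_complex _ _ (Submodule.smul_mem _ _ (Submodule.smul_mem _ _
    (Submodule.mem_span_singleton_self _)))

variable {r : ℕ → ℕ}

/-- On the first j positions the component has both the weight r and the weight of Y, so a
disagreement would make it zero. -/
theorem eq_rowReading_of_component (hq : q ≠ 0) (hg : QGood n q) (hjn : j ≤ n) (hmu : mu.card = j)
    (hr : r ∈ latticeWords n) (h0 : wtProj n q (gen n q) r • stripVector j n q t ≠ 0) {i : ℕ}
    (hi : i < j) : r i = rowReading mu i := by
  have h := heckeFam_gen (n := n) hq
  by_contra hne
  refine h0 (HeckeFam.Wt_eq_zero hq hg hjn (hr.1.mono hjn) (rowReading_mem hmu).1 ⟨i, hi, hne⟩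
    (HeckeFam.Wt_mono (h.Wt_wtProj hg hr.1 _) hjn) fun k hk => ?_)
  rw [h.Wt_wtProj hg hr.1 _ k (by omega), ← h.wtProj_jm_smul hg (by omega) hr,
    Wt_stripVector t hq hg hjn hmu k hk, smul_smul_comm']

theorem isHorizontalStrip_of_component (hq : q ≠ 0) (hg : QGood n q) (hjn : j ≤ n)
    (hmu : mu.card = j) (hr : r ∈ latticeWords n)
    (h0 : wtProj n q (gen n q) r • stripVector j n q t ≠ 0) {nu : YoungDiagram}
    (hc : cnt r n = nu.rowLen) : IsHorizontalStrip mu nu := by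
  have h1 : cnt r j = mu.rowLen := by
    rw [← cnt_rowReading hmu]
    exact cnt_congr fun i hi => eq_rowReading_of_component t hq hg hjn hmu hr h0 hi
  refine isHorizontalStrip_of_rowLen (fun a => ?_) fun a => ?_
  · rw [← h1, ← hc]
    exact cnt_mono r a hjn
  · rw [← h1, ← hc]
    exact (heckeFam_gen hq).horizontal_of_invariant hg hjn le_rfl
      (fun k hk hk' => gen_smul_stripVector t hq hk hk') hr h0 a

/-- Nonzero components of one shape agree on the first j letters, so their words are connected by
exchanges in the tail, where Y is invariant. This is why each S^nu is needed only once. -/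
theorem exists_smul_of_component (hq : q ≠ 0) (hg : QGood n q) (hjn : j ≤ n)
    (hmu : mu.card = j) (hr : r ∈ latticeWords n)
    (h0 : wtProj n q (gen n q) r • stripVector j n q t ≠ 0) {r' : ℕ → ℕ} (hr' : r' ∈ latticeWords n)
    (h0' : wtProj n q (gen n q) r' • stripVector j n q t ≠ 0) (hc : cnt r n = cnt r' n) :
    ∃ a : (Hecke n q)ᵐᵒᵖ, wtProj n q (gen n q) r' • stripVector j n q t =
      a • wtProj n q (gen n q) r • stripVector j n q t := by
  have hP := (heckeFam_gen hq).swapClosed_component hg le_rfl (j := j)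
    (Y := stripVector j n q t) (fun k hk hk' => gen_smul_stripVector t hq hk hk') r
  refine (hP.connected le_rfl hr.1 hr'.1 (fun i hi => ?_) hc ⟨hr, 1, (one_smul _ _).symm⟩).2
  rcases hi with hi | hi
  · rw [eq_rowReading_of_component t hq hg hjn hmu hr h0 hi,
      eq_rowReading_of_component t hq hg hjn hmu hr' h0' hi]
  · rw [hr.2 i hi, hr'.2 i hi]

/-- The components of the shape `nu` are contained in the image of one Specht module. -/
theorem exists_hom_specht (hq : q ≠ 0) (hg : QGood n q) (hjn : j ≤ n) (hmu : mu.card = j)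
    {nu : YoungDiagram} (hnu : nu.card = n) :
    ∃ f : specht n q nu →ₗ[(Hecke n q)ᵐᵒᵖ] Submodule.span (Hecke n q)ᵐᵒᵖ {stripVector j n q t},
      ∀ r ∈ latticeWords n, cnt r n = nu.rowLen →
        ∃ x, (f x : WordSpace n) = wtProj n q (gen n q) r • stripVector j n q t := by
  by_cases hex : ∃ r ∈ latticeWords n, cnt r n = nu.rowLen ∧
      wtProj n q (gen n q) r • stripVector j n q t ≠ 0
  · obtain ⟨r₀, hr₀, hc₀, h0⟩ := hex
    obtain ⟨e⟩ := nonempty_equiv_specht hq hg hnu hr₀ hc₀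
      ((heckeFam_gen hq).Wt_wtProj hg hr₀.1 _) h0
    refine ⟨Submodule.inclusion (Submodule.span_le.2 ?_) ∘ₗ e.symm.toLinearMap, fun r hr hc => ?_⟩
    · rintro _ rfl
      exact Submodule.smul_mem _ _ (Submodule.mem_span_singleton_self _)
    · by_cases h1 : wtProj n q (gen n q) r • stripVector j n q t = 0
      · exact ⟨0, by rw [map_zero, h1]; rfl⟩
      · obtain ⟨a, ha⟩ := exists_smul_of_component t hq hg hjn hmu hr₀ h0 hr h1 (hc₀.trans hc.symm)
        refine ⟨e ⟨_, Submodule.mem_span_singleton.2 ⟨a, ha.symm⟩⟩, ?_⟩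
        simp
  · refine ⟨0, fun r hr hc => ⟨0, ?_⟩⟩
    by_contra h1
    exact hex ⟨r, hr, hc, fun h2 => h1 h2.symm⟩

theorem wtProj_smul_eq_zero_of_not_strip (hq : q ≠ 0) (hg : QGood n q) (hjn : j ≤ n)
    (hmu : mu.card = j) (hlam : lam.card = n) (hns : ¬ IsHorizontalStrip mu lam)
    (a : (Hecke n q)ᵐᵒᵖ) :
    wtProj n q (gen n q) (rowReading lam) • a • stripVector j n q t = 0 := by
  have h := heckeFam_gen (n := n) hq
  rw [← h.sum_wtProj_smul hg (stripVector j n q t), Finset.smul_sum, Finset.smul_sum]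
  refine Finset.sum_eq_zero fun r hr => ?_
  rw [Set.Finite.mem_toFinset] at hr
  by_contra h0
  have h1 : wtProj n q (gen n q) r • stripVector j n q t ≠ 0 := fun h1 => h0 (by simp [h1])
  have hc := h.cnt_eq_of_wtProj_smul_ne_zero hg subAlg_gen_eq_top hr.1 (rowReading_mem hlam).1
    (h.Wt_wtProj hg hr.1 _) a h0
  exact hns (isHorizontalStrip_of_component t hq hg hjn hmu hr h1
    (hc.symm.trans (cnt_rowReading hlam)))

end symmetrizer

end HeckeStrip
end

/-! ### The Horizontal Strip Lemma -/

open HeckeStrip in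
open scoped RightActions DirectSum in
theorem mainTheorem10 (n j : ℕ) (q : ℂ) (hq : q ≠ 0) (hss : IsSemisimpleRing (Hecke n q))
    (lam mu : YoungDiagram) (hlam : lam.card = n) (hmu : mu.card = j) (hle : mu ≤ lam)
    (t : SkewSYT mu lam) :
    (∃ N : Submodule (Hecke n q)ᵐᵒᵖ (WordSpace n),
      N ≤ wordModule n q lam ∧
      (∀ u ∈ specht j q mu, phi j n t u <• cElt n q j ∈ N) ∧
      ∃ f : (⨁ nu : {nu : YoungDiagram // nu.card = n ∧ IsHorizontalStrip mu nu},
            specht n q nu.1) →ₗ[(Hecke n q)ᵐᵒᵖ] N,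
        Function.Surjective f) ∧
    (¬ IsHorizontalStrip mu lam →
      ∀ u ∈ specht j q mu,
        (phi j n t u <• cElt n q j) <• isotypicProjector n q lam = 0) := by
  classical
  have hg : QGood n q := qGood_of_isSemisimpleRing hq hss
  have hjn : j ≤ n := by
    rw [← hmu, ← hlam]
    exact Finset.card_le_card (YoungDiagram.cells_subset_iff.2 hle)
  refine ⟨⟨Submodule.span _ {stripVector j n q t}, ?_, ?_, ?_⟩, fun hns u hu => ?_⟩
  · refine Submodule.span_le.2 ?_
    rintro _ rfl
    exact stripVector_mem t hmu hlam hle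
  · exact fun u hu => phi_smul_cElt_mem t hq hg hjn hmu hu
  · choose f hf using fun nu : {nu : YoungDiagram // nu.card = n ∧ IsHorizontalStrip mu nu} =>
      exists_hom_specht t hq hg hjn hmu nu.2.1
    refine ⟨DirectSum.toModule _ _ _ f, surjective_toModule f ?_⟩
    -- The generator is replaced by the sum of its weight components; each nonzero one lies in the
    -- range of the map for its shape, which is a horizontal strip over `mu`.
    refine (congrArg (· ∈ ⨆ nu, LinearMap.range (Submodule.subtype _ ∘ₗ f nu))
      ((heckeFam_gen hq).sum_wtProj_smul hg (stripVector j n q t))).mp ?_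
    refine Submodule.sum_mem _ fun r hr => ?_
    rw [Set.Finite.mem_toFinset] at hr
    by_cases h0 : wtProj n q (gen n q) r • stripVector j n q t = 0
    · rw [h0]; exact Submodule.zero_mem _
    · obtain ⟨nu, hnu, hrow⟩ := exists_youngDiagram hr.1
      have hc : cnt r n = nu.rowLen := funext fun a => (hrow a).symm
      obtain ⟨x, hx⟩ := hf
        ⟨nu, hnu, isHorizontalStrip_of_component t hq hg hjn hmu hr h0 hc⟩ r hr hc
      exact Submodule.mem_iSup_of_mem _ ⟨x, hx⟩
  · refine isotypicProjector_smul_eq_zero hq hg hlam fun a => ?_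
    obtain ⟨b, hb⟩ := Submodule.mem_span_singleton.1 (phi_smul_cElt_mem t hq hg hjn hmu hu)
    rw [← hb, smul_smul a b]
    exact wtProj_smul_eq_zero_of_not_strip t hq hg hjn hmu hlam hns _
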